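/- Let $\mathcal T:(0,\infty)\to\mathbb R$ be a real-analytic tension with $\mathcal T(r)>0$ and $\mathcal T'(r)>0$ for all $r>0$, and put $T(r)=\mathcal T(r)/r$. Write $\mathbb T=\mathbb R/2\pi\mathbb Z$ and $\widehat f(k)=\frac1{2\pi}\int_{\mathbb T}f(s)e^{-iks}\,ds$. For $f:\mathbb T\to\mathbb C$ let $\|f\|_{\dot A}:=\sum_{k\in\mathbb Z}|k||\widehat f(k)|$, and for $F:[0,\infty)\times\mathbb T\to\mathbb C$ let $$\|F\|_W:=\sup_{t\ge0}\sum_{k\in\mathbb Z}|\widehat F(t,k)||k|+\sup_{t\ge0,\;m\in\mathbb Z_{\ge0}}\ \sum_{2^{m-1}\le|k|\le2^{m+1}}|\widehat F(t,k)||k|(1+|k|t)^{2/3}.$$ The two-dimensional Peskin problem (equal viscosities) is $$\partial_t\mathcal X(t,s)=\frac1{4\pi}\,\mathrm{p.v.}\!\int_{\mathbb T}\operatorname{Re}\Big[\frac{\mathcal X'(t,r)^2}{(\mathcal X(t,r)-\mathcal X(t,s))^2}\Big](\mathcal X(t,r)-\mathcal X(t,s))\,T(|\mathcal X'(t,r)|)\,dr,\qquad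 \mathcal X(0,s)=\mathcal X_0(s),$$ where $'$ is the derivative in the space variable. A solution is a continuous function $\mathcal X:[0,\infty)\times\mathbb T\to\mathbb C$, of class $C^1$ in $s$ for each $t\ge 0$, with $\mathcal X(0,\cdot)=\mathcal X_0$, such that for all $t>0$ and all $s$ the principal value exists, $\mathcal X(\cdot,s)$ is differentiable at $t$, and the equation holds. Theorem. There are constants $\varepsilon_0,C,c>0$, depending only on $\mathcal T$, such that for every $0<\varepsilon\le\varepsilon_0$ and every continuous $\mathcal X_0:\mathbb T\to\mathbb C$ with $\|\mathcal X_0-e^{is}\|_{\dot A}\le\varepsilon$ there is a unique solution $\mathcal X$ of the form $$\mathcal X(t,s)=a_0(t)+a_1(t)e^{is}+\mathcal Y(t,s),\qquad \widehat{\mathcal Y}(t,0)=\widehat{\mathcal Y}(t,1)=0,\qquad \|\mathcal Y\|_W\le C\varepsilon .$$ This solution is of class $C^2$ in $s$ for every $t>0$. The limits $\widetilde a_0=\lim_{t\to\infty}a_0(t)$ and $\widetilde a_1=\lim_{t\to\infty}a_1(t)$ exist, $\widetilde a_1\neq0$, and $\mathcal X$ converges exponentially to the translated circle $\widetilde a_0+\widetilde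 a_1e^{is}$: for all $t\ge0$, $$\sup_s|\mathcal X(t,s)-\widetilde a_0-\widetilde a_1e^{is}|\le Ce^{-ct}\quad\text{and}\quad\|\mathcal X(t,\cdot)-\widetilde a_0-\widetilde a_1e^{is}\|_{\dot A}\le Ce^{-ct}.$$ -/

import Mathlib

open Filter Topology MeasureTheory Set
open scoped ENNReal

namespace Peskin

noncomputable section

/-- The `k`-th Fourier coefficient `(1 / 2π) ∫_{0}^{2π} f(s) e^{-iks} ds` of a `2π`-periodic
function. -/
def coeff (f : ℝ → ℂ) (k : ℤ) : ℂ := fourierCoeffOn Real.two_pi_pos f k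

/-- The curve `s ↦ a₀ + a₁ e^{is}`: a circle with centre `a₀` and radius `|a₁|`. -/
def circleCurve (a₀ a₁ : ℂ) (s : ℝ) : ℂ := a₀ + a₁ * Complex.exp (Complex.I * s)

/-- The Wiener (semi)norm `∑ₖ |f̂(k)| |k|` of a function on the circle, with values in `[0, ∞]`. -/
def wienerNorm (f : ℝ → ℂ) : ℝ≥0∞ := ∑' k : ℤ, ‖coeff f k‖ₑ * ENNReal.ofReal |(k : ℝ)|

/-- The frequencies `k` with `|k| ∈ [2^{m-1}, 2^{m+1}]`. -/
def dyadicBlock (m : ℕ) : Set ℤ :=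
  {k | (2 : ℝ) ^ ((m : ℤ) - 1) ≤ |(k : ℝ)| ∧ |(k : ℝ)| ≤ (2 : ℝ) ^ ((m : ℤ) + 1)}

/-- The space-time norm `W`, with values in `[0, ∞]`, of `F : [0, ∞) × 𝕋 → ℂ`. -/
def wNorm (F : ℝ → ℝ → ℂ) : ℝ≥0∞ :=
  (⨆ t ∈ Ici (0 : ℝ), wienerNorm (F t)) +
    ⨆ t ∈ Ici (0 : ℝ), ⨆ m : ℕ, ∑' k : dyadicBlock m,
      ‖coeff (F t) k‖ₑ *
        ENNReal.ofReal (|((k : ℤ) : ℝ)| * (1 + |((k : ℤ) : ℝ)| * t) ^ (2 / 3 : ℝ))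

/-- The structural conditions on the tension: it is real-analytic and positive, with positive
derivative, on `(0, ∞)`. -/
structure IsTension (τ : ℝ → ℝ) : Prop where
  analytic : AnalyticOnNhd ℝ τ (Ioi 0)
  pos : ∀ r, 0 < r → 0 < τ r
  deriv_pos : ∀ r, 0 < r → 0 < deriv τ r

/-- The integrand `Re[f'(r)² / (f(r) - f(s))²] (f(r) - f(s)) T(|f'(r)|)`, with `T(ρ) = τ(ρ) / ρ`,
for the tension `τ`. -/
def integrand (τ : ℝ → ℝ) (f : ℝ → ℂ) (s r : ℝ) : ℂ :=
  (((deriv f r ^ 2 / (f r - f s) ^ 2).re : ℝ) : ℂ) * (f r - f s) *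
    ((τ ‖deriv f r‖ / ‖deriv f r‖ : ℝ) : ℂ)

/-- `V` is the principal value at `r = s` of `∫ g(r) dr` over the period `[s - π, s + π]`. -/
def HasPrincipalValue (g : ℝ → ℂ) (s : ℝ) (V : ℂ) : Prop :=
  (∀ δ ∈ Ioo 0 Real.pi, IntegrableOn g {r | δ ≤ |r - s| ∧ |r - s| ≤ Real.pi}) ∧
    Tendsto (fun δ : ℝ => ∫ r in {r : ℝ | δ ≤ |r - s| ∧ |r - s| ≤ Real.pi}, g r)
      (𝓝[>] 0) (𝓝 V)

/-- `X(t, s)`, for `t ∈ [0, ∞)` and `s ∈ ℝ / 2πℤ`, is a (global, classical) solution of the Peskin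
problem `∂ₜX = (1 / 4π) p.v. ∫ Re[X'(r)² / (X(r) - X(s))²] (X(r) - X(s)) T(|X'(r)|) dr` with
`X(0, ·) = X₀`. -/
structure IsSolution (τ : ℝ → ℝ) (X₀ : ℝ → ℂ) (X : ℝ → ℝ → ℂ) : Prop where
  periodic : ∀ t, 0 ≤ t → Function.Periodic (X t) (2 * Real.pi)
  contDiff : ∀ t, 0 ≤ t → ContDiff ℝ 1 (X t)
  continuousOn : ContinuousOn (Function.uncurry X) (Ici 0 ×ˢ univ)
  initial : ∀ s, X 0 s = X₀ s
  evolution : ∀ t, 0 < t → ∀ s, ∃ V : ℂ, HasPrincipalValue (integrand τ (X t) s) s V ∧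
    HasDerivAt (fun t' => X t' s) ((1 / (4 * Real.pi) : ℝ) * V) t

/-- `X(t, s) = a₀(t) + a₁(t) e^{is} + Y(t, s)` for `t ≥ 0`, where the Fourier modes `0` and `1` of
`Y(t, ·)` vanish. -/
def HasDecomposition (X : ℝ → ℝ → ℂ) (a₀ a₁ : ℝ → ℂ) (Y : ℝ → ℝ → ℂ) : Prop :=
  ∀ t, 0 ≤ t → (∀ s, X t s = circleCurve (a₀ t) (a₁ t) s + Y t s) ∧
    coeff (Y t) 0 = 0 ∧ coeff (Y t) 1 = 0

end

end Peskin

open scoped NNReal BoundedContinuousFunction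

namespace Peskin

noncomputable section

set_option linter.unusedSectionVars false

/-! ### Summable families -/

/-! Write the tangent as `X' = i e^{is} (1 + v)` with `v = ∑ v_n e^{ins}`, so that `(n + 1) X_{n+1}
= v_n + δ_{n0}` and `v_{-1} = 0`. The chord factors as `X(r) - X(s) = (e^{ir} - e^{is}) Q`, where
the double Fourier coefficients of `Q - 1` in the variables `s` and `r - s` are averages of the
`v_n`. Put `U = 1 + v(r)` and `E = e^{i(r-s)}`. Expanding the real part, the Peskin integrand
becomes `-(1/2) e^{is} N / (E - 1)` with `N = (E² U² / Q + Ū² Q / Q̄²) S(UŪ - 1)`, where `S` is the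
Taylor series at `w = 1` of `τ(√w) / √w`. Near `U = Q = 1` the factor `N` makes sense in the Wiener
algebra `ℓ¹(ℤ × ℤ)`. Since p.v. `∫ e^{ipα} / (e^{iα} - 1) dα` is `π` for `p ≥ 1` and `-π` for `p ≤
0`, the principal value is a signed sum of the coefficients of `N` over `p`
(`IsCurve.hasPrincipalValue`). The equation turns into the infinite system `v_n' = -(n+1)/8 · (row n
of N)`.

The linear part of row `n` involves only `v_n` and the conjugate of `v_{-n}` (`Frame.linRow_eq`). A
change of variables decouples the pairs `(n, -n)`, with relaxation rates `(c₀ + 2c₁) n / 4` for `n >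
0` and `c₀ |n| / 4` for `n < 0` (`mode_evolution`, `data_evolution`). Here `c₀ = τ(1)` and `c₀ + 2c₁
= τ'(1)`, so the two sign conditions on the tension are exactly linear stability. The mode `0` is
neutral, since circles are stationary.

The nonlinearity costs one factor `n`, which damping at a rate proportional to `|n|` gives back,
provided that the norm is `∑_n sup_t` rather than `sup_t ∑_n`. For existence, `v` is sought as a
constant (the limit circle) plus modes `e^{-μ max(|n|,1) t} g_n(t)` with `∑_n sup_t |g_n|` finite.
Such weighted families form a commutative Banach algebra, a convolution algebra twisted by a cocycle
because the weights are only subadditive; an extra degree records whether a term contains a decaying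
factor. The part of degree zero of `N` is that of a circle and contributes nothing, so the row sums
decay again (`rhs_stateEval`). For the neutral mode, Duhamel's formula is integrated from `t = ∞`,
which determines the limit circle. The nonlinear remainder has a small Lipschitz constant near `0`
(`norm_remainder_sub_le`), and the contraction principle gives `exists_state`. The exponential
weights give at once the `W` bound, the smoothness in `s` and the convergence to a circle.

For uniqueness, no decay of the second solution is known, nor is `∑_n sup_t` known to be finite for
it. The tangent modes of two solutions are therefore compared in `sup_{t,n}` on a time interval of
length at most one. The remainder is small in this norm too, because the nonlinear differences are
combinations of the differences of the variables with coefficients in the Wiener algebra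
(`exists_rhs_sub_eq`); this gives `D ≤ D / 2` for the difference
(`IsSolution.eqOn_of_wienerNorm_le`). A connectedness argument in time then yields global
uniqueness. -/

/-- Absolutely summable families with values in a Banach space. -/
def Fam (ι B : Type*) [NormedAddCommGroup B] : Type _ := lp (fun _ : ι => B) 1

namespace Fam

section Instances

variable (ι B : Type*) [NormedAddCommGroup B]

instance : NormedAddCommGroup (Fam ι B) :=
  inferInstanceAs (NormedAddCommGroup (lp (fun _ : ι => B) 1))

instance [NormedSpace ℝ B] : NormedSpace ℝ (Fam ι B) :=
  inferInstanceAs (NormedSpace ℝ (lp (fun _ : ι => B) 1))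

instance [CompleteSpace B] : CompleteSpace (Fam ι B) :=
  inferInstanceAs (CompleteSpace (lp (fun _ : ι => B) 1))

instance : CoeFun (Fam ι B) fun _ => ι → B := ⟨fun f => f.1⟩

end Instances

variable {ι κ B F : Type*} [NormedAddCommGroup B] [NormedSpace ℝ B]
  [NormedAddCommGroup F] [NormedSpace ℝ F] [CompleteSpace F]

@[simp] theorem add_apply (f g : Fam ι B) (i : ι) : (f + g) i = f i + g i := rfl

@[simp] theorem sub_apply (f g : Fam ι B) (i : ι) : (f - g) i = f i - g i := rfl

@[simp] theorem smul_apply (c : ℝ) (f : Fam ι B) (i : ι) : (c • f) i = c • f i := rfl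

theorem ext {f g : Fam ι B} (h : ∀ i, f i = g i) : f = g := Subtype.ext (funext h)

theorem summable_norm (f : Fam ι B) : Summable fun i => ‖f i‖ := by
  simpa using (lp.memℓp f).summable (by simp)

theorem norm_eq (f : Fam ι B) : ‖f‖ = ∑' i, ‖f i‖ := by
  have h := lp.norm_eq_tsum_rpow (p := 1) (by simp) (show lp (fun _ : ι => B) 1 from f)
  simp only [ENNReal.toReal_one, Real.rpow_one, div_one] at h
  exact h

theorem norm_apply_le (f : Fam ι B) (i : ι) : ‖f i‖ ≤ ‖f‖ :=
  lp.norm_apply_le_norm (by norm_num) f i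

/-- The family with a given summable sequence of norms. -/
def mk (f : ι → B) (h : Summable fun i => ‖f i‖) : Fam ι B :=
  ⟨f, memℓp_gen (by simpa using h)⟩

@[simp] theorem mk_apply (f : ι → B) (h : Summable fun i => ‖f i‖) (i : ι) : mk f h i = f i := rfl

open Classical in
/-- The family supported at a single index. -/
def single (i : ι) : B →L[ℝ] Fam ι B := lp.singleContinuousLinearMap ℝ (fun _ => B) 1 i

open Classical in
theorem single_apply (i j : ι) (b : B) : single i b j = if j = i then b else 0 := by
  classical
  refine (lp.single_apply (E := fun _ : ι => B) 1 i b j).trans ?_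
  rw [Pi.single_apply]

@[simp] theorem norm_single (i : ι) (b : B) : ‖single i b‖ = ‖b‖ := by
  classical exact lp.norm_single (E := fun _ : ι => B) (p := 1) one_pos i b

theorem hasSum_single (f : Fam ι B) : HasSum (fun i => single i (f i)) f :=
  by classical exact lp.hasSum_single (by norm_num) f

/-- One-term families span a dense subspace. Nearly every identity between operators or
homomorphisms below is reduced to one-term families in this way. -/
theorem clm_ext {φ ψ : Fam ι B →L[ℝ] F} (h : ∀ i b, φ (single i b) = ψ (single i b)) : φ = ψ := by
  ext f
  have h1 := (hasSum_single f).mapL φ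
  have h2 := (hasSum_single f).mapL ψ
  simp only [h] at h1
  exact h1.unique h2

theorem summable_norm_apply {φ : ι → B →L[ℝ] F} {C : ℝ} (h : ∀ i, ‖φ i‖ ≤ C) (f : Fam ι B) :
    Summable fun i => ‖φ i (f i)‖ :=
  Summable.of_nonneg_of_le (fun _ => norm_nonneg _) (fun i => (φ i).le_of_opNorm_le (h i) _)
    ((summable_norm f).mul_left C)

/-- The continuous linear map with given uniformly bounded values on the families with one term. -/
def lift (φ : ι → B →L[ℝ] F) {C : ℝ} (h : ∀ i, ‖φ i‖ ≤ C) : Fam ι B →L[ℝ] F :=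
  LinearMap.mkContinuous
    { toFun := fun f => ∑' i, φ i (f i)
      map_add' := fun f g => by
        rw [← (summable_norm_apply h f).of_norm.tsum_add (summable_norm_apply h g).of_norm]
        simp
      map_smul' := fun c f => by
        simp [← tsum_const_smul'' c] } C fun f => by
    rw [norm_eq, ← tsum_mul_left]
    exact tsum_of_norm_bounded ((summable_norm f).mul_left C).hasSum
      fun i => (φ i).le_of_opNorm_le (h i) _

theorem lift_apply (φ : ι → B →L[ℝ] F) {C : ℝ} (h : ∀ i, ‖φ i‖ ≤ C) (f : Fam ι B) :
    lift φ h f = ∑' i, φ i (f i) := rfl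

@[simp] theorem lift_single (φ : ι → B →L[ℝ] F) {C : ℝ} (h : ∀ i, ‖φ i‖ ≤ C) (i : ι) (b : B) :
    lift φ h (single i b) = φ i b := by
  rw [lift_apply, tsum_eq_single i]
  · simp [single_apply]
  · intro j hj
    simp [single_apply, hj]

theorem norm_lift_le (φ : ι → B →L[ℝ] F) {C : ℝ} (h : ∀ i, ‖φ i‖ ≤ C) (f : Fam ι B) :
    ‖lift φ h f‖ ≤ C * ‖f‖ := by
  rw [lift_apply, norm_eq, ← tsum_mul_left]
  exact tsum_of_norm_bounded ((summable_norm f).mul_left C).hasSum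
    fun i => (φ i).le_of_opNorm_le (h i) _

theorem hasSum_lift (φ : ι → B →L[ℝ] F) {C : ℝ} (h : ∀ i, ‖φ i‖ ≤ C) (f : Fam ι B) :
    HasSum (fun i => φ i (f i)) (lift φ h f) :=
  (summable_norm_apply h f).of_norm.hasSum

end Fam

/-! ### Twisted convolution algebras -/

/-- A normalised symmetric two-cocycle of norm at most one. -/
structure Cocycle (M B : Type*) [AddCommMonoid M] [NormedCommRing B] where
  toFun : M → M → B
  norm_le : ∀ a b, ‖toFun a b‖ ≤ 1
  comm : ∀ a b, toFun a b = toFun b a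
  zero_left : ∀ a, toFun 0 a = 1
  assoc : ∀ a b c, toFun a b * toFun (a + b) c = toFun b c * toFun a (b + c)

section Conv

variable {M B : Type*} [AddCommMonoid M] [NormedCommRing B] [NormedAlgebra ℝ B]
  [NormOneClass B] [CompleteSpace B] (ρ : Cocycle M B)

/-- Absolutely summable families with the twisted convolution product. -/
def Conv {M B : Type*} [AddCommMonoid M] [NormedCommRing B] (_ρ : Cocycle M B) : Type _ := Fam M B

namespace Conv

instance : NormedAddCommGroup (Conv ρ) := inferInstanceAs (NormedAddCommGroup (Fam M B))
instance : NormedSpace ℝ (Conv ρ) := inferInstanceAs (NormedSpace ℝ (Fam M B))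
instance : CompleteSpace (Conv ρ) := inferInstanceAs (CompleteSpace (Fam M B))

/-- The product with a family supported at `a`, on families supported at `a'`. -/
def shift (a : M) (b : B) (a' : M) : B →L[ℝ] Fam M B :=
  (Fam.single (a + a')).comp (ContinuousLinearMap.mul ℝ B (ρ.toFun a a' * b))

theorem norm_shift_le (a : M) (b : B) (a' : M) : ‖shift ρ a b a'‖ ≤ ‖b‖ := by
  refine ContinuousLinearMap.opNorm_le_bound _ (norm_nonneg _) fun x => ?_
  simp only [shift, ContinuousLinearMap.comp_apply, ContinuousLinearMap.mul_apply', Fam.norm_single]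
  calc _ ≤ ‖ρ.toFun a a'‖ * ‖b‖ * ‖x‖ :=
        (norm_mul_le _ _).trans (mul_le_mul_of_nonneg_right (norm_mul_le _ _) (norm_nonneg _))
    _ ≤ 1 * ‖b‖ * ‖x‖ := by gcongr; exact ρ.norm_le _ _
    _ = _ := by ring

/-- The product with a family supported at `a`. -/
def mulSingle (a : M) : B →L[ℝ] Fam M B →L[ℝ] Fam M B :=
  LinearMap.mkContinuous₂
    (LinearMap.mk₂ ℝ (fun b f => Fam.lift (shift ρ a b) (norm_shift_le ρ a b) f)
      (fun b b' f => by
        simp only [Fam.lift_apply]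
        rw [← (Fam.summable_norm_apply (norm_shift_le ρ a b) f).of_norm.tsum_add
          (Fam.summable_norm_apply (norm_shift_le ρ a b') f).of_norm]
        simp [shift, mul_add])
      (fun c b f => by
        simp only [Fam.lift_apply]
        rw [← tsum_const_smul'' c]
        simp [shift])
      (fun b f g => map_add _ _ _)
      (fun c b f => map_smul _ _ _)) 1
    (fun b f => by simpa using Fam.norm_lift_le _ (norm_shift_le ρ a b) f)

theorem mulSingle_single (a a' : M) (b b' : B) :
    mulSingle ρ a b (Fam.single a' b') = Fam.single (a + a') (ρ.toFun a a' * b * b') := by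
  simp [mulSingle, shift]

theorem norm_mulSingle_le (a : M) : ‖mulSingle ρ a‖ ≤ 1 :=
  LinearMap.mkContinuous₂_norm_le _ zero_le_one _

/-- The twisted convolution product, as a bilinear map. -/
def mulL : Fam M B →L[ℝ] Fam M B →L[ℝ] Fam M B :=
  Fam.lift (mulSingle ρ) (norm_mulSingle_le ρ)

theorem mulL_single (a a' : M) (b b' : B) :
    mulL ρ (Fam.single a b) (Fam.single a' b') = Fam.single (a + a') (ρ.toFun a a' * b * b') := by
  simp [mulL, mulSingle_single]

theorem norm_mulL_le (f g : Fam M B) : ‖mulL ρ f g‖ ≤ ‖f‖ * ‖g‖ := by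
  refine ((mulL ρ f).le_opNorm g).trans ?_
  gcongr
  exact (Fam.norm_lift_le _ (norm_mulSingle_le ρ) f).trans (one_mul _).le

theorem mulL_comm (f g : Fam M B) : mulL ρ f g = mulL ρ g f := by
  have : mulL ρ = (mulL ρ).flip := by
    refine Fam.clm_ext fun a b => Fam.clm_ext fun a' b' => ?_
    rw [ContinuousLinearMap.flip_apply, mulL_single, mulL_single, add_comm, ρ.comm]
    congr 1; ring
  calc mulL ρ f g = (mulL ρ).flip f g := by rw [← this]
    _ = _ := rfl

/-- All three arguments are reduced to one-term families, one at a time; there associativity is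
precisely the cocycle identity. -/
theorem mulL_assoc (f g h : Fam M B) : mulL ρ (mulL ρ f g) h = mulL ρ f (mulL ρ g h) := by
  have : ∀ g h, (mulL ρ).flip h ∘L (mulL ρ).flip g = (mulL ρ).flip (mulL ρ g h) := by
    intro g h
    refine Fam.clm_ext fun a b => ?_
    have h1 : (mulL ρ).flip h ∘L mulL ρ (Fam.single a b)
        = mulL ρ (Fam.single a b) ∘L (mulL ρ).flip h := by
      refine Fam.clm_ext fun a' b' => ?_
      have h2 : mulL ρ (mulL ρ (Fam.single a b) (Fam.single a' b'))
          = mulL ρ (Fam.single a b) ∘L mulL ρ (Fam.single a' b') := by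
        refine Fam.clm_ext fun a'' b'' => ?_
        simp only [mulL_single, ContinuousLinearMap.comp_apply, add_assoc]
        congr 1
        linear_combination b * b' * b'' * ρ.assoc a a' a''
      exact congrArg (fun L : Fam M B →L[ℝ] Fam M B => L h) h2
    exact congrArg (fun L : Fam M B →L[ℝ] Fam M B => L g) h1
  exact congrArg (fun L : Fam M B →L[ℝ] Fam M B => L f) (this g h)

theorem one_mulL (f : Fam M B) : mulL ρ (Fam.single 0 1) f = f := by
  have : mulL ρ (Fam.single 0 1) = ContinuousLinearMap.id ℝ _ := by
    refine Fam.clm_ext fun a b => ?_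
    simp [mulL_single, ρ.zero_left]
  rw [this]; rfl

instance : NormedCommRing (Conv ρ) where
  __ := (inferInstance : NormedAddCommGroup (Conv ρ))
  mul f g := mulL ρ f g
  one := Fam.single 0 1
  mul_assoc := mulL_assoc ρ
  mul_comm := mulL_comm ρ
  one_mul := one_mulL ρ
  mul_one f := (mulL_comm ρ _ _).trans (one_mulL ρ f)
  left_distrib f g h := map_add (mulL ρ f) g h
  right_distrib f g h := congrArg (fun L : Fam M B →L[ℝ] Fam M B => L h) (map_add (mulL ρ) f g)
  zero_mul f := congrArg (fun L : Fam M B →L[ℝ] Fam M B => L f) (map_zero (mulL ρ))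
  mul_zero f := map_zero (mulL ρ f)
  norm_mul_le := norm_mulL_le ρ

instance : NormedAlgebra ℝ (Conv ρ) where
  __ := Algebra.ofModule (A := Conv ρ) (R := ℝ)
    (fun r f g => congrArg (fun L : Fam M B →L[ℝ] Fam M B => L g) (map_smul (mulL ρ) r f))
    (fun r f g => map_smul (mulL ρ f) r g)
  norm_smul_le := norm_smul_le

instance : NormOneClass (Conv ρ) where
  norm_one := (Fam.norm_single (0 : M) (1 : B)).trans norm_one

/-- The family supported at a single index, as an element of the algebra. -/
def single (a : M) : B →L[ℝ] Conv ρ := Fam.single a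

theorem single_mul_single (a a' : M) (b b' : B) :
    single ρ a b * single ρ a' b' = single ρ (a + a') (ρ.toFun a a' * b * b') :=
  mulL_single ρ a a' b b'

theorem norm_single (a : M) (b : B) : ‖single ρ a b‖ = ‖b‖ := Fam.norm_single a b

theorem clm_ext {F : Type*} [NormedAddCommGroup F] [NormedSpace ℝ F] [CompleteSpace F]
    {φ ψ : Conv ρ →L[ℝ] F} (h : ∀ a b, φ (single ρ a b) = ψ (single ρ a b)) : φ = ψ :=
  Fam.clm_ext h

/-- The continuous linear map with given values on the families with one term. -/
def lift {F : Type*} [NormedAddCommGroup F] [NormedSpace ℝ F] [CompleteSpace F]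
    (φ : M → B →L[ℝ] F) {C : ℝ} (h : ∀ i, ‖φ i‖ ≤ C) : Conv ρ →L[ℝ] F := Fam.lift φ h

theorem lift_single {F : Type*} [NormedAddCommGroup F] [NormedSpace ℝ F] [CompleteSpace F]
    (φ : M → B →L[ℝ] F) {C : ℝ} (h : ∀ i, ‖φ i‖ ≤ C) (i : M) (b : B) :
    lift ρ φ h (single ρ i b) = φ i b := Fam.lift_single φ h i b

/-- A continuous linear map that is multiplicative on families with one term is a homomorphism. -/
def hom {R : Type*} [NormedCommRing R] [NormedAlgebra ℝ R] [CompleteSpace R]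
    (φ : M → B →L[ℝ] R) {C : ℝ} (h : ∀ i, ‖φ i‖ ≤ C) (h1 : φ 0 1 = 1)
    (hm : ∀ a a' b b', φ (a + a') (ρ.toFun a a' * b * b') = φ a b * φ a' b') :
    Conv ρ →ₐ[ℝ] R :=
  AlgHom.ofLinearMap (lift ρ φ h).toLinearMap
    (by
      change lift ρ φ h (single ρ 0 1) = 1
      rw [lift_single, h1])
    (by
      intro f g
      have h2 : ∀ g : Fam M B, (Fam.lift φ h).comp ((mulL ρ).flip g)
          = (ContinuousLinearMap.mul ℝ R).flip (Fam.lift φ h g) ∘L Fam.lift φ h := by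
        intro g
        refine Fam.clm_ext fun a b => ?_
        have h3 : (Fam.lift φ h).comp (mulL ρ (Fam.single a b))
            = (ContinuousLinearMap.mul ℝ R (Fam.lift φ h (Fam.single a b))) ∘L Fam.lift φ h := by
          refine Fam.clm_ext fun a' b' => ?_
          simp [mulL_single, hm]
        exact congrArg (fun L : Fam M B →L[ℝ] R => L g) h3
      exact congrArg (fun L : Fam M B →L[ℝ] R => L f) (h2 g))

theorem continuous_hom {R : Type*} [NormedCommRing R] [NormedAlgebra ℝ R] [CompleteSpace R]
    (φ : M → B →L[ℝ] R) {C : ℝ} (h : ∀ i, ‖φ i‖ ≤ C) (h1 : φ 0 1 = 1)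
    (hm : ∀ a a' b b', φ (a + a') (ρ.toFun a a' * b * b') = φ a b * φ a' b') :
    Continuous (hom ρ φ h h1 hm) := (lift ρ φ h).continuous

end Conv

end Conv

/-! ### Divided differences in a commutative Banach algebra -/

section DividedDifference

variable {R : Type*} [NormedCommRing R] [NormedAlgebra ℝ R] [CompleteSpace R] [NormOneClass R]

/-- Near the constant tuple `1`, the differences of `F` are linear combinations of the differences
of the variables, with coefficients that tend to `a` at `1`. -/
def HasDivDiff {k : ℕ} (F : (Fin k → R) → R) (a : Fin k → R) : Prop :=
  ∃ A : (Fin k → R) → (Fin k → R) → Fin k → R,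
    Tendsto (fun p : (Fin k → R) × (Fin k → R) => A p.1 p.2) (𝓝 (1, 1)) (𝓝 a) ∧
    ∀ᶠ p : (Fin k → R) × (Fin k → R) in 𝓝 (1, 1),
      F p.1 - F p.2 = ∑ i, A p.1 p.2 i * (p.1 i - p.2 i)

namespace HasDivDiff

variable {k : ℕ} {F G : (Fin k → R) → R} {a b : Fin k → R}

theorem coord (i : Fin k) : HasDivDiff (fun x : Fin k → R => x i) (Pi.single i 1) :=
  ⟨fun _ _ => Pi.single i 1, tendsto_const_nhds, Eventually.of_forall fun p => by
    rw [Finset.sum_eq_single i (fun j _ hj => by simp [hj]) (by simp)]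
    simp⟩

theorem const (c : R) : HasDivDiff (fun _ : Fin k → R => c) 0 :=
  ⟨fun _ _ => 0, tendsto_const_nhds, Eventually.of_forall fun p => by simp⟩

theorem add (hF : HasDivDiff F a) (hG : HasDivDiff G b) :
    HasDivDiff (fun x => F x + G x) (a + b) := by
  obtain ⟨A, hA, hA'⟩ := hF
  obtain ⟨B, hB, hB'⟩ := hG
  refine ⟨fun x y => A x y + B x y, hA.add hB, ?_⟩
  filter_upwards [hA', hB'] with p h1 h2
  simp only [Pi.add_apply, add_mul, Finset.sum_add_distrib, ← h1, ← h2]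
  ring

/-- Comparing with the base point, `F x - F 1` is a combination of the `x i - 1` with convergent
coefficients. -/
theorem tendsto (hF : HasDivDiff F a) : Tendsto F (𝓝 1) (𝓝 (F 1)) := by
  obtain ⟨A, hA, hA'⟩ := hF
  have hp : Tendsto (fun x : Fin k → R => (x, (1 : Fin k → R))) (𝓝 1) (𝓝 (1, 1)) :=
    (continuous_id.prodMk continuous_const).tendsto _
  have h1 : Tendsto (fun x : Fin k → R => F 1 + ∑ i, A x 1 i * (x i - 1)) (𝓝 1)
      (𝓝 (F 1 + ∑ i, a i * (1 - 1))) := by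
    refine tendsto_const_nhds.add (tendsto_finsetSum _ fun i _ => ?_)
    exact ((tendsto_pi_nhds.1 (hA.comp hp) i)).mul
      (((continuous_apply i).tendsto (1 : Fin k → R)).sub tendsto_const_nhds)
  simp only [sub_self, mul_zero, Finset.sum_const_zero, add_zero] at h1
  refine h1.congr' ?_
  filter_upwards [hp.eventually hA'] with x hx
  have : F x - F 1 = ∑ i, A x 1 i * (x i - 1) := by simpa using hx
  rw [← this]; ring

/-- Leibniz splitting `F x G x - F y G y = F x (G x - G y) + (F x - F y) G y`, with the continuity
of both factors at `1` to identify the limit of the coefficients. -/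
theorem mul (hF : HasDivDiff F a) (hG : HasDivDiff G b) :
    HasDivDiff (fun x => F x * G x) (fun i => F 1 * b i + a i * G 1) := by
  have tF := hF.tendsto
  have tG := hG.tendsto
  obtain ⟨A, hA, hA'⟩ := hF
  obtain ⟨B, hB, hB'⟩ := hG
  refine ⟨fun x y i => F x * B x y i + A x y i * G y, ?_, ?_⟩
  · refine tendsto_pi_nhds.2 fun i => ?_
    refine Tendsto.add (Tendsto.mul ?_ (tendsto_pi_nhds.1 hB i))
      (Tendsto.mul (tendsto_pi_nhds.1 hA i) ?_)
    · exact tF.comp (continuous_fst.tendsto ((1 : Fin k → R), (1 : Fin k → R)))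
    · exact tG.comp (continuous_snd.tendsto ((1 : Fin k → R), (1 : Fin k → R)))
  · filter_upwards [hA', hB'] with p h1 h2
    have h3 : ∑ i, (F p.1 * B p.1 p.2 i + A p.1 p.2 i * G p.2) * (p.1 i - p.2 i)
        = F p.1 * ∑ i, B p.1 p.2 i * (p.1 i - p.2 i)
          + (∑ i, A p.1 p.2 i * (p.1 i - p.2 i)) * G p.2 := by
      rw [Finset.mul_sum, Finset.sum_mul, ← Finset.sum_add_distrib]
      exact Finset.sum_congr rfl fun i _ => by ring
    rw [h3, ← h1, ← h2]
    ring

theorem congr_coeff (hF : HasDivDiff F a) (h : a = b) : HasDivDiff F b := h ▸ hF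

/-- Composition with a function of one variable that has divided differences. -/
theorem comp {φ : R → R} {K : R → R → R} {c : R} (hF : HasDivDiff F a)
    (hK : Tendsto (fun p : R × R => K p.1 p.2) (𝓝 (F 1, F 1)) (𝓝 c))
    (hφ : ∀ᶠ p : R × R in 𝓝 (F 1, F 1), φ p.1 - φ p.2 = K p.1 p.2 * (p.1 - p.2)) :
    HasDivDiff (fun x => φ (F x)) (fun i => c * a i) := by
  have tF := hF.tendsto
  obtain ⟨A, hA, hA'⟩ := hF
  have hp : Tendsto (fun p : (Fin k → R) × (Fin k → R) => (F p.1, F p.2)) (𝓝 (1, 1))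
      (𝓝 (F 1, F 1)) :=
    Tendsto.prodMk_nhds (tF.comp (continuous_fst.tendsto ((1 : Fin k → R), (1 : Fin k → R))))
      (tF.comp (continuous_snd.tendsto ((1 : Fin k → R), (1 : Fin k → R))))
  refine ⟨fun x y i => K (F x) (F y) * A x y i, ?_, ?_⟩
  · exact tendsto_pi_nhds.2 fun i => (hK.comp hp).mul (tendsto_pi_nhds.1 hA i)
  · filter_upwards [hA', hp.eventually hφ] with p h1 h2
    rw [h2, h1, Finset.mul_sum]
    exact Finset.sum_congr rfl fun i _ => by ring

/-- All elements near `1` are units, and `x⁻¹ - y⁻¹ = -x⁻¹ y⁻¹ (x - y)` for units. -/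
theorem inverse (i : Fin k) :
    HasDivDiff (fun x : Fin k → R => Ring.inverse (x i)) (-Pi.single i 1) := by
  have hi : Tendsto (Ring.inverse : R → R) (𝓝 1) (𝓝 1) := by
    have := NormedRing.inverse_continuousAt (1 : Rˣ)
    simpa [ContinuousAt] using this
  have hu : ∀ᶠ x : R in 𝓝 1, IsUnit x := by
    have := Units.nhds (1 : Rˣ)
    rw [Units.val_one] at this
    exact this
  have := (coord (R := R) i).comp (φ := Ring.inverse)
    (K := fun x y => -(Ring.inverse x * Ring.inverse y)) (c := -(1 * 1)) ?_ ?_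
  · refine this.congr_coeff ?_
    ext j
    simp
  · exact ((hi.comp (continuous_fst.tendsto ((1 : R), (1 : R)))).mul
      (hi.comp (continuous_snd.tendsto ((1 : R), (1 : R))))).neg
  · filter_upwards [(continuous_fst.tendsto ((1 : R), (1 : R))).eventually hu,
      (continuous_snd.tendsto ((1 : R), (1 : R))).eventually hu] with p h1 h2
    have e1 := Ring.inverse_mul_cancel _ h1
    have e2 := Ring.inverse_mul_cancel _ h2
    linear_combination (Ring.inverse p.2) * e1 - Ring.inverse p.1 * e2

/-- Quantitative form: near `1`, differences of `F` are combinations of differences of the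
variables with coefficients close to `a`. -/
theorem exists_delta (hF : HasDivDiff F a) {η : ℝ} (hη : 0 < η) :
    ∃ δ > 0, ∀ x y : Fin k → R, (∀ i, ‖x i - 1‖ ≤ δ) → (∀ i, ‖y i - 1‖ ≤ δ) →
      ∃ A : Fin k → R, (∀ i, ‖A i - a i‖ ≤ η) ∧ F x - F y = ∑ i, A i * (x i - y i) := by
  obtain ⟨A, hA, hA'⟩ := hF
  have h1 := (hA.eventually (Metric.closedBall_mem_nhds a hη)).and hA'
  obtain ⟨δ, hδ, h2⟩ := Metric.eventually_nhds_iff.1 h1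
  refine ⟨δ / 2, by positivity, fun x y hx hy => ?_⟩
  have hxy : dist (x, y) ((1 : Fin k → R), (1 : Fin k → R)) < δ := by
    rw [Prod.dist_eq, max_lt_iff]
    constructor
    · refine ((dist_pi_le_iff (by positivity)).2 fun i => ?_).trans_lt (half_lt_self hδ)
      simpa [dist_eq_norm] using hx i
    · refine ((dist_pi_le_iff (by positivity)).2 fun i => ?_).trans_lt (half_lt_self hδ)
      simpa [dist_eq_norm] using hy i
  obtain ⟨h3, h4⟩ := h2 hxy
  refine ⟨A x y, fun i => ?_, h4⟩
  have := (dist_pi_le_iff hη.le).1 h3 i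
  simpa [dist_eq_norm] using this

end HasDivDiff

end DividedDifference

/-! ### Power series with real coefficients -/

section PowerSeries

variable {R : Type*} [NormedCommRing R] [NormedAlgebra ℝ R] [CompleteSpace R] [NormOneClass R]
  {c : ℕ → ℝ} {K a : ℝ}

/-- The sum of the power series with coefficients `c`. -/
def powerSum (c : ℕ → ℝ) (b : R) : R := ∑' n, c n • b ^ n

theorem summable_powerSum (hc : ∀ n, |c n| ≤ K * a ^ n) {b : R} (hb : a * ‖b‖ < 1) (ha : 0 ≤ a) :
    Summable fun n => ‖c n • b ^ n‖ := by
  refine Summable.of_nonneg_of_le (fun _ => norm_nonneg _) (fun n => ?_)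
    ((summable_geometric_of_lt_one (by positivity) hb).mul_left K)
  calc ‖c n • b ^ n‖ ≤ |c n| * ‖b‖ ^ n := by
        rw [norm_smul, Real.norm_eq_abs]; gcongr; exact norm_pow_le _ _
    _ ≤ K * a ^ n * ‖b‖ ^ n := by gcongr; exact hc n
    _ = _ := by rw [mul_pow]; ring

theorem powerSum_zero : powerSum c (0 : R) = c 0 • 1 := by
  rw [powerSum, tsum_eq_single 0 (fun n hn => by simp [hn])]
  simp

theorem powerSum_map {R' : Type*} [NormedCommRing R'] [NormedAlgebra ℝ R'] (φ : R →ₐ[ℝ] R')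
    (hφ : Continuous φ) (hc : ∀ n, |c n| ≤ K * a ^ n) (ha : 0 ≤ a) {b : R} (hb : a * ‖b‖ < 1) :
    φ (powerSum c b) = powerSum c (φ b) := by
  rw [powerSum, powerSum,
    ((summable_powerSum hc hb ha).of_norm.hasSum.map φ hφ).tsum_eq.symm]
  simp

/-- The divided difference of a power series. -/
def powerDiff (c : ℕ → ℝ) (x y : R) : R :=
  ∑' n, c (n + 1) • ∑ i ∈ Finset.range (n + 1), x ^ i * y ^ (n - i)

theorem norm_geom_sum₂_le {x y : R} {r : ℝ} (hx : ‖x‖ ≤ r) (hy : ‖y‖ ≤ r) (n : ℕ) :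
    ‖∑ i ∈ Finset.range (n + 1), x ^ i * y ^ (n - i)‖ ≤ (n + 1 : ℝ) * r ^ n := by
  have hr : 0 ≤ r := (norm_nonneg x).trans hx
  refine (norm_sum_le _ _).trans ?_
  have : ∀ i ∈ Finset.range (n + 1), ‖x ^ i * y ^ (n - i)‖ ≤ r ^ n := by
    intro i hi
    have h1 : i ≤ n := Nat.lt_succ_iff.1 (Finset.mem_range.1 hi)
    calc ‖x ^ i * y ^ (n - i)‖ ≤ ‖x‖ ^ i * ‖y‖ ^ (n - i) :=
          (norm_mul_le _ _).trans (mul_le_mul (norm_pow_le _ _) (norm_pow_le _ _)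
            (norm_nonneg _) (by positivity))
      _ ≤ r ^ i * r ^ (n - i) := by gcongr
      _ = r ^ n := by rw [← pow_add]; congr 1; omega
  refine (Finset.sum_le_card_nsmul _ _ _ this).trans ?_
  simp

theorem powerDiff_bound (hc : ∀ n, |c n| ≤ K * a ^ n) (_ha : 0 ≤ a) {r : ℝ} {x y : R}
    (hx : ‖x‖ ≤ r) (hy : ‖y‖ ≤ r) (n : ℕ) :
    ‖c (n + 1) • ∑ i ∈ Finset.range (n + 1), x ^ i * y ^ (n - i)‖
      ≤ K * a * ((n + 1 : ℝ) * (a * r) ^ n) := by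
  have hr : 0 ≤ r := (norm_nonneg x).trans hx
  rw [norm_smul, Real.norm_eq_abs]
  calc _ ≤ (K * a ^ (n + 1)) * ((n + 1 : ℝ) * r ^ n) :=
        mul_le_mul (hc _) (norm_geom_sum₂_le hx hy n) (norm_nonneg _)
          ((abs_nonneg _).trans (hc _))
    _ = _ := by rw [mul_pow]; ring

theorem summable_powerDiff_bound {q : ℝ} (hq0 : 0 ≤ q) (hq : q < 1) (C : ℝ) :
    Summable fun n : ℕ => C * ((n + 1 : ℝ) * q ^ n) := by
  refine Summable.mul_left _ ?_
  have h1 := summable_pow_mul_geometric_of_norm_lt_one 1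
    (show ‖q‖ < 1 by rwa [Real.norm_of_nonneg hq0])
  have h2 := summable_geometric_of_lt_one hq0 hq
  refine (h1.add h2).congr fun n => ?_
  simp; ring

/-- Termwise `x^{n+1} - y^{n+1} = (∑ xⁱ y^{n-i}) (x - y)`; the common factor comes out of the
convergent sum. -/
theorem powerSum_sub (hc : ∀ n, |c n| ≤ K * a ^ n) (ha : 0 ≤ a) {r : ℝ} (hr : a * r < 1) {x y : R}
    (hx : ‖x‖ ≤ r) (hy : ‖y‖ ≤ r) :
    powerSum c x - powerSum c y = powerDiff c x y * (x - y) := by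
  have hr0 : 0 ≤ r := (norm_nonneg x).trans hx
  have sx := (summable_powerSum (R := R) hc
    ((mul_le_mul_of_nonneg_left hx ha).trans_lt hr) ha).of_norm
  have sy := (summable_powerSum (R := R) hc
    ((mul_le_mul_of_nonneg_left hy ha).trans_lt hr) ha).of_norm
  have sd : Summable fun n => c (n + 1) • ∑ i ∈ Finset.range (n + 1), x ^ i * y ^ (n - i) :=
    Summable.of_norm_bounded (summable_powerDiff_bound (by positivity) hr (K * a))
      (powerDiff_bound hc ha hx hy)
  rw [powerSum, powerSum, powerDiff, ← sd.tsum_mul_right, sx.tsum_eq_zero_add, sy.tsum_eq_zero_add]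
  have h1 := (summable_nat_add_iff 1).2 sx
  have h2 := (summable_nat_add_iff 1).2 sy
  rw [pow_zero, pow_zero, add_sub_add_left_eq_sub, ← h1.tsum_sub h2]
  refine tsum_congr fun n => ?_
  have h3 := geom_sum₂_mul x y (n + 1)
  simp only [Nat.add_sub_cancel] at h3
  rw [smul_mul_assoc, h3, smul_sub]

theorem eventually_norm_le {r : ℝ} (hr : 0 < r) : ∀ᶠ x : R in 𝓝 0, ‖x‖ ≤ r := by
  filter_upwards [Metric.closedBall_mem_nhds (0 : R) hr] with x hx
  simpa using hx

/-- Dominated convergence on the ball of radius `1 / (2a)`, where the terms are at most `K a (n + 1)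
2⁻ⁿ`. At the origin only the term `n = 0` survives. -/
theorem tendsto_powerDiff (hc : ∀ n, |c n| ≤ K * a ^ n) (ha : 0 < a) :
    Tendsto (fun p : R × R => powerDiff c p.1 p.2) (𝓝 (0, 0)) (𝓝 (c 1 • 1)) := by
  have h0 : c 1 • (1 : R) = ∑' n, c (n + 1) • ∑ i ∈ Finset.range (n + 1),
      (0 : R) ^ i * 0 ^ (n - i) := by
    rw [tsum_eq_single 0]
    · simp
    · intro n hn
      rw [Finset.sum_eq_zero, smul_zero]
      intro i _
      rcases Nat.eq_zero_or_pos i with h | h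
      · simp [h, hn]
      · simp [h.ne']
  rw [h0]
  have hsm : ∀ᶠ p : R × R in 𝓝 (0, 0), ‖p.1‖ ≤ 1 / (2 * a) ∧ ‖p.2‖ ≤ 1 / (2 * a) := by
    have hb := eventually_norm_le (R := R) (show 0 < 1 / (2 * a) by positivity)
    exact ((continuous_fst.tendsto ((0 : R), (0 : R))).eventually hb).and
      ((continuous_snd.tendsto ((0 : R), (0 : R))).eventually hb)
  refine tendsto_tsum_of_dominated_convergence
    (summable_powerDiff_bound (q := 1 / 2) (by norm_num) (by norm_num) (K * a)) (fun n => ?_) ?_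
  · have : Continuous fun p : R × R =>
        c (n + 1) • ∑ i ∈ Finset.range (n + 1), p.1 ^ i * p.2 ^ (n - i) := by fun_prop
    exact this.tendsto (0, 0)
  · filter_upwards [hsm] with p hp n
    have := powerDiff_bound hc ha.le hp.1 hp.2 n
    rwa [show a * (1 / (2 * a)) = 1 / 2 by field_simp] at this

end PowerSeries

/-! ### The nonlinearity -/

section Nonlinearity

variable {R : Type*} [NormedCommRing R] [NormedAlgebra ℝ R] [CompleteSpace R] [NormOneClass R]
  {c : ℕ → ℝ} {K a : ℝ}

/-- The nonlinearity of the Peskin problem in terms of the tangent, its conjugate, the divided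
difference of the curve and its conjugate. -/
def nonlin (c : ℕ → ℝ) (E : R) (x : Fin 4 → R) : R :=
  (E ^ 2 * x 0 ^ 2 * Ring.inverse (x 2) + x 1 ^ 2 * x 2 * Ring.inverse (x 3) ^ 2)
    * powerSum c (x 0 * x 1 - 1)

/-- The derivatives of the nonlinearity at `1`. -/
def nonlinCoeff (c : ℕ → ℝ) (E : R) : Fin 4 → R :=
  ![(2 * c 0 + c 1) • E ^ 2 + c 1 • 1, (2 * c 0 + c 1) • 1 + c 1 • E ^ 2,
    c 0 • 1 - c 0 • E ^ 2, -((2 * c 0) • 1)]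

/-- Product rule: at `1` the first factor equals `E² + 1`, and the power series equals `c 0` with
derivative `c 1` with respect to both `x 0` and `x 1`. -/
theorem hasDivDiff_nonlin (hc : ∀ n, |c n| ≤ K * a ^ n) (ha : 0 < a) (E : R) :
    HasDivDiff (nonlin c E) (nonlinCoeff c E) := by
  have x (i : Fin 4) := HasDivDiff.coord (R := R) i
  have hpw := (((x 0).mul (x 1)).add (HasDivDiff.const (-1))).comp
    (φ := powerSum c) (K := powerDiff c) (c := c 1 • 1)
    (by simpa using tendsto_powerDiff hc ha)
    (by
      have hb := eventually_norm_le (R := R) (show 0 < 1 / (2 * a) by positivity)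
      have h0 : ((1 : Fin 4 → R) 0 * (1 : Fin 4 → R) 1 + -1) = 0 := by simp
      rw [h0]
      filter_upwards [(continuous_fst.tendsto ((0 : R), (0 : R))).eventually hb,
        (continuous_snd.tendsto ((0 : R), (0 : R))).eventually hb] with p h1 h2
      refine powerSum_sub hc ha.le ?_ h1 h2
      rw [show a * (1 / (2 * a)) = 1 / 2 by field_simp]
      norm_num)
  have h1 := ((HasDivDiff.const (E ^ 2)).mul ((x 0).mul (x 0))).mul (HasDivDiff.inverse 2)
  have h2 := (((x 1).mul (x 1)).mul (x 2)).mul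
    ((HasDivDiff.inverse (R := R) (3 : Fin 4)).mul (HasDivDiff.inverse 3))
  have h3 := (h1.add h2).mul hpw
  have e : nonlin c E = fun x : Fin 4 → R =>
      ((E ^ 2 * (x 0 * x 0) * Ring.inverse (x 2) +
        x 1 * x 1 * x 2 * (Ring.inverse (x 3) * Ring.inverse (x 3)))
        * powerSum c (x 0 * x 1 + -1)) := by
    funext x
    simp only [nonlin, pow_two, sub_eq_add_neg]
  rw [e]
  refine h3.congr_coeff ?_
  ext i
  fin_cases i <;>
    simp [nonlinCoeff, powerSum_zero, Pi.single_apply, Algebra.smul_def,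
      map_ofNat (algebraMap ℝ R) 2] <;> ring

theorem map_ringInverse {R' : Type*} [CommRing R'] (φ : R →+* R') {x : R} (hx : IsUnit x) :
    φ (Ring.inverse x) = Ring.inverse (φ x) := by
  have h1 : φ (Ring.inverse x) * φ x = 1 := by rw [← map_mul, Ring.inverse_mul_cancel _ hx, map_one]
  have h2 := Ring.mul_inverse_cancel _ (hx.map φ)
  calc φ (Ring.inverse x) = φ (Ring.inverse x) * (φ x * Ring.inverse (φ x)) := by rw [h2, mul_one]
    _ = _ := by rw [← mul_assoc, h1, one_mul]

/-- Lets the nonlinearity be computed once in a large algebra and evaluated afterwards. The side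
conditions matter: `Ring.inverse` is `0` off the units, and the power series is meaningful only
where it converges. -/
theorem map_nonlin {R' : Type*} [NormedCommRing R'] [NormedAlgebra ℝ R'] (φ : R →ₐ[ℝ] R')
    (hφ : Continuous φ) (hc : ∀ n, |c n| ≤ K * a ^ n) (ha : 0 ≤ a) (E : R) {x : Fin 4 → R}
    (h2 : IsUnit (x 2)) (h3 : IsUnit (x 3)) (h01 : a * ‖x 0 * x 1 - 1‖ < 1) :
    φ (nonlin c E x) = nonlin c (φ E) (fun i => φ (x i)) := by
  have e2 := map_ringInverse (φ : R →+* R') h2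
  have e3 := map_ringInverse (φ : R →+* R') h3
  simp only [AlgHom.coe_toRingHom] at e2 e3
  simp only [nonlin, map_mul, map_add, map_pow, e2, e3, powerSum_map φ hφ hc ha h01, map_sub,
    map_one]

theorem isUnit_of_norm_sub_one_lt {x : R} (h : ‖x - 1‖ < 1) : IsUnit x := by
  have := isUnit_one_sub_of_norm_lt_one (x := 1 - x) (by rwa [norm_sub_rev])
  simpa using this

theorem exists_regular (ha : 0 ≤ a) : ∃ δ > 0, ∀ x : Fin 4 → R, (∀ i, ‖x i - 1‖ ≤ δ) →
    IsUnit (x 2) ∧ IsUnit (x 3) ∧ a * ‖x 0 * x 1 - 1‖ < 1 := by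
  -- This radius is at most `1/2`, so that `‖x 0 * x 1 - 1‖ ≤ δ² + 2δ ≤ 3δ`, and `3a / (2 + 4a) <
  -- 1`.
  refine ⟨1 / (2 + 4 * a), by positivity, fun x hx => ?_⟩
  set δ := 1 / (2 + 4 * a) with hδ
  have hδ0 : 0 < δ := by positivity
  have hδ1 : δ ≤ 1 / 2 := by rw [hδ]; gcongr; linarith
  refine ⟨isUnit_of_norm_sub_one_lt ((hx 2).trans_lt (by linarith)),
    isUnit_of_norm_sub_one_lt ((hx 3).trans_lt (by linarith)), ?_⟩
  have h1 : ‖x 0 * x 1 - 1‖ ≤ 3 * δ := by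
    have : x 0 * x 1 - 1 = (x 0 - 1) * (x 1 - 1) + (x 0 - 1) + (x 1 - 1) := by ring
    rw [this]
    calc _ ≤ ‖x 0 - 1‖ * ‖x 1 - 1‖ + ‖x 0 - 1‖ + ‖x 1 - 1‖ :=
          (norm_add₃_le).trans (by gcongr; exact norm_mul_le _ _)
      _ ≤ δ * δ + δ + δ := by gcongr <;> exact hx _
      _ ≤ 3 * δ := by nlinarith
  calc a * ‖x 0 * x 1 - 1‖ ≤ a * (3 * δ) := by gcongr
    _ < 1 := by
      rw [hδ, show a * (3 * (1 / (2 + 4 * a))) = (3 * a) / (2 + 4 * a) by ring,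
        div_lt_one (by positivity)]
      linarith

end Nonlinearity

/-! ### Operators mixing the frequencies `n` and `-n` -/

section TwoDiag

variable {B : Type*} [NormedCommRing B] [NormedAlgebra ℝ B] [NormOneClass B] [CompleteSpace B]
  [StarRing B] [NormedStarGroup B] [StarModule ℝ B]

/-- Conjugation as a real-linear map. -/
def conjL (B : Type*) [NormedCommRing B] [NormedAlgebra ℝ B] [StarRing B] [NormedStarGroup B]
    [StarModule ℝ B] : B →L[ℝ] B := (starL' ℝ : B ≃L[ℝ] B)

@[simp] theorem conjL_apply (b : B) : conjL B b = star b := rfl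

theorem norm_conjL_le : ‖conjL B‖ ≤ 1 :=
  ContinuousLinearMap.opNorm_le_bound _ zero_le_one fun b => by simp

/-- The family `α n • v n + β n • star (v (-n))`. -/
def twoDiagFun (α β : ℤ → ℝ) (v : Fam ℤ B) (n : ℤ) : B := α n • v n + β n • star (v (-n))

theorem summable_twoDiagFun {α β : ℤ → ℝ} {C : ℝ} (hα : ∀ n, |α n| ≤ C) (hβ : ∀ n, |β n| ≤ C)
    (v : Fam ℤ B) : Summable fun n => ‖twoDiagFun α β v n‖ := by
  have h1 := Fam.summable_norm v
  have h2 : Summable fun n : ℤ => ‖v (-n)‖ := (Equiv.neg ℤ).summable_iff.2 h1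
  refine Summable.of_nonneg_of_le (fun _ => norm_nonneg _) (fun n => ?_)
    ((h1.mul_left C).add (h2.mul_left C))
  refine (norm_add_le _ _).trans ?_
  rw [norm_smul, norm_smul, norm_star]
  exact add_le_add (mul_le_mul_of_nonneg_right (hα n) (norm_nonneg _))
    (mul_le_mul_of_nonneg_right (hβ n) (norm_nonneg _))

/-- The operator `v ↦ α n • v n + β n • star (v (-n))` on summable families. -/
def twoDiag (α β : ℤ → ℝ) {C : ℝ} (hα : ∀ n, |α n| ≤ C) (hβ : ∀ n, |β n| ≤ C) :
    Fam ℤ B →L[ℝ] Fam ℤ B :=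
  LinearMap.mkContinuous
    { toFun := fun v => Fam.mk (twoDiagFun α β v) (summable_twoDiagFun hα hβ v)
      map_add' := fun v w => by
        refine Fam.ext fun n => ?_
        simp only [Fam.mk_apply, twoDiagFun, Fam.add_apply, star_add, smul_add]
        abel
      map_smul' := fun r v => by
        refine Fam.ext fun n => ?_
        simp only [Fam.mk_apply, twoDiagFun, Fam.smul_apply, star_smul, RingHom.id_apply, smul_add,
          smul_smul, mul_comm, star_trivial] }
    (C + C) fun v => by
      have h1 := Fam.summable_norm v
      have h2 : Summable fun n : ℤ => ‖v (-n)‖ := (Equiv.neg ℤ).summable_iff.2 h1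
      have h3 : ∑' n : ℤ, ‖v (-n)‖ = ‖v‖ := by
        rw [Fam.norm_eq]; exact (Equiv.neg ℤ).tsum_eq fun n => ‖v n‖
      rw [Fam.norm_eq, add_mul]
      conv_rhs => rw [← h3]
      nth_rewrite 1 [h3]
      rw [Fam.norm_eq v, ← tsum_mul_left, ← tsum_mul_left,
        ← (h1.mul_left C).tsum_add (h2.mul_left C)]
      refine (summable_twoDiagFun hα hβ v).tsum_le_tsum (fun n => ?_)
        ((h1.mul_left C).add (h2.mul_left C))
      refine (norm_add_le _ _).trans ?_
      rw [norm_smul, norm_smul, norm_star]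
      exact add_le_add (mul_le_mul_of_nonneg_right (hα n) (norm_nonneg _))
        (mul_le_mul_of_nonneg_right (hβ n) (norm_nonneg _))

theorem twoDiag_apply (α β : ℤ → ℝ) {C : ℝ} (hα : ∀ n, |α n| ≤ C) (hβ : ∀ n, |β n| ≤ C)
    (v : Fam ℤ B) (n : ℤ) : twoDiag α β hα hβ v n = α n • v n + β n • star (v (-n)) := rfl

theorem twoDiag_single (α β : ℤ → ℝ) {C : ℝ} (hα : ∀ n, |α n| ≤ C) (hβ : ∀ n, |β n| ≤ C)
    (k : ℤ) (b : B) : twoDiag α β hα hβ (Fam.single k b)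
      = Fam.single k (α k • b) + Fam.single (-k) (β (-k) • star b) := by
  refine Fam.ext fun n => ?_
  simp only [twoDiag_apply, Fam.add_apply, Fam.single_apply]
  have h : -n = k ↔ n = -k := by omega
  simp only [h]
  by_cases h1 : n = k
  · subst h1
    -- This is the index `0`, where the two terms sit at the same place and add up.
    by_cases h2 : n = -n
    · rw [if_pos rfl, if_pos h2, if_pos rfl, if_pos h2, ← h2]
    · rw [if_pos rfl, if_neg h2, if_pos rfl, if_neg h2, star_zero, smul_zero]
  · by_cases h2 : n = -k
    · subst h2
      rw [if_neg h1, if_pos rfl, if_neg h1, if_pos rfl, smul_zero]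
    · rw [if_neg h1, if_neg h2, if_neg h1, if_neg h2, star_zero, smul_zero, smul_zero]

end TwoDiag

/-! ### The four variables of the nonlinearity -/

/-- The sign `1` for `p ≥ 1` and `-1` for `p ≤ 0`. -/
def sgn (p : ℤ) : ℝ := if 1 ≤ p then 1 else -1

theorem abs_sgn (p : ℤ) : |sgn p| = 1 := by
  unfold sgn; split_ifs <;> simp

/-- The frequencies of the divided difference of the exponential with frequency `n + 1`. -/
def freqs (n : ℤ) : Finset ℤ := if 0 ≤ n then Finset.Icc 0 n else Finset.Icc (n + 1) (-1)

/-- The curve coefficient is the tangent coefficient divided by `n + 1`, while the divided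
difference of `e^{i(n+1)s}` has `|n + 1|` terms. The quotient is thus a mean, of norm at most one;
this is why divided differences lose nothing in `ℓ¹`. -/
theorem card_freqs (n : ℤ) : ((freqs n).card : ℝ) = |(n : ℝ) + 1| := by
  unfold freqs
  split_ifs with h
  · rw [Int.card_Icc, abs_of_nonneg (by exact_mod_cast (by omega : (0 : ℤ) ≤ n + 1))]
    have : ((n + 1 - 0).toNat : ℤ) = n + 1 := by omega
    exact_mod_cast this
  · rw [Int.card_Icc, abs_of_nonpos (by exact_mod_cast (by omega : n + 1 ≤ (0 : ℤ)))]
    have : ((-1 + 1 - (n + 1)).toNat : ℤ) = -(n + 1) := by omega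
    exact_mod_cast this

/-- An algebra with elements of frequencies `(n, p)`, and a summation over `p`. -/
structure Frame (R B : Type*) [NormedCommRing R] [NormedAlgebra ℝ R] [NormedCommRing B]
    [NormedAlgebra ℝ B] where
  s : ℤ → ℤ → B →L[ℝ] R
  E : R
  row : R →L[ℝ] Fam ℤ B
  norm_s : ∀ n p, ‖s n p‖ ≤ 1
  E_mul : ∀ n p b, E * s n p b = s n (p + 1) b
  row_s : ∀ n p b, row (s n p b) = Fam.single n (sgn p • b)
  norm_row : ‖row‖ ≤ 1

namespace Frame

variable {R B : Type*} [NormedCommRing R] [NormedAlgebra ℝ R] [CompleteSpace R] [NormOneClass R]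
  [NormedCommRing B] [NormedAlgebra ℝ B] [NormOneClass B] [CompleteSpace B]
  [StarRing B] [NormedStarGroup B] [StarModule ℝ B] (S : Frame R B)

/-- The mean of the elements of frequencies `(n, p)` with `p ∈ s`. -/
def avg (n : ℤ) (s : Finset ℤ) (e : ℤ) : B →L[ℝ] R :=
  (s.card : ℝ)⁻¹ • ∑ p ∈ s, S.s (e * n) (e * p)

theorem avg_apply (n : ℤ) (s : Finset ℤ) (e : ℤ) (b : B) :
    S.avg n s e b = (s.card : ℝ)⁻¹ • ∑ p ∈ s, S.s (e * n) (e * p) b := by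
  simp [avg]

theorem norm_avg_le (n : ℤ) (s : Finset ℤ) (e : ℤ) : ‖S.avg n s e‖ ≤ 1 := by
  unfold avg
  rw [norm_smul, norm_inv, Real.norm_natCast]
  have h : ‖∑ p ∈ s, S.s (e * n) (e * p)‖ ≤ s.card := by
    refine (norm_sum_le _ _).trans ?_
    refine (Finset.sum_le_card_nsmul _ _ 1 fun p _ => S.norm_s _ _).trans ?_
    simp
  rcases Nat.eq_zero_or_pos s.card with h0 | h0
  · simp [h0]
  · have : (0 : ℝ) < s.card := by exact_mod_cast h0
    rw [inv_mul_le_iff₀ this]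
    simpa using h

/-- The value of the `i`-th variable on the mode `n`. -/
def embTerm : Fin 4 → ℤ → B →L[ℝ] R :=
  ![fun n => S.avg n {n} 1, fun n => (S.avg n {n} (-1)).comp (conjL B),
    fun n => S.avg n (freqs n) 1, fun n => (S.avg n (freqs n) (-1)).comp (conjL B)]

theorem norm_embTerm_le (i : Fin 4) (n : ℤ) : ‖S.embTerm i n‖ ≤ 1 := by
  have h (s : Finset ℤ) : ‖(S.avg n s (-1)).comp (conjL B)‖ ≤ 1 :=
    (ContinuousLinearMap.opNorm_comp_le _ _).trans
      (mul_le_one₀ (S.norm_avg_le _ _ _) (norm_nonneg _) norm_conjL_le)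
  fin_cases i
  exacts [S.norm_avg_le _ _ _, h _, S.norm_avg_le _ _ _, h _]

/-- The `i`-th variable: the function, its conjugate, its divided difference and the conjugate of
the latter. -/
def emb (i : Fin 4) : Fam ℤ B →L[ℝ] R := Fam.lift (S.embTerm i) (S.norm_embTerm_le i)

theorem norm_emb_le (i : Fin 4) (v : Fam ℤ B) : ‖S.emb i v‖ ≤ ‖v‖ :=
  (Fam.norm_lift_le _ _ v).trans (one_mul _).le

theorem emb_single (i : Fin 4) (n : ℤ) (b : B) : S.emb i (Fam.single n b) = S.embTerm i n b :=
  Fam.lift_single _ _ _ _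

theorem emb_zero_single (n : ℤ) (b : B) : S.emb 0 (Fam.single n b) = S.s n n b := by
  simp [emb_single, embTerm, avg_apply]

theorem emb_one_single (n : ℤ) (b : B) : S.emb 1 (Fam.single n b) = S.s (-n) (-n) (star b) := by
  simp [emb_single, embTerm, avg_apply]

theorem emb_two_single (n : ℤ) (b : B) : S.emb 2 (Fam.single n b)
    = |(n : ℝ) + 1|⁻¹ • ∑ p ∈ freqs n, S.s n p b := by
  simp [emb_single, embTerm, avg_apply, card_freqs]

theorem emb_three_single (n : ℤ) (b : B) : S.emb 3 (Fam.single n b)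
    = |(n : ℝ) + 1|⁻¹ • ∑ p ∈ freqs n, S.s (-n) (-p) (star b) := by
  simp [emb_single, embTerm, avg_apply, card_freqs]

theorem E_sq_mul (n p : ℤ) (b : B) : S.E ^ 2 * S.s n p b = S.s n (p + 2) b := by
  rw [pow_two, mul_assoc, E_mul, E_mul, add_assoc]; rfl

/-- The linear part of the row sums of the nonlinearity. -/
def linRow (c : ℕ → ℝ) : Fam ℤ B →L[ℝ] Fam ℤ B :=
  ∑ i, S.row ∘L (ContinuousLinearMap.mul ℝ R (nonlinCoeff c S.E i)) ∘L S.emb i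

theorem linRow_apply (c : ℕ → ℝ) (v : Fam ℤ B) :
    S.linRow c v = S.row (∑ i, nonlinCoeff c S.E i * S.emb i v) := by
  simp [linRow, map_sum]

/-- The coefficient of `v n` in row `n` of the linear part. -/
def diagCoeff (c : ℕ → ℝ) (n : ℤ) : ℝ :=
  (2 * c 0 + c 1) * sgn (n + 2) + c 1 * sgn n
    + c 0 * (|(n : ℝ) + 1|⁻¹ * ∑ p ∈ freqs n, (sgn p - sgn (p + 2)))

/-- The coefficient of `star (v (-n))` in row `n` of the linear part. -/
def antiCoeff (c : ℕ → ℝ) (n : ℤ) : ℝ :=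
  (2 * c 0 + c 1) * sgn n + c 1 * sgn (n + 2)
    - 2 * c 0 * (|(n : ℝ) - 1|⁻¹ * ∑ p ∈ freqs (-n), sgn (-p))

/-- The variables `0` and `2` keep the index `k`, whereas their conjugates `1` and `3` reflect it to
`-k`. Multiplication by `E²` moves only the second frequency, by two, and so affects only the sign
`sgn`. -/
theorem linRow_single (c : ℕ → ℝ) (k : ℤ) (b : B) : S.linRow c (Fam.single k b)
    = Fam.single k (diagCoeff c k • b) + Fam.single (-k) (antiCoeff c (-k) • star b) := by
  have e : |((-k : ℤ) : ℝ) - 1| = |(k : ℝ) + 1| := by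
    rw [← abs_neg]; push_cast; congr 1; ring
  have hrow (n : ℤ) (s : Finset ℤ) (f : ℤ → ℤ) (b : B) :
      S.row (∑ p ∈ s, S.s n (f p) b) = (∑ p ∈ s, sgn (f p)) • Fam.single n b := by
    simp [map_sum, row_s, Finset.sum_smul]
  have hmul (n : ℤ) (s : Finset ℤ) (b : B) :
      S.E ^ 2 * ∑ p ∈ s, S.s n p b = ∑ p ∈ s, S.s n (p + 2) b := by
    simp [Finset.mul_sum, E_sq_mul]
  rw [linRow_apply, Fin.sum_univ_four, emb_zero_single, emb_one_single, emb_two_single,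
    emb_three_single, diagCoeff, antiCoeff, e, neg_neg]
  simp only [nonlinCoeff, Matrix.cons_val_zero, Matrix.cons_val_one, Matrix.cons_val,
    add_mul, sub_mul, neg_mul, smul_mul_assoc, one_mul, mul_smul_comm, hmul, E_sq_mul,
    map_add, map_sub, map_neg, map_smul, hrow, row_s, Finset.sum_sub_distrib]
  module

end Frame

/-! ### Values of the coefficients of the linear part -/

/-- The sign changes between `p` and `p + 2` only for `p = 0` and `p = -1`, and exactly one of these
lies in `freqs n` when `n ≠ -1`. -/
theorem sum_freqs_sub (n : ℤ) (hn : n ≠ -1) :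
    ∑ p ∈ freqs n, (sgn p - sgn (p + 2)) = -2 := by
  have key : ∀ p : ℤ, sgn p - sgn (p + 2) = if p = 0 ∨ p = -1 then -2 else 0 := by
    intro p
    unfold sgn
    split_ifs <;> first | omega | norm_num
  simp only [key]
  unfold freqs
  split_ifs with h
  · rw [Finset.sum_eq_single 0]
    · simp
    · intro p hp hp0
      rw [Finset.mem_Icc] at hp
      rw [if_neg (by omega)]
    · intro h0
      exact absurd (Finset.mem_Icc.2 ⟨le_rfl, h⟩) h0
  · rw [Finset.sum_eq_single (-1)]
    · simp
    · intro p hp hp0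
      rw [Finset.mem_Icc] at hp
      rw [if_neg (by omega)]
    · intro h0
      exact absurd (Finset.mem_Icc.2 ⟨by omega, le_rfl⟩) h0

/-- The sign `sgn (-p)` is constant on `freqs n`, so its mean is that constant. -/
theorem avg_freqs_neg (n : ℤ) (hn : n ≠ -1) :
    |(n : ℝ) + 1|⁻¹ * ∑ p ∈ freqs n, sgn (-p) = if 0 ≤ n then -1 else 1 := by
  have h1 : |(n : ℝ) + 1| ≠ 0 := by
    rw [abs_ne_zero]
    exact_mod_cast (by omega : n + 1 ≠ 0)
  have h2 : ∀ p ∈ freqs n, sgn (-p) = if 0 ≤ n then -1 else 1 := by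
    intro p hp
    unfold freqs at hp
    unfold sgn
    split_ifs at hp ⊢ <;> rw [Finset.mem_Icc] at hp <;> omega
  rw [Finset.sum_congr rfl h2, Finset.sum_const, nsmul_eq_mul, card_freqs, ← mul_assoc,
    inv_mul_cancel₀ h1, one_mul]

namespace Frame

theorem diagCoeff_of_pos (c : ℕ → ℝ) {n : ℤ} (hn : 1 ≤ n) :
    diagCoeff c n = 2 * n / (n + 1) * c 0 + 2 * c 1 := by
  have h0 : (0 : ℝ) < n + 1 := by exact_mod_cast (by omega : (0 : ℤ) < n + 1)
  rw [diagCoeff, sum_freqs_sub n (by omega), abs_of_pos h0, sgn, sgn, if_pos (by omega),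
    if_pos (by omega)]
  field_simp
  ring

theorem diagCoeff_of_neg (c : ℕ → ℝ) {n : ℤ} (hn : n ≤ -2) :
    diagCoeff c n = -(2 * n / (n + 1) * c 0 + 2 * c 1) := by
  have h0 : (n : ℝ) + 1 < 0 := by exact_mod_cast (by omega : n + 1 < (0 : ℤ))
  rw [diagCoeff, sum_freqs_sub n (by omega), abs_of_neg h0, sgn, sgn, if_neg (by omega),
    if_neg (by omega)]
  have : (n : ℝ) + 1 ≠ 0 := h0.ne
  field_simp
  ring

theorem diagCoeff_zero (c : ℕ → ℝ) : diagCoeff c 0 = 0 := by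
  rw [diagCoeff, sum_freqs_sub 0 (by omega), sgn, sgn]
  norm_num
  ring

theorem antiCoeff_of_pos (c : ℕ → ℝ) {n : ℤ} (hn : 2 ≤ n) : antiCoeff c n = 2 * c 1 := by
  have e : |(n : ℝ) - 1| = |((-n : ℤ) : ℝ) + 1| := by
    rw [← abs_neg]; push_cast; congr 1; ring
  rw [antiCoeff, e, avg_freqs_neg (-n) (by omega), sgn, sgn, if_pos (by omega), if_pos (by omega),
    if_neg (by omega)]
  ring

theorem antiCoeff_of_neg (c : ℕ → ℝ) {n : ℤ} (hn : n ≤ -2) : antiCoeff c n = -(2 * c 1) := by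
  have e : |(n : ℝ) - 1| = |((-n : ℤ) : ℝ) + 1| := by
    rw [← abs_neg]; push_cast; congr 1; ring
  rw [antiCoeff, e, avg_freqs_neg (-n) (by omega), sgn, sgn, if_neg (by omega), if_neg (by omega),
    if_pos (by omega)]
  ring

theorem antiCoeff_zero (c : ℕ → ℝ) : antiCoeff c 0 = 0 := by
  have := avg_freqs_neg 0 (by omega)
  rw [antiCoeff, neg_zero, sgn, sgn]
  norm_num at this ⊢
  rw [this]
  ring

theorem exists_coeff_bound (c : ℕ → ℝ) :
    ∃ C, ∀ n, |diagCoeff c n| ≤ C ∧ |antiCoeff c n| ≤ C := by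
  have hs : ∀ n : ℤ, |(n : ℝ) + 1|⁻¹ * (freqs n).card ≤ 1 := by
    intro n
    rw [card_freqs]
    exact inv_mul_le_one
  have h1 : ∀ n : ℤ, |(|(n : ℝ) + 1|⁻¹) * ∑ p ∈ freqs n, (sgn p - sgn (p + 2))| ≤ 2 := by
    intro n
    rw [abs_mul, abs_inv, abs_abs]
    have : |∑ p ∈ freqs n, (sgn p - sgn (p + 2))| ≤ (freqs n).card * 2 := by
      refine (Finset.abs_sum_le_sum_abs _ _).trans ?_
      refine (Finset.sum_le_card_nsmul _ _ 2 fun p _ => ?_).trans (by simp)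
      refine (abs_sub _ _).trans ?_
      rw [abs_sgn, abs_sgn]; norm_num
    calc _ ≤ |(n : ℝ) + 1|⁻¹ * ((freqs n).card * 2) := by gcongr
      _ = (|(n : ℝ) + 1|⁻¹ * (freqs n).card) * 2 := by ring
      _ ≤ 1 * 2 := by gcongr; exact hs n
      _ = 2 := one_mul 2
  have h2 : ∀ n : ℤ, |(|(n : ℝ) - 1|⁻¹) * ∑ p ∈ freqs (-n), sgn (-p)| ≤ 1 := by
    intro n
    have e : |(n : ℝ) - 1| = |((-n : ℤ) : ℝ) + 1| := by
      rw [← abs_neg]; push_cast; congr 1; ring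
    rw [e, abs_mul, abs_inv, abs_abs]
    have : |∑ p ∈ freqs (-n), sgn (-p)| ≤ (freqs (-n)).card := by
      refine (Finset.abs_sum_le_sum_abs _ _).trans ?_
      exact (Finset.sum_le_card_nsmul _ _ 1 fun p _ => (abs_sgn _).le).trans (by simp)
    exact (mul_le_mul_of_nonneg_left this (by positivity)).trans (hs (-n))
  refine ⟨|2 * c 0 + c 1| + |c 1| + 2 * |c 0|, fun n => ⟨?_, ?_⟩⟩
  · unfold diagCoeff
    refine (abs_add_three _ _ _).trans ?_
    rw [abs_mul, abs_mul, abs_sgn, abs_sgn, mul_one, mul_one, abs_mul (c 0)]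
    have := mul_le_mul_of_nonneg_left (h1 n) (abs_nonneg (c 0))
    linarith
  · unfold antiCoeff
    refine (abs_sub _ _).trans ?_
    refine (add_le_add_left (abs_add_le _ _) _).trans ?_
    rw [abs_mul, abs_mul, abs_sgn, abs_sgn, mul_one, mul_one, abs_mul, abs_mul 2 (c 0)]
    have := mul_le_mul_of_nonneg_left (h2 n) (show 0 ≤ |(2 : ℝ)| * |c 0| by positivity)
    rw [abs_two] at *
    linarith

variable {R B : Type*} [NormedCommRing R] [NormedAlgebra ℝ R] [CompleteSpace R] [NormOneClass R]
  [NormedCommRing B] [NormedAlgebra ℝ B] [NormOneClass B] [CompleteSpace B]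
  [StarRing B] [NormedStarGroup B] [StarModule ℝ B] (S : Frame R B)

theorem linRow_eq (c : ℕ → ℝ) (v : Fam ℤ B) (n : ℤ) :
    S.linRow c v n = diagCoeff c n • v n + antiCoeff c n • star (v (-n)) := by
  obtain ⟨C, hC⟩ := exists_coeff_bound c
  have : S.linRow c = twoDiag (diagCoeff c) (antiCoeff c) (fun n => (hC n).1) fun n => (hC n).2 :=
    Fam.clm_ext fun k b => by rw [linRow_single, twoDiag_single]
  rw [this, twoDiag_apply]

end Frame

/-! ### The truncated Hilbert kernel on the circle -/

/-- The Dirichlet kernel `sin ((p - 1/2) α) / sin (α / 2)`. -/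
def dirichlet (p : ℤ) (α : ℝ) : ℝ := Real.sin ((p - 1 / 2) * α) / Real.sin (α / 2)

theorem sin_half_pos {α : ℝ} (h0 : 0 < α) (h1 : α ≤ Real.pi) : 0 < Real.sin (α / 2) :=
  Real.sin_pos_of_pos_of_lt_pi (by linarith) (by linarith [Real.pi_pos])

theorem le_sin_half {α : ℝ} (h0 : 0 ≤ α) (h1 : α ≤ Real.pi) : α / Real.pi ≤ Real.sin (α / 2) := by
  have := Real.mul_le_sin (x := α / 2) (by linarith) (by linarith)
  calc α / Real.pi = 2 / Real.pi * (α / 2) := by ring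
    _ ≤ _ := this

theorem continuousOn_dirichlet (p : ℤ) : ContinuousOn (dirichlet p) (Ioc 0 Real.pi) := by
  unfold dirichlet
  refine ContinuousOn.div (by fun_prop) (by fun_prop) fun α hα => (sin_half_pos hα.1 hα.2).ne'

theorem uIcc_subset_Ioc {a b : ℝ} (ha : 0 < a) (hab : a ≤ b) (hb : b ≤ Real.pi) :
    uIcc a b ⊆ Ioc 0 Real.pi := by
  rw [uIcc_of_le hab]
  exact fun x hx => ⟨ha.trans_le hx.1, hx.2.trans hb⟩

theorem intervalIntegrable_dirichlet (p : ℤ) {a b : ℝ} (ha : 0 < a) (hab : a ≤ b)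
    (hb : b ≤ Real.pi) : IntervalIntegrable (dirichlet p) volume a b :=
  ((continuousOn_dirichlet p).mono (uIcc_subset_Ioc ha hab hb)).intervalIntegrable

theorem dirichlet_one_sub (p : ℤ) (α : ℝ) : dirichlet (1 - p) α = -dirichlet p α := by
  unfold dirichlet
  rw [← neg_div, ← Real.sin_neg]
  congr 2
  push_cast
  ring

theorem dirichlet_succ (p : ℤ) {α : ℝ} (h : Real.sin (α / 2) ≠ 0) :
    dirichlet (p + 1) α = dirichlet p α + 2 * Real.cos (p * α) := by
  unfold dirichlet
  rw [div_add' _ _ _ h]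
  congr 1
  have e1 : ((p + 1 : ℤ) - 1 / 2 : ℝ) * α = p * α + α / 2 := by push_cast; ring
  have e2 : ((p : ℝ) - 1 / 2) * α = p * α - α / 2 := by ring
  rw [e1, e2, Real.sin_add, Real.sin_sub]
  ring

/-- The kernel with index `1` is the constant `1`, and raising the index by one adds `2 cos (pα)`,
whose integral over `[0, π]` vanishes for `p ≥ 1`. -/
theorem tendsto_integral_dirichlet_succ (n : ℕ) :
    Tendsto (fun δ => ∫ α in δ..Real.pi, dirichlet (n + 1) α) (𝓝[>] 0) (𝓝 Real.pi) := by
  have hmem : ∀ᶠ δ : ℝ in 𝓝[>] 0, 0 < δ ∧ δ ≤ Real.pi := by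
    filter_upwards [Ioc_mem_nhdsGT Real.pi_pos] with δ hδ using hδ
  induction n with
  | zero =>
    have h1 : Tendsto (fun δ : ℝ => Real.pi - δ) (𝓝[>] 0) (𝓝 Real.pi) := by
      have : Tendsto (fun δ : ℝ => Real.pi - δ) (𝓝 0) (𝓝 (Real.pi - 0)) :=
        (continuous_const.sub continuous_id).tendsto 0
      rw [sub_zero] at this
      exact this.mono_left nhdsWithin_le_nhds
    refine h1.congr' ?_
    filter_upwards [hmem] with δ hδ
    have : ∫ α in δ..Real.pi, dirichlet ((0 : ℕ) + 1) α = ∫ α in δ..Real.pi, (1 : ℝ) := by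
      refine intervalIntegral.integral_congr fun α hα => ?_
      obtain ⟨h2, h3⟩ := uIcc_subset_Ioc hδ.1 hδ.2 le_rfl hα
      have h4 := (sin_half_pos h2 h3).ne'
      unfold dirichlet
      rw [div_eq_one_iff_eq h4]
      congr 1
      push_cast
      ring
    rw [this]
    simp
  | succ n ih =>
    have h1 : Tendsto (fun δ : ℝ => ∫ α in δ..Real.pi, 2 * Real.cos ((n + 1 : ℝ) * α)) (𝓝[>] 0)
        (𝓝 0) := by
      have h2 : ∀ δ : ℝ, ∫ α in δ..Real.pi, 2 * Real.cos ((n + 1 : ℝ) * α)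
          = -(2 * Real.sin ((n + 1 : ℝ) * δ) / (n + 1)) := by
        intro δ
        have hd : ∀ x ∈ uIcc δ Real.pi, HasDerivAt
            (fun x : ℝ => 2 * Real.sin ((n + 1 : ℝ) * x) / (n + 1))
            (2 * Real.cos ((n + 1 : ℝ) * x)) x := by
          intro x _
          have := (((((hasDerivAt_id x).const_mul (n + 1 : ℝ)).sin).const_mul 2).div_const
            (n + 1 : ℝ))
          refine this.congr_deriv ?_
          simp only [id]
          field_simp
        rw [intervalIntegral.integral_eq_sub_of_hasDerivAt hd
          (Continuous.intervalIntegrable (by fun_prop) _ _)]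
        have : Real.sin ((n + 1 : ℝ) * Real.pi) = 0 := by
          exact_mod_cast Real.sin_nat_mul_pi (n + 1)
        rw [this]
        ring
      simp only [h2]
      have : Tendsto (fun δ : ℝ => -(2 * Real.sin ((n + 1 : ℝ) * δ) / (n + 1))) (𝓝 0)
          (𝓝 (-(2 * Real.sin ((n + 1 : ℝ) * 0) / (n + 1)))) :=
        Continuous.tendsto (by fun_prop) 0
      simp only [mul_zero, Real.sin_zero, zero_div, neg_zero] at this
      exact this.mono_left nhdsWithin_le_nhds
    have h3 := ih.add h1
    rw [add_zero] at h3
    refine h3.congr' ?_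
    filter_upwards [hmem] with δ hδ
    rw [← intervalIntegral.integral_add (intervalIntegrable_dirichlet _ hδ.1 hδ.2 le_rfl)
      (Continuous.intervalIntegrable (by fun_prop) _ _)]
    refine intervalIntegral.integral_congr fun α hα => ?_
    obtain ⟨h2, h3⟩ := uIcc_subset_Ioc hδ.1 hδ.2 le_rfl hα
    have := dirichlet_succ (n + 1) (sin_half_pos h2 h3).ne'
    push_cast at this ⊢
    rw [this]

/-- Indices `p ≤ 0` follow from the antisymmetry under `p ↦ 1 - p`; this is why `sgn 0 = -1`. -/
theorem tendsto_integral_dirichlet (p : ℤ) :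
    Tendsto (fun δ => ∫ α in δ..Real.pi, dirichlet p α) (𝓝[>] 0) (𝓝 (Real.pi * sgn p)) := by
  unfold sgn
  split_ifs with h
  · obtain ⟨n, hn⟩ := Int.eq_ofNat_of_zero_le (show 0 ≤ p - 1 by omega)
    have := tendsto_integral_dirichlet_succ n
    rw [show ((n : ℤ) + 1) = p by omega] at this
    simpa using this
  · obtain ⟨n, hn⟩ := Int.eq_ofNat_of_zero_le (show 0 ≤ -p by omega)
    have := (tendsto_integral_dirichlet_succ n).neg
    rw [show ((n : ℤ) + 1) = 1 - p by omega] at this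
    simp only [dirichlet_one_sub, intervalIntegral.integral_neg, neg_neg] at this
    simpa using this

/-- Integration by parts: the boundary terms are of order `(2/M) / sin (a/2)`, which is bounded
because `a ≥ 1/M`. The remaining integrand `g` is dominated by `k`, the derivative of a multiple of
`1 / sin (x/2)`, so its integral is explicit as well. -/
theorem abs_integral_dirichlet_tail (M : ℝ) (hM : 1 ≤ M) {a : ℝ} (ha : 1 / M ≤ a)
    (ha' : a ≤ Real.pi) : |∫ α in a..Real.pi, Real.sin (M / 2 * α) / Real.sin (α / 2)|
      ≤ 4 * Real.pi := by
  have hM0 : 0 < M := by linarith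
  have ha0 : 0 < a := (by positivity : 0 < 1 / M).trans_le ha
  have hs : ∀ x ∈ uIcc a Real.pi, Real.sin (x / 2) ≠ 0 := fun x hx =>
    have := uIcc_subset_Ioc ha0 ha' le_rfl hx
    (sin_half_pos this.1 this.2).ne'
  have dsin (x : ℝ) : HasDerivAt (fun x => Real.sin (x / 2)) (Real.cos (x / 2) * (1 / 2)) x :=
    ((hasDerivAt_id x).div_const 2).sin
  have dcos (x : ℝ) : HasDerivAt (fun x => Real.cos (M / 2 * x))
      (-Real.sin (M / 2 * x) * (M / 2)) x := by
    simpa using ((hasDerivAt_id x).const_mul (M / 2)).cos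
  set f : ℝ → ℝ := fun x => Real.sin (M / 2 * x) / Real.sin (x / 2) with hf
  set g : ℝ → ℝ := fun x => Real.cos (M / 2 * x) * Real.cos (x / 2) / Real.sin (x / 2) ^ 2 / M
    with hg
  set k : ℝ → ℝ := fun x => Real.cos (x / 2) / Real.sin (x / 2) ^ 2 / M with hk
  have cf : ContinuousOn f (uIcc a Real.pi) := ContinuousOn.div (by fun_prop) (by fun_prop) hs
  have cg : ContinuousOn g (uIcc a Real.pi) :=
    (ContinuousOn.div (by fun_prop) (by fun_prop) fun x hx => pow_ne_zero 2 (hs x hx)).div_const M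
  have ck : ContinuousOn k (uIcc a Real.pi) :=
    (ContinuousOn.div (by fun_prop) (by fun_prop) fun x hx => pow_ne_zero 2 (hs x hx)).div_const M
  have h1 : ∫ α in a..Real.pi, (f α + g α)
      = -(2 / M) * (Real.cos (M / 2 * Real.pi) / Real.sin (Real.pi / 2))
        - -(2 / M) * (Real.cos (M / 2 * a) / Real.sin (a / 2)) := by
    refine intervalIntegral.integral_eq_sub_of_hasDerivAt
      (f := fun x => -(2 / M) * (Real.cos (M / 2 * x) / Real.sin (x / 2))) (fun x hx => ?_)
      (cf.add cg).intervalIntegrable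
    refine (((dcos x).div (dsin x) (hs x hx)).const_mul (-(2 / M))).congr_deriv ?_
    have := hs x hx
    simp only [hf, hg]
    field_simp
    ring
  have h2 : ∫ α in a..Real.pi, k α
      = -(2 / M) * (1 / Real.sin (Real.pi / 2)) - -(2 / M) * (1 / Real.sin (a / 2)) := by
    refine intervalIntegral.integral_eq_sub_of_hasDerivAt
      (f := fun x => -(2 / M) * (1 / Real.sin (x / 2))) (fun x hx => ?_) ck.intervalIntegrable
    refine (((hasDerivAt_const x (1 : ℝ)).div (dsin x) (hs x hx)).const_mul
      (-(2 / M))).congr_deriv ?_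
    have := hs x hx
    simp only [hk]
    field_simp
    ring
  have h3 : |∫ α in a..Real.pi, g α| ≤ ∫ α in a..Real.pi, k α := by
    refine intervalIntegral.abs_integral_le_integral_abs ha' |>.trans ?_
    refine intervalIntegral.integral_mono_on ha' cg.abs.intervalIntegrable ck.intervalIntegrable
      fun x hx => ?_
    have hc : 0 ≤ Real.cos (x / 2) :=
      Real.cos_nonneg_of_neg_pi_div_two_le_of_le (by linarith [hx.1, Real.pi_pos])
        (by linarith [hx.2])
    simp only [hg, hk]
    rw [abs_div, abs_div, abs_mul, abs_of_pos hM0, abs_of_nonneg hc,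
      abs_of_nonneg (sq_nonneg (Real.sin (x / 2)))]
    gcongr
    exact mul_le_of_le_one_left hc (Real.abs_cos_le_one _)
  have h4 : ∫ α in a..Real.pi, f α = (∫ α in a..Real.pi, (f α + g α)) - ∫ α in a..Real.pi, g α := by
    rw [intervalIntegral.integral_add cf.intervalIntegrable cg.intervalIntegrable]; ring
  have hsa : 1 / (M * Real.pi) ≤ Real.sin (a / 2) := by
    refine le_trans ?_ (le_sin_half ha0.le ha')
    rw [← div_div]
    gcongr
  have hsa0 : 0 < Real.sin (a / 2) := lt_of_lt_of_le (by positivity) hsa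
  have hS : 1 / Real.sin (a / 2) ≤ M * Real.pi := by
    rw [div_le_iff₀ hsa0]
    rwa [div_le_iff₀ (by positivity), mul_comm] at hsa
  rw [Real.sin_pi_div_two] at h1 h2
  rw [h4, h1]
  have e1 : |Real.cos (M / 2 * Real.pi)| ≤ 1 := Real.abs_cos_le_one _
  have e2 : |Real.cos (M / 2 * a) / Real.sin (a / 2)| ≤ M * Real.pi := by
    rw [abs_div, abs_of_pos hsa0]
    exact (div_le_div_of_nonneg_right (Real.abs_cos_le_one _) hsa0.le).trans hS
  have e3 : 2 / M * (M * Real.pi) = 2 * Real.pi := by field_simp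
  have hM2 : 0 < 2 / M := by positivity
  rw [h2] at h3
  have e4 := mul_le_mul_of_nonneg_left hS hM2.le
  have e5 := abs_le.1 h3
  have e6 := abs_le.1 e1
  have e7 := abs_le.1 e2
  have e8 := mul_le_mul_of_nonneg_left e6.1 hM2.le
  have e9 := mul_le_mul_of_nonneg_left e6.2 hM2.le
  have e10 := mul_le_mul_of_nonneg_left e7.1 hM2.le
  have e11 := mul_le_mul_of_nonneg_left e7.2 hM2.le
  rw [abs_le]
  constructor <;> linarith

/-- The oscillation is used only above `1/M`; below, the integrand is at most `Mπ/2` on an interval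
of length at most `1/M`. -/
theorem abs_integral_dirichlet_aux (M : ℝ) (hM : 1 ≤ M) {δ : ℝ} (hδ : 0 < δ)
    (hδ' : δ ≤ Real.pi) : |∫ α in δ..Real.pi, Real.sin (M / 2 * α) / Real.sin (α / 2)|
      ≤ 6 * Real.pi := by
  rcases le_total (1 / M) δ with h | h
  · exact (abs_integral_dirichlet_tail M hM h hδ').trans (by linarith [Real.pi_pos])
  · have hM0 : 0 < M := by linarith
    have h1 : 1 / M ≤ Real.pi := by
      have : 1 / M ≤ 1 := by rw [div_le_one hM0]; exact hM
      linarith [Real.pi_gt_three]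
    have hc : ContinuousOn (fun α : ℝ => Real.sin (M / 2 * α) / Real.sin (α / 2))
        (Ioc 0 Real.pi) :=
      ContinuousOn.div (by fun_prop) (by fun_prop) fun x hx => (sin_half_pos hx.1 hx.2).ne'
    have i1 := (hc.mono (uIcc_subset_Ioc hδ h h1)).intervalIntegrable (μ := volume)
    have i2 := (hc.mono (uIcc_subset_Ioc (hδ.trans_le h) h1 le_rfl)).intervalIntegrable
      (μ := volume)
    rw [← intervalIntegral.integral_add_adjacent_intervals i1 i2]
    have b1 : |∫ α in δ..(1 / M), Real.sin (M / 2 * α) / Real.sin (α / 2)|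
        ≤ M / 2 * Real.pi * |1 / M - δ| := by
      rw [← Real.norm_eq_abs]
      refine intervalIntegral.norm_integral_le_of_norm_le_const fun x hx => ?_
      rw [uIoc_of_le h] at hx
      have hx0 : 0 < x := hδ.trans hx.1
      have hs := le_sin_half hx0.le (hx.2.trans h1)
      have hs0 := sin_half_pos hx0 (hx.2.trans h1)
      rw [Real.norm_eq_abs, abs_div, abs_of_pos hs0, div_le_iff₀ hs0]
      calc |Real.sin (M / 2 * x)| ≤ |M / 2 * x| := Real.abs_sin_le_abs
        _ = M / 2 * Real.pi * (x / Real.pi) := by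
          rw [abs_of_pos (by positivity)]; field_simp
        _ ≤ _ := by gcongr
    have b2 : M / 2 * Real.pi * |1 / M - δ| ≤ 2 * Real.pi := by
      rw [abs_of_nonneg (by linarith)]
      calc M / 2 * Real.pi * (1 / M - δ) ≤ M / 2 * Real.pi * (1 / M) := by
            gcongr; linarith
        _ = Real.pi / 2 := by field_simp
        _ ≤ _ := by linarith [Real.pi_pos]
    have b3 := abs_integral_dirichlet_tail M hM le_rfl h1
    exact (abs_add_le _ _).trans (by linarith)

/-- Uniformity in both `p` and `δ` is the point: it allows the principal value of a whole Fourier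
series to be taken term by term. -/
theorem abs_integral_dirichlet_le (p : ℤ) {δ : ℝ} (hδ : 0 < δ) (hδ' : δ ≤ Real.pi) :
    |∫ α in δ..Real.pi, dirichlet p α| ≤ 6 * Real.pi := by
  have key : ∀ p : ℤ, 1 ≤ p → |∫ α in δ..Real.pi, dirichlet p α| ≤ 6 * Real.pi := by
    intro p hp
    have hp' : (1 : ℝ) ≤ p := by exact_mod_cast hp
    have := abs_integral_dirichlet_aux (2 * p - 1) (by linarith) hδ hδ'
    have e : ∀ α : ℝ, (2 * (p : ℝ) - 1) / 2 * α = (p - 1 / 2) * α := fun α => by ring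
    simpa only [e, dirichlet] using this
  rcases le_or_gt 1 p with h | h
  · exact key p h
  · have := key (1 - p) (by omega)
    simpa only [dirichlet_one_sub, intervalIntegral.integral_neg, abs_neg] using this

/-! ### The Wiener algebra of the torus -/

/-- The trivial cocycle. -/
def Cocycle.trivial (M B : Type*) [AddCommMonoid M] [NormedCommRing B] [NormOneClass B] :
    Cocycle M B where
  toFun _ _ := 1
  norm_le _ _ := norm_one.le
  comm _ _ := rfl
  zero_left _ := rfl
  assoc _ _ _ := rfl

/-- The underlying family of coefficients. -/
def Conv.toFam {M B : Type*} [AddCommMonoid M] [NormedCommRing B] {ρ : Cocycle M B}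
    (G : Conv ρ) : Fam M B := G

/-- The Wiener algebra of the two-dimensional torus. -/
abbrev Wiener := Conv (Cocycle.trivial (ℤ × ℤ) ℂ)

/-- The Wiener algebra as an algebra with frequencies. -/
def wienerFrame : Frame Wiener ℂ where
  s n p := Conv.single _ (n, p)
  E := Conv.single _ (0, 1) 1
  row := Conv.lift _ (C := 1) (fun a => sgn a.2 • Fam.single a.1) fun a =>
    ContinuousLinearMap.opNorm_le_bound _ zero_le_one fun b => by simp [norm_smul, abs_sgn]
  norm_s n p := ContinuousLinearMap.opNorm_le_bound _ zero_le_one fun b => by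
    simp [Conv.norm_single]
  E_mul n p b := by
    have h : ((0 : ℤ), (1 : ℤ)) + (n, p) = (n, p + 1) := by ext <;> simp [add_comm]
    have h' : (Cocycle.trivial (ℤ × ℤ) ℂ).toFun (0, 1) (n, p) * 1 * b = b := by
      rw [mul_one]
      exact one_mul b
    rw [Conv.single_mul_single, h, h']
  row_s n p b := by
    rw [Conv.lift_single, map_smul]
    rfl
  norm_row := ContinuousLinearMap.opNorm_le_bound _ zero_le_one fun f =>
    Fam.norm_lift_le _ _ f

/-- The exponential `e^{ins} e^{ip(r-s)}`. -/
def torusExp (s r : ℝ) (a : ℤ × ℤ) : ℂ :=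
  Complex.exp (Complex.I * (a.1 * s)) * Complex.exp (Complex.I * (a.2 * (r - s)))

theorem norm_exp_I (x : ℝ) : ‖Complex.exp (Complex.I * x)‖ = 1 := by
  rw [mul_comm, Complex.norm_exp_ofReal_mul_I]

theorem norm_torusExp (s r : ℝ) (a : ℤ × ℤ) : ‖torusExp s r a‖ = 1 := by
  have h1 := norm_exp_I (a.1 * s)
  have h2 := norm_exp_I (a.2 * (r - s))
  push_cast at h1 h2
  rw [torusExp, norm_mul, h1, h2, one_mul]

theorem torusExp_add (s r : ℝ) (a b : ℤ × ℤ) :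
    torusExp s r (a + b) = torusExp s r a * torusExp s r b := by
  simp only [torusExp, ← Complex.exp_add]
  congr 1
  simp only [Prod.fst_add, Prod.snd_add]
  push_cast
  ring

theorem norm_torusExp_mul_le (s r : ℝ) (a : ℤ × ℤ) :
    ‖ContinuousLinearMap.mul ℝ ℂ (torusExp s r a)‖ ≤ 1 :=
  (ContinuousLinearMap.opNorm_mul_apply_le ℝ ℂ _).trans (norm_torusExp s r a).le

/-- Evaluation at the point `(s, r)` of the torus. -/
def torusEval (s r : ℝ) : Wiener →ₐ[ℝ] ℂ :=
  Conv.hom _ (fun a => ContinuousLinearMap.mul ℝ ℂ (torusExp s r a))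
    (norm_torusExp_mul_le s r) (by simp [torusExp])
    (fun a a' b b' => by
      simp only [Cocycle.trivial, ContinuousLinearMap.mul_apply', torusExp_add]
      ring)

theorem continuous_torusEval (s r : ℝ) : Continuous (torusEval s r) := Conv.continuous_hom _ _ _ _ _

theorem torusEval_single (s r : ℝ) (a : ℤ × ℤ) (b : ℂ) :
    torusEval s r (Conv.single _ a b) = torusExp s r a * b :=
  Conv.lift_single _ _ _ _ _

theorem hasSum_torusEval (s r : ℝ) (G : Wiener) :
    HasSum (fun a => torusExp s r a * G.toFam a) (torusEval s r G) :=
  Fam.hasSum_lift _ (norm_torusExp_mul_le s r) G.toFam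

theorem norm_torusEval_le (s r : ℝ) (G : Wiener) : ‖torusEval s r G‖ ≤ ‖G‖ :=
  (Fam.norm_lift_le _ (norm_torusExp_mul_le s r) G).trans (one_mul _).le

theorem continuous_torusEval_right (s : ℝ) (G : Wiener) :
    Continuous fun r => torusEval s r G := by
  have : (fun r => torusEval s r G) = fun r => ∑' a, torusExp s r a * G.toFam a :=
    funext fun r => (hasSum_torusEval s r G).tsum_eq.symm
  rw [this]
  refine continuous_tsum (fun a => ?_) (Fam.summable_norm G.toFam) fun a r => ?_
  · unfold torusExp; fun_prop
  · rw [norm_mul, norm_torusExp, one_mul]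

/-- The sum `∑ₙ w n e^{ins}`. -/
def fourierSum (s : ℝ) : Fam ℤ ℂ →L[ℝ] ℂ :=
  Fam.lift (C := 1) (fun n => ContinuousLinearMap.mul ℝ ℂ (Complex.exp (Complex.I * (n * s))))
    fun n => (ContinuousLinearMap.opNorm_mul_apply_le ℝ ℂ _).trans (by
      have := norm_exp_I (n * s)
      push_cast at this
      exact this.le)

theorem hasSum_fourierSum (s : ℝ) (w : Fam ℤ ℂ) :
    HasSum (fun n : ℤ => Complex.exp (Complex.I * (n * s)) * w n) (fourierSum s w) :=
  Fam.hasSum_lift _ _ w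

theorem fourierSum_single (s : ℝ) (n : ℤ) (b : ℂ) :
    fourierSum s (Fam.single n b) = Complex.exp (Complex.I * (n * s)) * b :=
  Fam.lift_single _ _ _ _

theorem norm_fourierSum_le (s : ℝ) (w : Fam ℤ ℂ) : ‖fourierSum s w‖ ≤ ‖w‖ :=
  (Fam.norm_lift_le _ _ w).trans (one_mul _).le

/-! ### Principal values -/

/-- The kernel `1 / (e^{iα} - 1)`. -/
def hilbertKernel (α : ℝ) : ℂ := (Complex.exp (Complex.I * α) - 1)⁻¹

theorem exp_sub_one_ne_zero {α : ℝ} (h0 : 0 < |α|) (h1 : |α| ≤ Real.pi) :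
    Complex.exp (Complex.I * α) - 1 ≠ 0 := by
  intro h
  have h2 : Complex.exp (Complex.I * α) = 1 := by linear_combination h
  obtain ⟨n, hn⟩ := Complex.exp_eq_one_iff.1 h2
  have h3 : (α : ℂ) = ((n * (2 * Real.pi) : ℝ) : ℂ) := by
    have := mul_left_cancel₀ Complex.I_ne_zero
      (show Complex.I * α = Complex.I * ((n * (2 * Real.pi) : ℝ) : ℂ) by
        rw [hn]; push_cast; ring)
    exact this
  have h4 : α = n * (2 * Real.pi) := Complex.ofReal_injective h3
  have hpi := Real.pi_pos
  have hn0 : n ≠ 0 := by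
    rintro rfl
    simp [h4] at h0
  have h5 : (1 : ℝ) ≤ |(n : ℝ)| := by exact_mod_cast Int.one_le_abs hn0
  rw [h4, abs_mul, abs_of_pos (by positivity : 0 < 2 * Real.pi)] at h1
  nlinarith

/-- Since `e^{iα} - 1 = 2i e^{iα/2} sin (α/2)`, the two terms are `± e^{±i(p - 1/2)α} / (2i sin
(α/2))`. The half-angle exponentials `z` and `Z` make this a rational identity. -/
theorem pair_eq_dirichlet (p : ℤ) {α : ℝ} (h0 : 0 < α) (h1 : α ≤ Real.pi) :
    Complex.exp (Complex.I * (p * α)) * hilbertKernel α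
      + Complex.exp (Complex.I * (p * (-α : ℝ))) * hilbertKernel (-α) = dirichlet p α := by
  have hs := sin_half_pos h0 h1
  have ha := exp_sub_one_ne_zero (α := α) (by rwa [abs_of_pos h0]) (by rwa [abs_of_pos h0])
  have hb := exp_sub_one_ne_zero (α := -α) (by rwa [abs_neg, abs_of_pos h0])
    (by rwa [abs_neg, abs_of_pos h0])
  unfold hilbertKernel dirichlet
  set z := Complex.exp (Complex.I * (α / 2)) with hz
  have hz0 : z ≠ 0 := Complex.exp_ne_zero _
  have e1 : Complex.exp (Complex.I * α) = z ^ 2 := by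
    rw [hz, ← Complex.exp_nat_mul]; congr 1; push_cast; ring
  have e2 : Complex.exp (Complex.I * (-α : ℝ)) = (z ^ 2)⁻¹ := by
    rw [← e1, ← Complex.exp_neg]; congr 1; push_cast; ring
  have hsin : Complex.sin (α / 2) ≠ 0 := by
    have : Complex.sin (α / 2) = ((Real.sin (α / 2) : ℝ) : ℂ) := by push_cast; rfl
    rw [this]
    exact_mod_cast hs.ne'
  set Z := Complex.exp (Complex.I * ((p - 1 / 2) * α)) with hZ
  have hZ0 : Z ≠ 0 := Complex.exp_ne_zero _
  have e3 : Complex.exp (Complex.I * (p * α)) = Z * z := by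
    rw [hZ, hz, ← Complex.exp_add]; congr 1; ring
  have e4 : Complex.exp (Complex.I * (p * (-α : ℝ))) = Z⁻¹ * z⁻¹ := by
    rw [hZ, hz, ← Complex.exp_neg, ← Complex.exp_neg, ← Complex.exp_add]; congr 1; push_cast; ring
  have e5 : Complex.sin (α / 2) = (z⁻¹ - z) * Complex.I / 2 := by
    rw [Complex.sin, hz, ← Complex.exp_neg]; congr 4 <;> ring_nf
  have e6 : Complex.sin ((p - 1 / 2) * α) = (Z⁻¹ - Z) * Complex.I / 2 := by
    rw [Complex.sin, hZ, ← Complex.exp_neg]; congr 4 <;> ring_nf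
  rw [e1] at ha ⊢
  rw [e2] at hb ⊢
  rw [e3, e4]
  push_cast
  rw [e5] at hsin ⊢
  rw [e6]
  have h7 : z⁻¹ - z ≠ 0 := by
    intro h; rw [h] at hsin; simp at hsin
  have h8 : (z ^ 2)⁻¹ - 1 = -((z ^ 2 - 1) / z ^ 2) := by field_simp; ring
  have h9 : z⁻¹ - z = -((z ^ 2 - 1) / z) := by field_simp; ring
  rw [h8, h9]
  field_simp
  ring

theorem truncation_eq (s : ℝ) {δ : ℝ} (hδ : 0 < δ) :
    {r : ℝ | δ ≤ |r - s| ∧ |r - s| ≤ Real.pi}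
      = Icc (s + δ) (s + Real.pi) ∪ Icc (s - Real.pi) (s - δ) := by
  ext r
  simp only [mem_ofPred_eq, mem_union, mem_Icc]
  rcases le_total 0 (r - s) with h | h
  · rw [abs_of_nonneg h]
    constructor
    · rintro ⟨h1, h2⟩; left; constructor <;> linarith
    · rintro (⟨h1, h2⟩ | ⟨h1, h2⟩) <;> constructor <;> linarith
  · rw [abs_of_nonpos h]
    constructor
    · rintro ⟨h1, h2⟩; right; constructor <;> linarith
    · rintro (⟨h1, h2⟩ | ⟨h1, h2⟩) <;> constructor <;> linarith

theorem isCompact_truncation (s : ℝ) {δ : ℝ} (hδ : 0 < δ) :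
    IsCompact {r : ℝ | δ ≤ |r - s| ∧ |r - s| ≤ Real.pi} := by
  rw [truncation_eq s hδ]
  exact isCompact_Icc.union isCompact_Icc

theorem setIntegral_truncation {g : ℝ → ℂ} {s δ : ℝ} (hδ : 0 < δ) (hδ' : δ ≤ Real.pi)
    (hg : ContinuousOn g {r : ℝ | δ ≤ |r - s| ∧ |r - s| ≤ Real.pi}) :
    ∫ r in {r : ℝ | δ ≤ |r - s| ∧ |r - s| ≤ Real.pi}, g r
      = ∫ α in δ..Real.pi, (g (s + α) + g (s - α)) := by
  rw [truncation_eq s hδ] at hg ⊢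
  have c1 := hg.mono subset_union_left
  have c2 := hg.mono subset_union_right
  rw [setIntegral_union]
  · have i1 : IntervalIntegrable (fun α => g (s + α)) volume δ Real.pi := by
      refine ContinuousOn.intervalIntegrable ?_
      rw [uIcc_of_le hδ']
      refine c1.comp (by fun_prop) fun x hx => ⟨by linarith [hx.1], by linarith [hx.2]⟩
    have i2 : IntervalIntegrable (fun α => g (s - α)) volume δ Real.pi := by
      refine ContinuousOn.intervalIntegrable ?_
      rw [uIcc_of_le hδ']
      refine c2.comp (by fun_prop) fun x hx => ⟨by linarith [hx.2], by linarith [hx.1]⟩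
    rw [intervalIntegral.integral_add i1 i2, intervalIntegral.integral_comp_add_left g,
      intervalIntegral.integral_comp_sub_left g,
      intervalIntegral.integral_of_le (by linarith), intervalIntegral.integral_of_le (by linarith),
      integral_Icc_eq_integral_Ioc, integral_Icc_eq_integral_Ioc]
  · rw [Set.disjoint_left]
    rintro r ⟨h1, _⟩ ⟨_, h2⟩
    linarith
  · exact measurableSet_Icc
  · exact c1.integrableOn_Icc
  · exact c2.integrableOn_Icc

theorem continuousOn_hilbertKernel (s : ℝ) {δ : ℝ} (hδ : 0 < δ) :
    ContinuousOn (fun r => hilbertKernel (r - s)) {r : ℝ | δ ≤ |r - s| ∧ |r - s| ≤ Real.pi} := by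
  refine ContinuousOn.inv₀ (by fun_prop) fun r hr => ?_
  exact exp_sub_one_ne_zero (hδ.trans_le hr.1) hr.2

theorem integral_torusExp (s : ℝ) {δ : ℝ} (hδ : 0 < δ) (hδ' : δ ≤ Real.pi) (a : ℤ × ℤ) (b : ℂ) :
    ∫ r in {r : ℝ | δ ≤ |r - s| ∧ |r - s| ≤ Real.pi}, torusExp s r a * b * hilbertKernel (r - s)
      = Complex.exp (Complex.I * (a.1 * s)) * b * (∫ α in δ..Real.pi, dirichlet a.2 α : ℝ) := by
  have hc : Continuous fun r => torusExp s r a * b := by unfold torusExp; fun_prop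
  rw [setIntegral_truncation (g := fun r => torusExp s r a * b * hilbertKernel (r - s)) hδ hδ'
    (hc.continuousOn.mul (continuousOn_hilbertKernel s hδ)), ← intervalIntegral.integral_ofReal, ← intervalIntegral.integral_const_mul]
  refine intervalIntegral.integral_congr fun α hα => ?_
  obtain ⟨h1, h2⟩ := uIcc_subset_Ioc hδ hδ' le_rfl hα
  have e := pair_eq_dirichlet a.2 h1 h2
  simp only [← e, torusExp]
  rw [show s + α - s = α by ring, show s - α - s = -α by ring]
  rw [show (((s + α : ℝ) : ℂ) - s) = α by push_cast; ring,
    show (((s - α : ℝ) : ℂ) - s) = ((-α : ℝ) : ℂ) by push_cast; ring]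
  ring

theorem tsum_row (s : ℝ) (G : Wiener) :
    ∑' a : ℤ × ℤ, Complex.exp (Complex.I * (a.1 * s)) * G.toFam a
      * ((Real.pi * sgn a.2 : ℝ) : ℂ) = Real.pi * fourierSum s (wienerFrame.row G) := by
  have hb : ∀ a : ℤ × ℤ, ‖ContinuousLinearMap.mul ℝ ℂ
      (Complex.exp (Complex.I * (a.1 * s)) * ((Real.pi * sgn a.2 : ℝ) : ℂ))‖ ≤ Real.pi := by
    intro a
    refine (ContinuousLinearMap.opNorm_mul_apply_le ℝ ℂ _).trans ?_
    have := norm_exp_I (a.1 * s)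
    push_cast at this
    rw [norm_mul, this, one_mul, Complex.norm_real, Real.norm_eq_abs, abs_mul, abs_sgn, mul_one,
      abs_of_pos Real.pi_pos]
  have h : Conv.lift (Cocycle.trivial (ℤ × ℤ) ℂ) _ hb
      = Real.pi • (fourierSum s ∘L wienerFrame.row) := by
    refine Conv.clm_ext _ fun a b => ?_
    have := wienerFrame.row_s a.1 a.2 b
    change wienerFrame.row (Conv.single _ a b) = _ at this
    rw [Conv.lift_single, smul_apply, ContinuousLinearMap.comp_apply, this, fourierSum_single]
    simp only [ContinuousLinearMap.mul_apply', Complex.real_smul]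
    push_cast
    ring
  have h2 : Fam.lift _ hb G.toFam = Real.pi • fourierSum s (wienerFrame.row G) :=
    congrArg (fun L : Wiener →L[ℝ] ℂ => L G) h
  simp only [Fam.lift_apply, ContinuousLinearMap.mul_apply'] at h2
  refine Eq.trans (tsum_congr fun a => by ring) (h2.trans ?_)
  simp

/-- The principal value of the Hilbert transform of an element of the Wiener algebra. -/
theorem hasPrincipalValue_torusEval (s : ℝ) (G : Wiener) :
    HasPrincipalValue (fun r => torusEval s r G * hilbertKernel (r - s)) s
      (Real.pi * fourierSum s (wienerFrame.row G)) := by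
  have hcont : ∀ δ : ℝ, 0 < δ → ContinuousOn (fun r => torusEval s r G * hilbertKernel (r - s))
      {r : ℝ | δ ≤ |r - s| ∧ |r - s| ≤ Real.pi} := fun δ hδ =>
    (continuous_torusEval_right s G).continuousOn.mul (continuousOn_hilbertKernel s hδ)
  refine ⟨fun δ hδ => ContinuousOn.integrableOn_compact (isCompact_truncation s hδ.1) (hcont δ hδ.1), ?_⟩
  -- Away from `r = s` the kernel is bounded, so the absolutely convergent series may be integrated
  -- term by term.
  have key : ∀ δ ∈ Ioc 0 Real.pi,
      ∫ r in {r : ℝ | δ ≤ |r - s| ∧ |r - s| ≤ Real.pi}, torusEval s r G * hilbertKernel (r - s)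
        = ∑' a : ℤ × ℤ, Complex.exp (Complex.I * (a.1 * s)) * G.toFam a
          * ((∫ α in δ..Real.pi, dirichlet a.2 α : ℝ) : ℂ) := by
    rintro δ ⟨hδ, hδ'⟩
    have hK := isCompact_truncation s hδ
    obtain ⟨C, hC⟩ := hK.exists_bound_of_continuousOn (continuousOn_hilbertKernel s hδ)
    set A := {r : ℝ | δ ≤ |r - s| ∧ |r - s| ≤ Real.pi} with hA
    have hi : ∀ a : ℤ × ℤ, IntegrableOn
        (fun r => torusExp s r a * G.toFam a * hilbertKernel (r - s)) A := by
      intro a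
      have hc : Continuous fun r => torusExp s r a * G.toFam a := by
        unfold torusExp; fun_prop
      refine ContinuousOn.integrableOn_compact hK ?_
      exact hc.continuousOn.mul (continuousOn_hilbertKernel s hδ)
    have hs : Summable fun a : ℤ × ℤ =>
        ∫ r in A, ‖torusExp s r a * G.toFam a * hilbertKernel (r - s)‖ := by
      refine Summable.of_nonneg_of_le (fun a => integral_nonneg fun r => norm_nonneg _) (fun a => ?_)
        ((Fam.summable_norm G.toFam).mul_right (C * (volume A).toReal))
      have := norm_setIntegral_le_of_norm_le_const (μ := volume) (s := A)
        (f := fun r => ‖torusExp s r a * G.toFam a * hilbertKernel (r - s)‖)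
        (C := ‖G.toFam a‖ * C) hK.measure_lt_top fun r hr => by
          rw [norm_norm, norm_mul, norm_mul, norm_torusExp, one_mul]
          exact mul_le_mul_of_nonneg_left (hC r hr) (norm_nonneg _)
      refine (le_abs_self _).trans (this.trans (le_of_eq ?_))
      rw [Measure.real]; ring
    have e : ∫ r in A, torusEval s r G * hilbertKernel (r - s)
        = ∫ r in A, ∑' a, torusExp s r a * G.toFam a * hilbertKernel (r - s) := by
      refine integral_congr_ae (Eventually.of_forall fun r => ?_)
      simp only
      rw [tsum_mul_right, (hasSum_torusEval s r G).tsum_eq]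
    rw [e, ← (hasSum_integral_of_summable_integral_norm hi hs).tsum_eq]
    exact tsum_congr fun a => integral_torusExp s hδ hδ' a _
  rw [← tsum_row]
  have hmem : ∀ᶠ δ : ℝ in 𝓝[>] 0, δ ∈ Ioc 0 Real.pi := Ioc_mem_nhdsGT Real.pi_pos
  refine Tendsto.congr' (hmem.mono fun δ hδ => (key δ hδ).symm) ?_
  -- The truncated integrals are bounded by `6π` uniformly and tend to `π sgn p`, so the limit
  -- passes through the sum.
  refine tendsto_tsum_of_dominated_convergence
    ((Fam.summable_norm G.toFam).mul_right (6 * Real.pi)) (fun a => ?_) ?_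
  · refine tendsto_const_nhds.mul ?_
    exact (Complex.continuous_ofReal.tendsto _).comp (tendsto_integral_dirichlet a.2)
  · filter_upwards [hmem] with δ hδ a
    have := norm_exp_I (a.1 * s)
    push_cast at this
    rw [norm_mul, norm_mul, this, one_mul, Complex.norm_real]
    exact mul_le_mul_of_nonneg_left (abs_integral_dirichlet_le a.2 hδ.1 hδ.2) (norm_nonneg _)

theorem HasPrincipalValue.const_mul {g : ℝ → ℂ} {s : ℝ} {V : ℂ} (h : HasPrincipalValue g s V)
    (z : ℂ) : HasPrincipalValue (fun r => z * g r) s (z * V) :=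
  ⟨fun δ hδ => (h.1 δ hδ).const_mul z, (h.2.const_mul z).congr fun δ => by
    rw [integral_const_mul]⟩

theorem HasPrincipalValue.congr {g g' : ℝ → ℂ} {s : ℝ} {V : ℂ} (h : HasPrincipalValue g s V)
    (hg : ∀ r, 0 < |r - s| → |r - s| ≤ Real.pi → g r = g' r) : HasPrincipalValue g' s V := by
  have hm : ∀ δ : ℝ, MeasurableSet {r : ℝ | δ ≤ |r - s| ∧ |r - s| ≤ Real.pi} := fun δ => by
    have h1 : Measurable fun r : ℝ => |r - s| := by fun_prop
    exact (measurableSet_le measurable_const h1).inter (measurableSet_le h1 measurable_const)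
  refine ⟨fun δ hδ => (h.1 δ hδ).congr_fun (fun r hr => hg r (hδ.1.trans_le hr.1) hr.2) (hm δ),
    h.2.congr' ?_⟩
  filter_upwards [self_mem_nhdsWithin] with δ hδ
  exact setIntegral_congr_fun (hm δ) fun r hr => hg r (lt_of_lt_of_le hδ hr.1) hr.2

theorem HasPrincipalValue.unique {g : ℝ → ℂ} {s : ℝ} {V V' : ℂ} (h : HasPrincipalValue g s V)
    (h' : HasPrincipalValue g s V') : V = V' := tendsto_nhds_unique h.2 h'.2

/-! ### The Peskin integrand in the Wiener algebra -/

theorem hasSum_congr {ι : Type*} {f g : ι → ℂ} {A : ℂ} (h : ∀ i, f i = g i) :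
    HasSum f A ↔ HasSum g A := by rw [funext h]

/-- The coefficients `c` are those of the expansion of `τ(√w)/√w` in powers of `w - 1`. -/
structure IsExpansion (τ : ℝ → ℝ) (c : ℕ → ℝ) (K a : ℝ) : Prop where
  pos : 0 < a
  bound : ∀ n, |c n| ≤ K * a ^ n
  sum_eq : ∀ y : ℝ, a * |y| < 1 → powerSum c y = τ (Real.sqrt (1 + y)) / Real.sqrt (1 + y)
  zero_pos : 0 < c 0
  one_pos : 0 < c 0 + 2 * c 1

/-- The variables of the nonlinearity, for a perturbation `v` of the unit tangent. -/
def vars (v : Fam ℤ ℂ) (i : Fin 4) : Wiener := 1 + wienerFrame.emb i v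

/-- The expansion of the nonlinearity converges. -/
def Regular {R : Type*} [NormedCommRing R] (a : ℝ) (x : Fin 4 → R) : Prop :=
  IsUnit (x 2) ∧ IsUnit (x 3) ∧ a * ‖x 0 * x 1 - 1‖ < 1

/-- The row sums of the nonlinearity. -/
def rhs (c : ℕ → ℝ) (v : Fam ℤ ℂ) : Fam ℤ ℂ :=
  wienerFrame.row (nonlin c wienerFrame.E (vars v))

theorem torusEval_s (s r : ℝ) (n p : ℤ) (b : ℂ) :
    torusEval s r (wienerFrame.s n p b) = torusExp s r (n, p) * b := torusEval_single s r (n, p) b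

theorem torusExp_neg (s r : ℝ) (n p : ℤ) :
    torusExp s r (-n, -p) = (starRingEnd ℂ) (torusExp s r (n, p)) := by
  simp only [torusExp, map_mul, ← Complex.exp_conj, Complex.conj_I, Complex.conj_ofReal, map_intCast,
    map_sub, Int.cast_neg]
  congr 2 <;> ring

theorem torusExp_diag (s r : ℝ) (n : ℤ) :
    torusExp s r (n, n) = Complex.exp (Complex.I * (n * r)) := by
  rw [torusExp, ← Complex.exp_add]
  congr 1
  ring

/-- Evaluation as a continuous linear map. -/
def torusEvalL (s r : ℝ) : Wiener →L[ℝ] ℂ := ⟨(torusEval s r).toLinearMap, continuous_torusEval s r⟩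

theorem torusEvalL_apply (s r : ℝ) (G : Wiener) : torusEvalL s r G = torusEval s r G := rfl

theorem torusEval_vars_zero (s r : ℝ) (v : Fam ℤ ℂ) :
    torusEval s r (vars v 0) = 1 + fourierSum r v := by
  have : torusEvalL s r ∘L wienerFrame.emb 0 = fourierSum r := Fam.clm_ext fun n b => by
    rw [ContinuousLinearMap.comp_apply, Frame.emb_zero_single, torusEvalL_apply, torusEval_s,
      fourierSum_single, torusExp_diag]
  rw [vars, map_add, map_one, ← this]
  rfl

theorem torusEval_vars_one (s r : ℝ) (v : Fam ℤ ℂ) :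
    torusEval s r (vars v 1) = (starRingEnd ℂ) (torusEval s r (vars v 0)) := by
  have : torusEvalL s r ∘L wienerFrame.emb 1
      = (conjL ℂ) ∘L (torusEvalL s r ∘L wienerFrame.emb 0) := Fam.clm_ext fun n b => by
    simp only [ContinuousLinearMap.comp_apply, Frame.emb_zero_single, Frame.emb_one_single,
      torusEvalL_apply, torusEval_s, torusExp_neg, conjL_apply, star_mul']
    rfl
  have h := congrArg (fun L : Fam ℤ ℂ →L[ℝ] ℂ => L v) this
  simp only [vars, map_add, map_one]
  exact congrArg (1 + ·) h

theorem torusEval_vars_three (s r : ℝ) (v : Fam ℤ ℂ) :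
    torusEval s r (vars v 3) = (starRingEnd ℂ) (torusEval s r (vars v 2)) := by
  have : torusEvalL s r ∘L wienerFrame.emb 3
      = (conjL ℂ) ∘L (torusEvalL s r ∘L wienerFrame.emb 2) := Fam.clm_ext fun n b => by
    simp only [ContinuousLinearMap.comp_apply, Frame.emb_two_single, Frame.emb_three_single,
      map_smul, map_sum, torusEvalL_apply, torusEval_s, torusExp_neg, conjL_apply, star_mul']
    rfl
  have h := congrArg (fun L : Fam ℤ ℂ →L[ℝ] ℂ => L v) this
  simp only [vars, map_add, map_one]
  exact congrArg (1 + ·) h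

/-! ### Tangent, chord and principal value for a curve given by its Fourier series -/

theorem exp_int_mul_I (n : ℤ) (x : ℝ) :
    Complex.exp (Complex.I * (n * x)) = Complex.exp (Complex.I * x) ^ n := by
  rw [← Complex.exp_int_mul]; congr 1; ring

/-- Telescoping. For `n < 0` the sum runs from `n + 1` to `-1` and produces `1 - w^{n+1}`, whence
the sign. -/
theorem sum_freqs_zpow (n : ℤ) {w : ℂ} (hw : w ≠ 0) :
    (if 0 ≤ n then (1 : ℂ) else -1) * ((w - 1) * ∑ p ∈ freqs n, w ^ p) = w ^ (n + 1) - 1 := by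
  have tele : ∀ a b : ℤ, a ≤ b + 1 → (w - 1) * ∑ p ∈ Finset.Icc a b, w ^ p = w ^ (b + 1) - w ^ a := by
    intro a b hab
    obtain ⟨m, hm⟩ := Int.eq_ofNat_of_zero_le (show 0 ≤ b + 1 - a by omega)
    obtain rfl : b = a + m - 1 := by omega
    clear hab hm
    induction m with
    | zero => simp
    | succ m ih =>
      have : Finset.Icc a (a + (m + 1 : ℕ) - 1) = insert (a + m) (Finset.Icc a (a + m - 1)) := by
        ext x; simp only [Finset.mem_Icc, Finset.mem_insert]; push_cast; omega
      rw [this, Finset.sum_insert (by simp), mul_add, ih]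
      have e1 : a + (m : ℤ) - 1 + 1 = a + m := by ring
      have e2 : a + ((m + 1 : ℕ) : ℤ) - 1 + 1 = a + m + 1 := by push_cast; ring
      rw [e1, e2, zpow_add_one₀ hw (a + m)]
      ring
  unfold freqs
  split_ifs with h
  · rw [tele 0 n (by omega)]; simp
  · rw [tele (n + 1) (-1) (by omega)]; simp

/-- The Fourier series of a curve whose tangent is `i e^{is} (1 + v)`. -/
structure IsCurve (f : ℝ → ℂ) (v : Fam ℤ ℂ) (X : ℤ → ℂ) : Prop where
  hasSum : ∀ s : ℝ, HasSum (fun k : ℤ => X k * Complex.exp (Complex.I * (k * s))) (f s)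
  coeff : ∀ n : ℤ, ((n : ℂ) + 1) * X (n + 1) = v n + if n = 0 then 1 else 0

namespace IsCurve

variable {f : ℝ → ℂ} {v : Fam ℤ ℂ} {X : ℤ → ℂ}

theorem hasSum_add_ite {q : ℤ → ℂ} {A : ℂ} (h : HasSum (fun n => q n * v n) A) :
    HasSum (fun n => q n * (v n + if n = 0 then 1 else 0)) (q 0 + A) := by
  have h1 : HasSum (fun n : ℤ => q n * if n = 0 then 1 else 0) (q 0) := by
    have := _root_.hasSum_single (f := fun n : ℤ => q n * if n = 0 then 1 else 0) 0
      (fun n hn => by simp [hn])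
    simpa using this
  rw [add_comm]
  exact (hasSum_congr fun n => by ring).1 (h.add h1)

theorem hasSum_one_add_fourierSum (r : ℝ) (v : Fam ℤ ℂ) : HasSum (fun n : ℤ =>
    Complex.exp (Complex.I * (n * r)) * (v n + if n = 0 then 1 else 0)) (1 + fourierSum r v) := by
  simpa using hasSum_add_ite (hasSum_fourierSum r v)

theorem summable_mul_coeff (h : IsCurve f v X) : Summable fun k : ℤ => ‖(k : ℂ) * X k‖ := by
  refine (Equiv.addRight (1 : ℤ)).summable_iff.1 ?_
  have h1 : Summable fun n : ℤ => ‖(if n = 0 then 1 else 0 : ℂ)‖ :=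
    summable_of_ne_finset_zero (s := {0}) fun n hn => by simp at hn; simp [hn]
  refine Summable.of_nonneg_of_le (fun _ => norm_nonneg _) (fun n => ?_)
    ((Fam.summable_norm v).add h1)
  have := h.coeff n
  simp only [Function.comp_apply, Equiv.coe_addRight]
  push_cast
  rw [this]
  exact norm_add_le _ _

theorem hasDerivAt (h : IsCurve f v X) (r : ℝ) :
    HasDerivAt f (Complex.I * Complex.exp (Complex.I * r) * (1 + fourierSum r v)) r := by
  have hf : f = fun s : ℝ => ∑' k : ℤ, X k * Complex.exp (Complex.I * (k * s)) :=
    funext fun s => (h.hasSum s).tsum_eq.symm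
  have hd (k : ℤ) (y : ℝ) : HasDerivAt (fun s : ℝ => X k * Complex.exp (Complex.I * (k * s)))
      (Complex.I * ((k * X k) * Complex.exp (Complex.I * (k * y)))) y := by
    have h1 : HasDerivAt (fun s : ℝ => Complex.I * ((k : ℂ) * (s : ℂ))) (Complex.I * (k * 1)) y :=
      ((Complex.ofRealCLM.hasDerivAt (x := y)).const_mul (k : ℂ)).const_mul Complex.I
    refine (h1.cexp.const_mul (X k)).congr_deriv ?_
    ring
  have hn (k : ℤ) (y : ℝ) : ‖Complex.I * ((k * X k) * Complex.exp (Complex.I * (k * y)))‖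
      ≤ ‖(k : ℂ) * X k‖ := by
    have := norm_exp_I (k * y)
    push_cast at this
    rw [norm_mul, norm_mul, this, Complex.norm_I, one_mul, mul_one]
  have key := hasDerivAt_tsum h.summable_mul_coeff hd hn (h.hasSum 0).summable r
  rw [← hf] at key
  refine key.congr_deriv ?_
  rw [← (Equiv.addRight (1 : ℤ)).tsum_eq, ← (hasSum_one_add_fourierSum r v).tsum_eq,
    ← tsum_mul_left]
  refine tsum_congr fun n => ?_
  rw [← h.coeff n]
  simp only [Equiv.coe_addRight]
  push_cast
  rw [show Complex.I * (((n : ℂ) + 1) * r) = Complex.I * r + Complex.I * (n * r) by ring,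
    Complex.exp_add]
  ring

/-- The divided difference of an exponential. -/
def divExp (s r : ℝ) (n : ℤ) : ℂ :=
  ((|(n : ℝ) + 1|⁻¹ : ℝ) : ℂ) * ∑ p ∈ freqs n, torusExp s r (n, p)

theorem hasSum_divExp (s r : ℝ) (v : Fam ℤ ℂ) :
    HasSum (fun n => divExp s r n * (v n + if n = 0 then 1 else 0))
      (torusEval s r (vars v 2)) := by
  have h1 : HasSum (fun n => divExp s r n * v n) (torusEval s r (wienerFrame.emb 2 v)) := by
    have := (Fam.hasSum_single v).mapL (torusEvalL s r ∘L wienerFrame.emb 2)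
    refine (hasSum_congr fun n => ?_).1 this
    rw [ContinuousLinearMap.comp_apply, torusEvalL_apply, Frame.emb_two_single, map_smul, map_sum,
      divExp, Complex.real_smul, mul_assoc, Finset.sum_mul]
    simp only [torusEval_s]
  have h2 : divExp s r 0 = 1 := by simp [divExp, freqs, torusExp]
  have := hasSum_add_ite h1
  rw [h2] at this
  rwa [vars, map_add, map_one]

theorem mul_divExp (s r : ℝ) (n : ℤ) :
    ((n : ℂ) + 1) * ((Complex.exp (Complex.I * r) - Complex.exp (Complex.I * s)) * divExp s r n)
      = Complex.exp (Complex.I * ((n + 1 : ℤ) * r)) - Complex.exp (Complex.I * ((n + 1 : ℤ) * s))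
      := by
  set w := Complex.exp (Complex.I * ((r - s : ℝ) : ℂ)) with hw
  set z := Complex.exp (Complex.I * s) with hz
  have hz0 : z ≠ 0 := Complex.exp_ne_zero _
  have hw0 : w ≠ 0 := Complex.exp_ne_zero _
  have e1 : Complex.exp (Complex.I * r) = z * w := by
    rw [hw, hz, ← Complex.exp_add]; congr 1; push_cast; ring
  have e2 : ∀ p : ℤ, torusExp s r (n, p) = z ^ n * w ^ p := by
    intro p
    rw [torusExp, hw, hz, ← exp_int_mul_I, ← exp_int_mul_I]
    push_cast
    rfl
  have e3 := sum_freqs_zpow n hw0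
  rw [exp_int_mul_I, exp_int_mul_I, e1, divExp, mul_zpow]
  simp only [e2, ← Finset.mul_sum]
  -- The constant mode of the curve: both sides vanish, `freqs (-1)` being empty.
  rcases eq_or_ne n (-1) with rfl | hn
  · simp
  have e4 : ((n : ℂ) + 1) * ((|(n : ℝ) + 1|⁻¹ : ℝ) : ℂ) = if 0 ≤ n then (1 : ℂ) else -1 := by
    have hne : (n : ℝ) + 1 ≠ 0 := by exact_mod_cast (by omega : n + 1 ≠ 0)
    have : ((n : ℝ) + 1) * |(n : ℝ) + 1|⁻¹ = if 0 ≤ n then 1 else -1 := by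
      split_ifs with h
      · have : (0 : ℝ) ≤ n + 1 := by exact_mod_cast (by omega : 0 ≤ n + 1)
        rw [abs_of_nonneg this, mul_inv_cancel₀ hne]
      · have : (n : ℝ) + 1 ≤ 0 := by exact_mod_cast (by omega : n + 1 ≤ 0)
        rw [abs_of_nonpos this, inv_neg, mul_neg, mul_inv_cancel₀ hne]
    have h2 := congrArg (fun x : ℝ => (x : ℂ)) this
    push_cast at h2 ⊢
    rw [h2]
    split_ifs <;> simp
  calc _ = (((n : ℂ) + 1) * ((|(n : ℝ) + 1|⁻¹ : ℝ) : ℂ)) * ((w - 1) * ∑ p ∈ freqs n, w ^ p)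
        * (z * z ^ n) := by ring
    _ = _ := by
      rw [e4, e3, zpow_add_one₀ hz0]
      ring

/-- Each exponential is divided by `e^{ir} - e^{is}` separately. The added `1` in `vars v 2` is the
contribution of the unit circle itself. -/
theorem sub_eq (h : IsCurve f v X) (s r : ℝ) :
    f r - f s = (Complex.exp (Complex.I * r) - Complex.exp (Complex.I * s))
      * torusEval s r (vars v 2) := by
  have h1 := (h.hasSum r).sub (h.hasSum s)
  rw [← (Equiv.addRight (1 : ℤ)).hasSum_iff] at h1
  refine h1.unique ?_
  refine (hasSum_congr fun n => ?_).1
    ((hasSum_divExp s r v).mul_left (Complex.exp (Complex.I * r) - Complex.exp (Complex.I * s)))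
  rw [← h.coeff n]
  simp only [Function.comp_apply, Equiv.coe_addRight]
  linear_combination X (n + 1) * mul_divExp s r n

/-- Writing the real part as half the sum with the conjugate and inserting the tangent `i e^{ir} U`
and the chord `(e^{ir} - e^{is}) Q`, the integrand becomes `-(1/2) e^{is}` times the nonlinearity
times the kernel `1 / (e^{i(r-s)} - 1)`. -/
theorem hasPrincipalValue {τ : ℝ → ℝ} {c : ℕ → ℝ} {K a : ℝ} (hc : IsExpansion τ c K a)
    (h : IsCurve f v X) (hv : Regular a (vars v)) (s : ℝ) :
    HasPrincipalValue (integrand τ f s) s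
      (-(Real.pi / 2) * (Complex.exp (Complex.I * s) * fourierSum s (rhs c v))) := by
  have h1 := (hasPrincipalValue_torusEval s (nonlin c wienerFrame.E (vars v))).const_mul
    (-(1 / 2) * Complex.exp (Complex.I * s))
  have e : -(1 / 2) * Complex.exp (Complex.I * s)
      * (Real.pi * fourierSum s (wienerFrame.row (nonlin c wienerFrame.E (vars v))))
      = -(Real.pi / 2) * (Complex.exp (Complex.I * s) * fourierSum s (rhs c v)) := by
    rw [rhs]; ring
  rw [e] at h1
  refine h1.congr fun r hr0 hr1 => ?_
  obtain ⟨hq, hp, hb⟩ := hv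
  rw [map_nonlin (torusEval s r) (continuous_torusEval s r) hc.bound hc.pos.le _ hq hp hb]
  have hw1 := exp_sub_one_ne_zero hr0 hr1
  have hD : deriv f r = Complex.I * Complex.exp (Complex.I * r) * torusEval s r (vars v 0) := by
    rw [(h.hasDerivAt r).deriv, torusEval_vars_zero]
  have hQ : torusEval s r (vars v 2) ≠ 0 := (hq.map (torusEval s r)).ne_zero
  have hsub := h.sub_eq s r
  have hE : torusEval s r wienerFrame.E = Complex.exp (Complex.I * ((r - s : ℝ) : ℂ)) := by
    refine (torusEval_single s r (0, 1) 1).trans ?_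
    simp [torusExp]
  have hU1 := torusEval_vars_one s r v
  have hQ1 := torusEval_vars_three s r v
  have hnorm : ‖deriv f r‖ = ‖torusEval s r (vars v 0)‖ := by
    rw [hD, norm_mul, norm_mul, norm_exp_I, Complex.norm_I, one_mul, one_mul]
  have hpow : powerSum c (torusEval s r (vars v 0) * torusEval s r (vars v 1) - 1)
      = ((τ ‖deriv f r‖ / ‖deriv f r‖ : ℝ) : ℂ) := by
    have e1 : torusEval s r (vars v 0) * torusEval s r (vars v 1) - 1
        = ((‖torusEval s r (vars v 0)‖ ^ 2 - 1 : ℝ) : ℂ) := by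
      rw [hU1, Complex.mul_conj, Complex.normSq_eq_norm_sq]; push_cast; ring
    have e2 : a * |‖torusEval s r (vars v 0)‖ ^ 2 - 1| < 1 := by
      refine lt_of_le_of_lt (mul_le_mul_of_nonneg_left ?_ hc.pos.le) hb
      rw [← Real.norm_eq_abs, ← Complex.norm_real, ← e1, ← map_mul, ← map_one (torusEval s r),
        ← map_sub]
      exact norm_torusEval_le _ _ _
    have e3 := hc.sum_eq _ e2
    rw [add_sub_cancel, Real.sqrt_sq (norm_nonneg _), ← hnorm] at e3
    rw [← e3, e1, hnorm]
    -- The argument `|U|² - 1` is real, so the complex power series is the image of the real one,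
    -- which `IsExpansion` identifies with the tension.
    have e4 := powerSum_map (R := ℝ) (Complex.ofRealAm) Complex.continuous_ofReal hc.bound hc.pos.le
      (b := ‖torusEval s r (vars v 0)‖ ^ 2 - 1) (by rwa [Real.norm_eq_abs])
    exact e4.symm
  unfold nonlin integrand
  simp only
  rw [hpow, hE, hsub, hU1, hQ1, Ring.inverse_eq_inv', hilbertKernel]
  rw [hD]
  set U := torusEval s r (vars v 0)
  set Q := torusEval s r (vars v 2)
  set w := Complex.exp (Complex.I * ((r - s : ℝ) : ℂ)) with hw
  set z := Complex.exp (Complex.I * s) with hz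
  have hz0 : z ≠ 0 := Complex.exp_ne_zero _
  have hw0 : w ≠ 0 := Complex.exp_ne_zero _
  have e1 : Complex.exp (Complex.I * r) = z * w := by
    rw [hw, hz, ← Complex.exp_add]; congr 1; push_cast; ring
  have hzc : (starRingEnd ℂ) z = z⁻¹ := by
    rw [hz, ← Complex.exp_conj, ← Complex.exp_neg]; simp
  have hwc : (starRingEnd ℂ) w = w⁻¹ := by
    rw [hw, ← Complex.exp_conj, ← Complex.exp_neg]; simp
  have hQc : (starRingEnd ℂ) Q ≠ 0 := by simpa using hQ
  rw [e1, Complex.re_eq_add_conj]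
  have hwi : w⁻¹ - 1 ≠ 0 := by
    intro h0
    apply hw1
    have : w⁻¹ = 1 := by linear_combination h0
    rw [inv_eq_one.1 this, sub_self]
  simp only [map_div₀, map_pow, map_mul, map_sub, Complex.conj_I, hzc, hwc]
  have e2 : z⁻¹ * w⁻¹ - z⁻¹ = -(z⁻¹ * w⁻¹ * (w - 1)) := by field_simp; ring
  have e3 : z * w - z = z * (w - 1) := by ring
  rw [e2, e3]
  set T := ((τ ‖Complex.I * (z * w) * U‖ / ‖Complex.I * (z * w) * U‖ : ℝ) : ℂ)
  field_simp
  simp only [Complex.I_sq]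
  ring

end IsCurve

/-! ### The algebra of exponentially decaying families -/

/-- Bounded continuous functions of time. -/
abbrev Path := ℝ≥0 →ᵇ ℂ

/-- The function `t ↦ e^{-lt}`, for `l ≥ 0`. -/
def decay (l : ℝ) : Path :=
  BoundedContinuousFunction.ofNormedAddCommGroup
    -- Truncating the rate at zero makes this a bounded path for every real `l`.
    (fun t : ℝ≥0 => (Real.exp (-(max l 0) * t) : ℂ)) (by fun_prop) 1 fun t => by
      rw [Complex.norm_real, Real.norm_eq_abs, Real.abs_exp, Real.exp_le_one_iff]
      have : 0 ≤ max l 0 * t := by positivity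
      linarith

theorem decay_apply {l : ℝ} (hl : 0 ≤ l) (t : ℝ≥0) : decay l t = (Real.exp (-l * t) : ℂ) := by
  simp [decay, max_eq_left hl]

theorem norm_decay_le (l : ℝ) : ‖decay l‖ ≤ 1 :=
  BoundedContinuousFunction.norm_ofNormedAddCommGroup_le _ zero_le_one _

theorem decay_zero : decay 0 = 1 := by
  ext t
  simp [decay_apply le_rfl]

theorem decay_mul {l m : ℝ} (hl : 0 ≤ l) (hm : 0 ≤ m) : decay l * decay m = decay (l + m) := by
  ext t
  rw [BoundedContinuousFunction.mul_apply, decay_apply hl, decay_apply hm,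
    decay_apply (add_nonneg hl hm), ← Complex.ofReal_mul, ← Real.exp_add]
  congr 3
  ring

/-- The frequencies of the time-dependent algebra: the frequencies in the two space variables and
the degree in the decaying part. -/
abbrev Freq := ℤ × ℤ × ℕ

/-- The decay rate at a frequency. -/
def rate (μ : ℝ≥0) (a : Freq) : ℝ :=
  μ * if a.2.2 = 0 then |(a.1 : ℝ)| else max |(a.1 : ℝ)| 1

theorem rate_nonneg (μ : ℝ≥0) (a : Freq) : 0 ≤ rate μ a := by
  unfold rate; split_ifs <;> positivity

theorem rate_zero (μ : ℝ≥0) : rate μ 0 = 0 := by simp [rate]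

/-- Subadditivity keeps the defect `rate a + rate b - rate (a + b)` nonnegative, so the cocycle
built from it is a decaying exponential of norm at most one. If the sum has positive degree, then so
does one of the summands, which supplies the `1` in the maximum. -/
theorem rate_add_le (μ : ℝ≥0) (a b : Freq) : rate μ (a + b) ≤ rate μ a + rate μ b := by
  unfold rate
  rw [← mul_add]
  refine mul_le_mul_of_nonneg_left ?_ μ.2
  have h := abs_add_le (a.1 : ℝ) b.1
  have ha := abs_nonneg (a.1 : ℝ)
  have hb := abs_nonneg (b.1 : ℝ)
  have l1 := le_max_left |(a.1 : ℝ)| 1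
  have l2 := le_max_right |(a.1 : ℝ)| 1
  have l3 := le_max_left |(b.1 : ℝ)| 1
  have l4 := le_max_right |(b.1 : ℝ)| 1
  simp only [Prod.fst_add, Prod.snd_add, Int.cast_add]
  split_ifs <;> first | omega | ((try simp only [max_le_iff]); (try constructor) <;> linarith)

/-- The cocycle of the exponential weights. -/
def decayCocycle (μ : ℝ≥0) : Cocycle Freq Path where
  toFun a b := decay (rate μ a + rate μ b - rate μ (a + b))
  norm_le _ _ := norm_decay_le _
  comm a b := by rw [add_comm a b, add_comm (rate μ a)]
  zero_left a := by rw [zero_add, rate_zero, zero_add, sub_self, decay_zero]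
  assoc a b c := by
    have h1 := rate_add_le μ a b
    have h2 := rate_add_le μ (a + b) c
    have h3 := rate_add_le μ b c
    have h4 := rate_add_le μ a (b + c)
    rw [decay_mul (by linarith) (by linarith), decay_mul (by linarith) (by linarith), add_assoc a b c]
    congr 1
    ring

/-- The algebra of exponentially decaying families. -/
abbrev DecayAlg (μ : ℝ≥0) := Conv (decayCocycle μ)

/-- The weight ignores the second frequency, so multiplication by powers of `E` has trivial cocycle.
-/
theorem rate_E_add (μ : ℝ≥0) (k : ℕ) (n p : ℤ) (q : ℤ) :
    rate μ (0, q, 0) + rate μ (n, p, k) - rate μ ((0, q, 0) + (n, p, k)) = 0 := by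
  simp [rate]

theorem E_mul_single (μ : ℝ≥0) (n p q : ℤ) (k : ℕ) (b : Path) :
    Conv.single (decayCocycle μ) (0, q, 0) 1 * Conv.single _ (n, p, k) b
      = Conv.single _ (n, p + q, k) b := by
  have h : ((0, q, 0) + (n, p, k) : Freq) = (n, p + q, k) := by
    simp [add_comm]
  have h' : (decayCocycle μ).toFun (0, q, 0) (n, p, k) * 1 * b = b := by
    have : (decayCocycle μ).toFun (0, q, 0) (n, p, k) = 1 := by
      change decay _ = 1
      rw [rate_E_add, decay_zero]
    rw [this, one_mul, one_mul]
  rw [Conv.single_mul_single, h, h']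

/-- The coefficient of the row sums: only the terms of positive degree are kept. -/
def rowCoeff (a : Freq) : ℝ := if a.2.2 = 0 then 0 else sgn a.2.1

theorem abs_rowCoeff_le (a : Freq) : |rowCoeff a| ≤ 1 := by
  unfold rowCoeff; split_ifs
  · simp
  · exact (abs_sgn _).le

theorem norm_rowCoeff_smul_le (a : Freq) :
    ‖rowCoeff a • (Fam.single a.1 : Path →L[ℝ] Fam ℤ Path)‖ ≤ 1 :=
  ContinuousLinearMap.opNorm_le_bound _ zero_le_one fun b => by
    rw [smul_apply, norm_smul, Fam.norm_single, Real.norm_eq_abs]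
    exact mul_le_mul_of_nonneg_right (abs_rowCoeff_le a) (norm_nonneg _)

/-- The frame of the time-dependent algebra. -/
def decayFrame (μ : ℝ≥0) : Frame (DecayAlg μ) Path where
  s n p := Conv.single _ (n, p, 1)
  E := Conv.single _ (0, 1, 0) 1
  row := Conv.lift _ (fun a => rowCoeff a • Fam.single a.1) norm_rowCoeff_smul_le
  norm_s n p := ContinuousLinearMap.opNorm_le_bound _ zero_le_one fun b => by
    simp [Conv.norm_single]
  E_mul n p b := E_mul_single μ n p 1 1 b
  row_s n p b := by
    rw [Conv.lift_single, map_smul]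
    rfl
  norm_row := ContinuousLinearMap.opNorm_le_bound _ zero_le_one fun f =>
    Fam.norm_lift_le _ _ f

theorem decayFrame_row_single (μ : ℝ≥0) (a : Freq) (b : Path) :
    (decayFrame μ).row (Conv.single _ a b) = rowCoeff a • Fam.single a.1 b :=
  Conv.lift_single _ _ norm_rowCoeff_smul_le _ _

/-- Evaluation of a path with an exponential weight. -/
def evalPath (l : ℝ) (t : ℝ≥0) : Path →L[ℝ] ℂ :=
  Real.exp (-(max l 0) * t) • BoundedContinuousFunction.evalCLM ℝ t

theorem evalPath_apply {l : ℝ} (hl : 0 ≤ l) (t : ℝ≥0) (b : Path) :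
    evalPath l t b = (Real.exp (-l * t) : ℂ) * b t := by
  simp [evalPath, max_eq_left hl]

theorem norm_evalPath_le (l : ℝ) (t : ℝ≥0) : ‖evalPath l t‖ ≤ 1 := by
  refine ContinuousLinearMap.opNorm_le_bound _ zero_le_one fun b => ?_
  have h : 0 ≤ max l 0 * t := by positivity
  rw [evalPath, smul_apply, norm_smul, Real.norm_eq_abs, Real.abs_exp]
  refine mul_le_mul ?_ (b.norm_coe_le_norm t) (norm_nonneg _) zero_le_one
  rw [Real.exp_le_one_iff]
  linarith

/-- The cocycle factor is exactly what makes the weighted evaluation multiplicative. -/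
theorem evalPath_decay_mul {l m r : ℝ} (hl : 0 ≤ l) (hm : 0 ≤ m) (hr : 0 ≤ r) (hlm : r ≤ l + m)
    (t : ℝ≥0) (b b' : Path) :
    evalPath r t (decay (l + m - r) * b * b') = evalPath l t b * evalPath m t b' := by
  rw [evalPath_apply hl, evalPath_apply hm, evalPath_apply hr, BoundedContinuousFunction.mul_apply,
    BoundedContinuousFunction.mul_apply, decay_apply (by linarith)]
  have : (Real.exp (-r * t) : ℂ) * Real.exp (-(l + m - r) * t)
      = Real.exp (-l * t) * Real.exp (-m * t) := by
    rw [← Complex.ofReal_mul, ← Complex.ofReal_mul, ← Real.exp_add, ← Real.exp_add]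
    congr 2
    ring
  linear_combination b t * b' t * this

theorem norm_single_comp_le {θ : Path →L[ℝ] ℂ} (h : ‖θ‖ ≤ 1) (a : ℤ × ℤ) :
    ‖(Conv.single (Cocycle.trivial (ℤ × ℤ) ℂ) a).comp θ‖ ≤ 1 := by
  refine ContinuousLinearMap.opNorm_le_bound _ zero_le_one fun b => ?_
  rw [ContinuousLinearMap.comp_apply, Conv.norm_single]
  exact θ.le_of_opNorm_le h b

theorem trivial_single_mul (a a' : ℤ × ℤ) (x y : ℂ) :
    Conv.single (Cocycle.trivial (ℤ × ℤ) ℂ) a x * Conv.single _ a' y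
      = Conv.single _ (a + a') (x * y) := by
  have h : (Cocycle.trivial (ℤ × ℤ) ℂ).toFun a a' * x * y = x * y := by
    change 1 * x * y = _
    rw [one_mul]
  rw [Conv.single_mul_single, h]

/-- Evaluation at a time. -/
def timeEval (μ : ℝ≥0) (t : ℝ≥0) : DecayAlg μ →ₐ[ℝ] Wiener :=
  Conv.hom _ (C := 1) (fun a => (Conv.single _ (a.1, a.2.1)).comp (evalPath (rate μ a) t))
    (fun a => norm_single_comp_le (norm_evalPath_le _ _) _)
    (by
      have : evalPath (rate μ 0) t (1 : Path) = 1 := by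
        rw [rate_zero, evalPath_apply le_rfl]; simp
      rw [ContinuousLinearMap.comp_apply, this]
      rfl)
    (fun a a' b b' => by
      simp only [ContinuousLinearMap.comp_apply, trivial_single_mul]
      change Conv.single _ _ (evalPath _ t (decay _ * b * b')) = _
      rw [evalPath_decay_mul (rate_nonneg _ _) (rate_nonneg _ _) (rate_nonneg _ _)
        (rate_add_le _ _ _)]
      rfl)

theorem timeEval_single (μ : ℝ≥0) (t : ℝ≥0) (a : Freq) (b : Path) :
    timeEval μ t (Conv.single _ a b) = Conv.single _ (a.1, a.2.1) (evalPath (rate μ a) t b) :=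
  Conv.lift_single _ _ _ _ _

theorem continuous_timeEval (μ : ℝ≥0) (t : ℝ≥0) : Continuous (timeEval μ t) :=
  Conv.continuous_hom _ _ _ _ _

/-- Evaluation of the part of degree zero at a time. -/
def timeEvalZero (μ : ℝ≥0) (t : ℝ≥0) : DecayAlg μ →ₐ[ℝ] Wiener :=
  Conv.hom _ (C := 1)
    (fun a => if a.2.2 = 0 then (Conv.single _ (a.1, a.2.1)).comp (evalPath (rate μ a) t) else 0)
    (fun a => by
      split_ifs
      · exact norm_single_comp_le (norm_evalPath_le _ _) _
      · simp)
    (by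
      have : evalPath (rate μ 0) t (1 : Path) = 1 := by
        rw [rate_zero, evalPath_apply le_rfl]; simp
      rw [if_pos (by rfl), ContinuousLinearMap.comp_apply, this]
      rfl)
    (fun a a' b b' => by
      by_cases h : a.2.2 = 0 <;> by_cases h' : a'.2.2 = 0
      · rw [if_pos h, if_pos h', if_pos (by simp [h, h'])]
        simp only [ContinuousLinearMap.comp_apply, trivial_single_mul]
        change Conv.single _ _ (evalPath _ t (decay _ * b * b')) = _
        rw [evalPath_decay_mul (rate_nonneg _ _) (rate_nonneg _ _) (rate_nonneg _ _)
          (rate_add_le _ _ _)]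
        rfl
      all_goals
        have h2 : (a + a').2.2 ≠ 0 := by
          simp only [Prod.snd_add]; omega
        rw [if_neg h2]
        simp [h, h'])

theorem timeEvalZero_single (μ : ℝ≥0) (t : ℝ≥0) (a : Freq) (b : Path) :
    timeEvalZero μ t (Conv.single _ a b)
      = if a.2.2 = 0 then Conv.single _ (a.1, a.2.1) (evalPath (rate μ a) t b) else 0 := by
  refine (Conv.lift_single _ _ _ _ _).trans ?_
  split_ifs <;> rfl

theorem continuous_timeEvalZero (μ : ℝ≥0) (t : ℝ≥0) : Continuous (timeEvalZero μ t) :=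
  Conv.continuous_hom _ _ _ _ _

/-- The decay rate of the `n`-th mode. -/
def modeRate (μ : ℝ≥0) (n : ℤ) : ℝ := μ * max |(n : ℝ)| 1

theorem modeRate_nonneg (μ : ℝ≥0) (n : ℤ) : 0 ≤ modeRate μ n := by unfold modeRate; positivity

/-- Evaluation of a decaying family at a time. -/
def famEval (μ : ℝ≥0) (t : ℝ≥0) : Fam ℤ Path →L[ℝ] Fam ℤ ℂ :=
  Fam.lift (C := 1) (fun n => (Fam.single n).comp (evalPath (modeRate μ n) t)) fun n =>
    ContinuousLinearMap.opNorm_le_bound _ zero_le_one fun b => by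
      rw [ContinuousLinearMap.comp_apply, Fam.norm_single]
      exact ContinuousLinearMap.le_of_opNorm_le _ (norm_evalPath_le _ _) b

theorem famEval_single (μ : ℝ≥0) (t : ℝ≥0) (n : ℤ) (b : Path) :
    famEval μ t (Fam.single n b) = Fam.single n (evalPath (modeRate μ n) t b) :=
  Fam.lift_single _ _ _ _

theorem Fam.clm_eq {ι B F : Type*} [NormedAddCommGroup B] [NormedSpace ℝ B] [NormedAddCommGroup F]
    [NormedSpace ℝ F] {φ ψ : Fam ι B →L[ℝ] F} (h : φ = ψ) (f : Fam ι B) : φ f = ψ f := by rw [h]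

/-- Evaluation of one entry. -/
def Fam.coord {ι B : Type*} [NormedAddCommGroup B] [NormedSpace ℝ B] (i : ι) : Fam ι B →L[ℝ] B :=
  LinearMap.mkContinuous
    { toFun := fun f => f i
      map_add' := fun _ _ => rfl
      map_smul' := fun _ _ => rfl } 1 fun f => (Fam.norm_apply_le f i).trans (one_mul _).ge

theorem famEval_apply (μ : ℝ≥0) (t : ℝ≥0) (g : Fam ℤ Path) (n : ℤ) :
    famEval μ t g n = (Real.exp (-modeRate μ n * t) : ℂ) * g n t := by
  rw [← evalPath_apply (modeRate_nonneg μ n)]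
  have : Fam.coord n ∘L famEval μ t = evalPath (modeRate μ n) t ∘L Fam.coord n := by
    refine Fam.clm_ext fun k b => ?_
    simp only [ContinuousLinearMap.comp_apply, famEval_single]
    change (Fam.single k (evalPath (modeRate μ k) t b) : Fam ℤ ℂ) n
      = evalPath (modeRate μ n) t ((Fam.single k b : Fam ℤ Path) n)
    rw [Fam.single_apply, Fam.single_apply]
    split_ifs with h
    · rw [h]
    · rw [map_zero]
  exact Fam.clm_eq this g

theorem norm_famEval_le (μ : ℝ≥0) (t : ℝ≥0) (g : Fam ℤ Path) : ‖famEval μ t g‖ ≤ ‖g‖ :=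
  (Fam.norm_lift_le _ _ g).trans (one_mul _).le

/-- Terms of positive degree carry the weight `modeRate` of a decaying family, which is how
`famEval` reads them. Terms of degree zero need not decay at `n = 0`; they are dropped from the row
sums of `decayFrame` and accounted for by `timeEvalZero`. -/
theorem row_timeEval (μ : ℝ≥0) (t : ℝ≥0) (G : DecayAlg μ) :
    wienerFrame.row (timeEval μ t G)
      = famEval μ t ((decayFrame μ).row G) + wienerFrame.row (timeEvalZero μ t G) := by
  let e : DecayAlg μ →L[ℝ] Wiener := ⟨(timeEval μ t).toLinearMap, continuous_timeEval μ t⟩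
  let e0 : DecayAlg μ →L[ℝ] Wiener := ⟨(timeEvalZero μ t).toLinearMap, continuous_timeEvalZero μ t⟩
  have : wienerFrame.row ∘L e = famEval μ t ∘L (decayFrame μ).row + wienerFrame.row ∘L e0 := by
    refine Conv.clm_ext _ fun a b => ?_
    change wienerFrame.row (timeEval μ t (Conv.single _ a b)) =
      famEval μ t ((decayFrame μ).row (Conv.single _ a b))
        + wienerFrame.row (timeEvalZero μ t (Conv.single _ a b))
    rw [timeEval_single, timeEvalZero_single, decayFrame_row_single, map_smul, famEval_single]
    have hr := wienerFrame.row_s a.1 a.2.1 (evalPath (rate μ a) t b)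
    change wienerFrame.row (Conv.single _ (a.1, a.2.1) _) = _ at hr
    split_ifs with h
    · rw [hr, rowCoeff, if_pos h, zero_smul, zero_add]
    · rw [hr, map_zero, add_zero, rowCoeff, if_neg h, map_smul, rate, if_neg h]
      rfl
  exact congrArg (fun L : DecayAlg μ →L[ℝ] Fam ℤ ℂ => L G) this

/-! ### The nonlinear remainder -/

/-- Constant paths. -/
def constPath : ℂ →L[ℝ] Path :=
  LinearMap.mkContinuous
    { toFun := fun z => BoundedContinuousFunction.const _ z
      map_add' := fun _ _ => rfl
      map_smul' := fun _ _ => rfl } 1 fun z => by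
    exact (BoundedContinuousFunction.norm_const_le z).trans (one_mul _).ge

theorem constPath_apply (z : ℂ) (t : ℝ≥0) : constPath z t = z := rfl

theorem norm_constPath_le (z : ℂ) : ‖constPath z‖ ≤ ‖z‖ :=
  BoundedContinuousFunction.norm_const_le z

/-- The identity for even indices, and conjugation for odd ones. -/
def conjIf : Fin 4 → ℂ →L[ℝ] ℂ :=
  ![ContinuousLinearMap.id ℝ ℂ, conjL ℂ, ContinuousLinearMap.id ℝ ℂ, conjL ℂ]

theorem norm_conjIf (i : Fin 4) (z : ℂ) : ‖conjIf i z‖ = ‖z‖ := by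
  fin_cases i <;> simp [conjIf]

/-- A complex number, and a decaying family. -/
abbrev State := ℂ × Fam ℤ Path

/-- The linear part of the variables of the nonlinearity. -/
def stateVar (μ : ℝ≥0) (i : Fin 4) (z : State) : DecayAlg μ :=
  Conv.single _ 0 (constPath (conjIf i z.1)) + (decayFrame μ).emb i z.2

theorem stateVar_sub (μ : ℝ≥0) (i : Fin 4) (z w : State) :
    stateVar μ i (z - w) = stateVar μ i z - stateVar μ i w := by
  simp only [stateVar, Prod.fst_sub, Prod.snd_sub, map_sub]
  abel

theorem norm_stateVar_le (μ : ℝ≥0) (i : Fin 4) (z : State) : ‖stateVar μ i z‖ ≤ 2 * ‖z‖ := by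
  have h1 : ‖Conv.single (decayCocycle μ) 0 (constPath (conjIf i z.1))‖ ≤ ‖z‖ := by
    rw [Conv.norm_single]
    exact (norm_constPath_le _).trans ((norm_conjIf i z.1).le.trans (norm_fst_le z))
  have h2 : ‖(decayFrame μ).emb i z.2‖ ≤ ‖z‖ := (Frame.norm_emb_le _ i z.2).trans (norm_snd_le z)
  exact (norm_add_le _ _).trans (by linarith)

/-- The variables of the nonlinearity. -/
def stateVars (μ : ℝ≥0) (z : State) (i : Fin 4) : DecayAlg μ := 1 + stateVar μ i z

/-- The row sums of the nonlinearity minus their linear part. -/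
def remainder (c : ℕ → ℝ) (μ : ℝ≥0) (z : State) : Fam ℤ Path :=
  (decayFrame μ).row (nonlin c (decayFrame μ).E (stateVars μ z)) - (decayFrame μ).linRow c z.2

theorem row_single_zero (μ : ℝ≥0) (n p : ℤ) (b : Path) :
    (decayFrame μ).row (Conv.single _ (n, p, 0) b) = 0 := by
  rw [decayFrame_row_single, rowCoeff, if_pos rfl, zero_smul]

theorem E_sq_mul_single (μ : ℝ≥0) (n p : ℤ) (k : ℕ) (b : Path) :
    (decayFrame μ).E ^ 2 * Conv.single _ (n, p, k) b = Conv.single _ (n, p + 2, k) b := by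
  rw [pow_two, mul_assoc]
  change Conv.single _ (0, 1, 0) 1 * (Conv.single _ (0, 1, 0) 1 * _) = _
  rw [E_mul_single, E_mul_single, add_assoc]
  rfl

theorem neg_smul_one_mul {R : Type*} [NormedCommRing R] [NormedAlgebra ℝ R] (r : ℝ) (x : R) :
    -(r • (1 : R)) * x = (-r) • x := by
  rw [neg_mul, smul_mul_assoc, one_mul, neg_smul]

/-- The product has degree zero and is discarded by the row sums. Hence the constant component of a
state does not enter the linear part. -/
theorem row_nonlinCoeff_mul_single (c : ℕ → ℝ) (μ : ℝ≥0) (i : Fin 4) (b : Path) :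
    (decayFrame μ).row (nonlinCoeff c (decayFrame μ).E i * Conv.single _ 0 b) = 0 := by
  have h0 : (decayFrame μ).row (Conv.single _ 0 b) = 0 := row_single_zero μ 0 0 b
  have h2 : (decayFrame μ).row ((decayFrame μ).E ^ 2 * Conv.single _ 0 b) = 0 := by
    change (decayFrame μ).row ((decayFrame μ).E ^ 2 * Conv.single _ (0, 0, 0) b) = 0
    rw [E_sq_mul_single, row_single_zero]
  have h1 : ∀ r : ℝ, (decayFrame μ).row (-(r • 1) * Conv.single _ 0 b) = 0 := fun r => by
    refine (congrArg _ (neg_smul_one_mul r _)).trans ?_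
    rw [map_smul, h0, smul_zero]
  fin_cases i <;>
    simp only [nonlinCoeff, add_mul, sub_mul, smul_mul_assoc, one_mul, map_add, map_sub,
      map_smul, h0, h2, smul_zero, add_zero, sub_zero, Fin.zero_eta,
      Fin.mk_one, Fin.reduceFinMk, Matrix.cons_val_zero, Matrix.cons_val_one, Matrix.cons_val]
  exact h1 _

theorem remainder_zero (c : ℕ → ℝ) (μ : ℝ≥0) : remainder c μ 0 = 0 := by
  have h1 : stateVars μ 0 = 1 := by
    funext i
    have := norm_stateVar_le μ i 0
    rw [norm_zero, mul_zero] at this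
    rw [stateVars, norm_le_zero_iff.1 this, add_zero]
    rfl
  have h2 : nonlin c (decayFrame μ).E (1 : Fin 4 → DecayAlg μ)
      = c 0 • ((decayFrame μ).E ^ 2 * Conv.single _ (0, 0, 0) 1)
        + c 0 • Conv.single _ (0, 0, 0) 1 := by
    change _ = c 0 • ((decayFrame μ).E ^ 2 * 1) + c 0 • 1
    simp only [nonlin, Pi.one_apply, one_pow, mul_one, Ring.inverse_one, sub_self, powerSum_zero,
      mul_smul_comm, smul_add]
  rw [remainder, h1, h2, E_sq_mul_single, map_add, map_smul, map_smul, row_single_zero,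
    row_single_zero]
  simp

theorem linRow_eq_sum (c : ℕ → ℝ) (μ : ℝ≥0) (z : State) :
    (decayFrame μ).linRow c z.2
      = (decayFrame μ).row (∑ i, nonlinCoeff c (decayFrame μ).E i * stateVar μ i z) := by
  rw [Frame.linRow_apply, map_sum, map_sum]
  refine Finset.sum_congr rfl fun i _ => ?_
  rw [stateVar, mul_add, map_add, row_nonlinCoeff_mul_single, zero_add]

/-- Subtracting the linear part replaces the coefficients `A i` of the divided differences by `A i -
nonlinCoeff i`, which are small near the base point. -/
theorem norm_remainder_sub_le {τ : ℝ → ℝ} {c : ℕ → ℝ} {K a : ℝ} (hc : IsExpansion τ c K a)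
    (μ : ℝ≥0) {η : ℝ} (hη : 0 < η) : ∃ δ > 0, ∀ z w : State, ‖z‖ ≤ δ → ‖w‖ ≤ δ →
      ‖remainder c μ z - remainder c μ w‖ ≤ η * ‖z - w‖ := by
  -- There are four variables, each of norm at most `2 ‖z - w‖`, and `4 · (η / 8) · 2 = η`.
  obtain ⟨δ, hδ, h⟩ := (hasDivDiff_nonlin hc.bound hc.pos (decayFrame μ).E).exists_delta
    (show 0 < η / 8 by positivity)
  refine ⟨δ / 2, by positivity, fun z w hz hw => ?_⟩
  have hb : ∀ z : State, ‖z‖ ≤ δ / 2 → ∀ i, ‖stateVars μ z i - 1‖ ≤ δ := by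
    intro z hz i
    rw [stateVars, add_sub_cancel_left]
    exact (norm_stateVar_le μ i z).trans (by linarith)
  obtain ⟨A, hA, hF⟩ := h (stateVars μ z) (stateVars μ w) (hb z hz) (hb w hw)
  have e : remainder c μ z - remainder c μ w = (decayFrame μ).row
      (∑ i, (A i - nonlinCoeff c (decayFrame μ).E i) * stateVar μ i (z - w)) := by
    have h1 : remainder c μ z - remainder c μ w = (decayFrame μ).row
        (nonlin c (decayFrame μ).E (stateVars μ z) - nonlin c (decayFrame μ).E (stateVars μ w))
        - (decayFrame μ).linRow c (z - w).2 := by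
      rw [remainder, remainder, Prod.snd_sub, map_sub, map_sub]
      abel
    rw [h1, linRow_eq_sum, ← map_sub, hF, ← Finset.sum_sub_distrib]
    congr 1
    refine Finset.sum_congr rfl fun i _ => ?_
    rw [stateVars, stateVars, add_sub_add_left_eq_sub, ← stateVar_sub, sub_mul]
  rw [e]
  refine (ContinuousLinearMap.le_of_opNorm_le _ (decayFrame μ).norm_row _).trans ?_
  rw [one_mul]
  refine (norm_sum_le _ _).trans ?_
  refine (Finset.sum_le_card_nsmul _ _ (η / 8 * (2 * ‖z - w‖)) fun i _ => ?_).trans ?_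
  · refine (norm_mul_le _ _).trans ?_
    exact mul_le_mul (hA i) (norm_stateVar_le μ i _) (norm_nonneg _) (by positivity)
  · simp only [Finset.card_univ, Fintype.card_fin, nsmul_eq_mul]
    push_cast
    linarith

/-! ### Evaluation at a time -/

theorem evalPath_star (l : ℝ) (t : ℝ≥0) (b : Path) :
    evalPath l t (star b) = star (evalPath l t b) := by
  rw [evalPath, smul_apply, smul_apply, star_smul (Real.exp _) (BoundedContinuousFunction.evalCLM ℝ t b),
    star_trivial (Real.exp _)]
  rfl

theorem rate_one (μ : ℝ≥0) (n p : ℤ) : rate μ (n, p, 1) = modeRate μ n := by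
  simp [rate, modeRate]

theorem modeRate_neg (μ : ℝ≥0) (n : ℤ) : modeRate μ (-n) = modeRate μ n := by
  simp [modeRate]

theorem timeEval_s (μ : ℝ≥0) (t : ℝ≥0) (n p : ℤ) (b : Path) :
    timeEval μ t ((decayFrame μ).s n p b) = wienerFrame.s n p (evalPath (modeRate μ n) t b) := by
  refine (timeEval_single μ t (n, p, 1) b).trans ?_
  rw [rate_one]
  rfl

theorem timeEval_emb (μ : ℝ≥0) (t : ℝ≥0) (i : Fin 4) (g : Fam ℤ Path) :
    timeEval μ t ((decayFrame μ).emb i g) = wienerFrame.emb i (famEval μ t g) := by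
  let e : DecayAlg μ →L[ℝ] Wiener := ⟨(timeEval μ t).toLinearMap, continuous_timeEval μ t⟩
  have he : ∀ x, e x = timeEval μ t x := fun _ => rfl
  have : e ∘L (decayFrame μ).emb i = wienerFrame.emb i ∘L famEval μ t := by
    refine Fam.clm_ext fun n b => ?_
    simp only [ContinuousLinearMap.comp_apply, famEval_single]
    fin_cases i
    · simp only [Fin.zero_eta, Frame.emb_zero_single, he, timeEval_s]
    · simp only [Fin.mk_one, Frame.emb_one_single, he, timeEval_s, modeRate_neg, evalPath_star]
    · simp only [Fin.reduceFinMk, Frame.emb_two_single, map_smul, map_sum, he, timeEval_s]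
    · simp only [Fin.reduceFinMk, Frame.emb_three_single, map_smul, map_sum, he, timeEval_s,
        modeRate_neg, evalPath_star]
  exact Fam.clm_eq this g

theorem wienerFrame_emb_zero (i : Fin 4) (z : ℂ) :
    wienerFrame.emb i (Fam.single 0 z) = Conv.single _ 0 (conjIf i z) := by
  fin_cases i
  · exact Frame.emb_zero_single _ _ _
  · exact Frame.emb_one_single _ _ _
  · simp only [Fin.reduceFinMk, Frame.emb_two_single, freqs]
    simp only [Int.cast_zero, zero_add, abs_one, inv_one, one_smul, le_refl, if_true,
      Finset.Icc_self, Finset.sum_singleton]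
    rfl
  · simp only [Fin.reduceFinMk, Frame.emb_three_single, freqs]
    simp only [Int.cast_zero, zero_add, abs_one, inv_one, one_smul, le_refl, if_true,
      Finset.Icc_self, Finset.sum_singleton]
    rfl

theorem timeEval_const (μ : ℝ≥0) (t : ℝ≥0) (z : ℂ) :
    timeEval μ t (Conv.single _ 0 (constPath z)) = Conv.single _ 0 z := by
  have h : evalPath (rate μ 0) t (constPath z) = z := by
    rw [rate_zero, evalPath_apply le_rfl, constPath_apply]
    simp
  rw [timeEval_single, h]
  rfl

theorem timeEvalZero_const (μ : ℝ≥0) (t : ℝ≥0) (z : ℂ) :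
    timeEvalZero μ t (Conv.single _ 0 (constPath z)) = Conv.single _ 0 z := by
  have h : evalPath (rate μ 0) t (constPath z) = z := by
    rw [rate_zero, evalPath_apply le_rfl, constPath_apply]
    simp
  rw [timeEvalZero_single, if_pos (show (0 : Freq).2.2 = 0 from rfl), h]
  rfl

theorem timeEvalZero_emb (μ : ℝ≥0) (t : ℝ≥0) (i : Fin 4) (g : Fam ℤ Path) :
    timeEvalZero μ t ((decayFrame μ).emb i g) = 0 := by
  let e : DecayAlg μ →L[ℝ] Wiener := ⟨(timeEvalZero μ t).toLinearMap, continuous_timeEvalZero μ t⟩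
  have he : ∀ n p b, e ((decayFrame μ).s n p b) = 0 := fun n p b =>
    (timeEvalZero_single μ t (n, p, 1) b).trans (if_neg one_ne_zero)
  have : e ∘L (decayFrame μ).emb i = 0 := by
    refine Fam.clm_ext fun n b => ?_
    simp only [ContinuousLinearMap.comp_apply, zero_apply]
    fin_cases i
    · simp only [Fin.zero_eta, Frame.emb_zero_single, he]
    · simp only [Fin.mk_one, Frame.emb_one_single, he]
    · simp only [Fin.reduceFinMk, Frame.emb_two_single, map_smul, map_sum, he,
        Finset.sum_const_zero, smul_zero]
    · simp only [Fin.reduceFinMk, Frame.emb_three_single, map_smul, map_sum, he,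
        Finset.sum_const_zero, smul_zero]
  exact Fam.clm_eq this g

/-- The perturbation of the tangent at a time. -/
def stateEval (μ : ℝ≥0) (t : ℝ≥0) (z : State) : Fam ℤ ℂ := Fam.single 0 z.1 + famEval μ t z.2

theorem norm_stateEval_le (μ : ℝ≥0) (t : ℝ≥0) (z : State) : ‖stateEval μ t z‖ ≤ 2 * ‖z‖ := by
  have h1 : ‖(Fam.single 0 z.1 : Fam ℤ ℂ)‖ ≤ ‖z‖ := (Fam.norm_single _ _).le.trans (norm_fst_le z)
  have h2 := (norm_famEval_le μ t z.2).trans (norm_snd_le z)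
  exact (norm_add_le _ _).trans (by linarith)

theorem timeEval_stateVars (μ : ℝ≥0) (t : ℝ≥0) (z : State) (i : Fin 4) :
    timeEval μ t (stateVars μ z i) = vars (stateEval μ t z) i := by
  rw [stateVars, stateVar, map_add, map_one, map_add, timeEval_const, timeEval_emb, vars, stateEval,
    map_add, wienerFrame_emb_zero]

theorem timeEvalZero_stateVars (μ : ℝ≥0) (t : ℝ≥0) (z : State) (i : Fin 4) :
    timeEvalZero μ t (stateVars μ z i) = vars (Fam.single 0 z.1) i := by
  rw [stateVars, stateVar, map_add, map_one, map_add, timeEvalZero_const, timeEvalZero_emb, vars,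
    wienerFrame_emb_zero, add_zero]

theorem norm_vars_sub_one_le (v : Fam ℤ ℂ) (i : Fin 4) : ‖vars v i - 1‖ ≤ ‖v‖ := by
  rw [vars, add_sub_cancel_left]
  exact Frame.norm_emb_le _ i v

/-- The inclusion of the constants in the Wiener algebra. -/
def wienerConst : ℂ →ₐ[ℝ] Wiener :=
  AlgHom.ofLinearMap (Conv.single (Cocycle.trivial (ℤ × ℤ) ℂ) 0).toLinearMap rfl fun x y => by
    change Conv.single _ 0 (x * y) = Conv.single _ 0 x * Conv.single _ 0 y
    rw [trivial_single_mul, add_zero]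

theorem wienerConst_apply (z : ℂ) : wienerConst z = Conv.single _ 0 z := rfl

theorem isUnit_of_isUnit_wienerConst {z : ℂ} (h : IsUnit (wienerConst z)) : IsUnit z := by
  rw [isUnit_iff_ne_zero]
  rintro rfl
  have : Nontrivial Wiener := NormOneClass.nontrivial
  rw [map_zero] at h
  exact h.ne_zero rfl

/-- Circles are stationary. -/
theorem rhs_single_zero {τ : ℝ → ℝ} {c : ℕ → ℝ} {K a : ℝ} (hc : IsExpansion τ c K a) {z : ℂ}
    (h : Regular a (vars (Fam.single 0 z))) : rhs c (Fam.single 0 z) = 0 := by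
  set y := 1 + z with hy
  have hv : ∀ i, vars (Fam.single 0 z) i = wienerConst (conjIf i y) := by
    intro i
    have h1 : conjIf i 1 = 1 := by fin_cases i <;> simp [conjIf]
    rw [vars, wienerFrame_emb_zero, hy, map_add, map_add, h1, map_one]
    rfl
  obtain ⟨h2, h3, h01⟩ := h
  rw [hv] at h2 h3
  rw [hv, hv] at h01
  have y2 := isUnit_of_isUnit_wienerConst h2
  have y3 := isUnit_of_isUnit_wienerConst h3
  have e2 := (map_ringInverse (wienerConst : ℂ →+* Wiener) y2).symm
  have e3 := (map_ringInverse (wienerConst : ℂ →+* Wiener) y3).symm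
  simp only [AlgHom.coe_toRingHom] at e2 e3
  have e4 : powerSum c (wienerConst (conjIf 0 y) * wienerConst (conjIf 1 y) - 1)
      = wienerConst (powerSum c (conjIf 0 y * conjIf 1 y - 1)) := by
    rw [powerSum_map wienerConst (Conv.single _ 0).continuous hc.bound hc.pos.le, map_sub, map_mul,
      map_one]
    rw [← map_mul, ← map_one wienerConst, ← map_sub, wienerConst_apply, Conv.norm_single] at h01
    exact h01
  have y2' : y ≠ 0 := y2.ne_zero
  have y3' : (starRingEnd ℂ) y ≠ 0 := y3.ne_zero
  set S := powerSum c (conjIf 0 y * conjIf 1 y - 1)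
  -- For a constant tangent perturbation `U = Q = y`, and both terms of the nonlinearity reduce to
  -- `y S`, one of them multiplied by `E²`.
  have e5 : nonlin c wienerFrame.E (vars (Fam.single 0 z))
      = wienerFrame.E ^ 2 * wienerConst (y * S) + wienerConst (y * S) := by
    simp only [nonlin, hv, e2, e3, e4]
    have a1 : wienerConst (y * S) = wienerConst (conjIf 0 y ^ 2 * Ring.inverse (conjIf 2 y) * S) := by
      congr 1
      simp only [conjIf, Matrix.cons_val_zero, Matrix.cons_val, Ring.inverse_eq_inv',
        ContinuousLinearMap.id_apply]
      field_simp
    have a2 : wienerConst (y * S) = wienerConst (conjIf 1 y ^ 2 * conjIf 2 y *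
        Ring.inverse (conjIf 3 y) ^ 2 * S) := by
      congr 1
      simp only [conjIf, Matrix.cons_val_one, Matrix.cons_val_zero, Matrix.cons_val,
        Ring.inverse_eq_inv', ContinuousLinearMap.id_apply, conjL_apply, RCLike.star_def]
      field_simp
    conv_rhs => rw [a1]
    conv_rhs => arg 2; rw [← a1, a2]
    simp only [map_mul, map_pow]
    ring
  rw [rhs, e5, map_add]
  -- The second frequencies `0` and `2` carry opposite signs, so the two terms cancel.
  have r0 := wienerFrame.row_s 0 0 (y * S)
  have r2 := wienerFrame.row_s 0 (0 + 2) (y * S)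
  rw [← Frame.E_sq_mul] at r2
  change wienerFrame.row (wienerFrame.E ^ 2 * wienerConst (y * S)) = _ at r2
  change wienerFrame.row (wienerConst (y * S)) = _ at r0
  rw [r0, r2, ← map_add, sgn, sgn]
  simp

/-- Evaluation at a time is an algebra homomorphism, so it commutes with the nonlinearity. Its part
of degree zero is the nonlinearity of the limit circle, whose row sums vanish; what remains is a
decaying family whose norm is independent of time. -/
theorem rhs_stateEval {τ : ℝ → ℝ} {c : ℕ → ℝ} {K a : ℝ} (hc : IsExpansion τ c K a) {μ : ℝ≥0}
    {z : State} (h : Regular a (stateVars μ z)) (h0 : Regular a (vars (Fam.single 0 z.1)))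
    (t : ℝ≥0) : rhs c (stateEval μ t z)
      = famEval μ t ((decayFrame μ).linRow c z.2 + remainder c μ z) := by
  obtain ⟨h2, h3, h01⟩ := h
  have e := map_nonlin (timeEval μ t) (continuous_timeEval μ t) hc.bound hc.pos.le
    (decayFrame μ).E h2 h3 h01
  have e0 := map_nonlin (timeEvalZero μ t) (continuous_timeEvalZero μ t) hc.bound hc.pos.le
    (decayFrame μ).E h2 h3 h01
  have hr : evalPath (rate μ (0, 1, 0)) t 1 = 1 := by
    rw [show rate μ (0, 1, 0) = 0 by simp [rate], evalPath_apply le_rfl]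
    simp
  have hE : timeEval μ t (decayFrame μ).E = wienerFrame.E := by
    refine (timeEval_single μ t (0, 1, 0) 1).trans ?_
    rw [hr]
    rfl
  have hE0 : timeEvalZero μ t (decayFrame μ).E = wienerFrame.E := by
    refine (timeEvalZero_single μ t (0, 1, 0) 1).trans ?_
    rw [if_pos rfl, hr]
    rfl
  simp only [timeEval_stateVars, hE] at e
  simp only [timeEvalZero_stateVars, hE0] at e0
  have hz := rhs_single_zero hc h0
  rw [rhs] at hz
  rw [rhs]
  change wienerFrame.row (nonlin c wienerFrame.E fun i => vars (stateEval μ t z) i) = _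
  rw [← e, row_timeEval, e0]
  change _ + wienerFrame.row (nonlin c wienerFrame.E (vars (Fam.single 0 z.1))) = _
  rw [hz, add_zero, remainder]
  congr 1
  abel

/-! ### Duhamel operators -/

/-- A path as a function on the line. -/
def Path.ext (f : Path) (t : ℝ) : ℂ := f t.toNNReal

theorem Path.continuous_ext (f : Path) : Continuous f.ext :=
  f.continuous.comp continuous_real_toNNReal

theorem Path.norm_ext_le (f : Path) (t : ℝ) : ‖f.ext t‖ ≤ ‖f‖ := f.norm_coe_le_norm _

/-- A bounded operator which solves `y' = -ν y + f`. -/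
structure IsDuhamel (ν C : ℝ) (A : Path →L[ℝ] Path) : Prop where
  norm_le : ‖A‖ ≤ C
  hasDerivAt : ∀ f t, 0 < t → HasDerivAt (A f).ext (-ν * (A f).ext t + f.ext t) t
  zero : 0 < ν → ∀ f, A f 0 = 0

theorem continuous_exp_mul_ext (ν : ℝ) (f : Path) :
    Continuous fun τ : ℝ => (Real.exp (ν * τ) : ℂ) * f.ext τ := by
  have := f.continuous_ext
  fun_prop

/-- The operator attached to a primitive of `e^{νt} f(t)`. -/
theorem isDuhamel_of_primitive {ν C : ℝ} (hC : 0 ≤ C) (J : Path → ℝ → ℂ)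
    (hadd : ∀ f g t, J (f + g) t = J f t + J g t) (hsmul : ∀ (r : ℝ) f t, J (r • f) t = r • J f t)
    (hder : ∀ f t, HasDerivAt (J f) ((Real.exp (ν * t) : ℂ) * f.ext t) t)
    (hle : ∀ f t, 0 ≤ t → ‖J f t‖ ≤ C * Real.exp (ν * t) * ‖f‖)
    (h0 : 0 < ν → ∀ f, J f 0 = 0) : ∃ A, IsDuhamel ν C A := by
  have hbd : ∀ f (t : ℝ≥0), ‖(Real.exp (-ν * t) : ℂ) * J f t‖ ≤ C * ‖f‖ := by
    intro f t
    rw [norm_mul, Complex.norm_real, Real.norm_eq_abs, Real.abs_exp]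
    calc Real.exp (-ν * t) * ‖J f t‖ ≤ Real.exp (-ν * t) * (C * Real.exp (ν * t) * ‖f‖) :=
          mul_le_mul_of_nonneg_left (hle f t t.2) (Real.exp_pos _).le
      _ = C * ‖f‖ * (Real.exp (-ν * t) * Real.exp (ν * t)) := by ring
      _ = C * ‖f‖ := by rw [← Real.exp_add]; simp
  have hcont : ∀ f, Continuous (J f) := fun f =>
    continuous_iff_continuousAt.2 fun t => (hder f t).continuousAt
  let A₀ : Path → Path := fun f => BoundedContinuousFunction.ofNormedAddCommGroup
    (fun t : ℝ≥0 => (Real.exp (-ν * t) : ℂ) * J f t)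
    (by have := hcont f; fun_prop) (C * ‖f‖) (hbd f)
  have hA₀ : ∀ f t, A₀ f t = (Real.exp (-ν * t) : ℂ) * J f t := fun _ _ => rfl
  let A : Path →L[ℝ] Path := LinearMap.mkContinuous
    { toFun := A₀
      map_add' := fun f g => by
        ext t
        rw [BoundedContinuousFunction.add_apply, hA₀, hA₀, hA₀, hadd, mul_add]
      map_smul' := fun r f => by
        ext t
        rw [RingHom.id_apply, BoundedContinuousFunction.smul_apply, hA₀, hA₀, hsmul,
          mul_smul_comm] } C fun f =>
      BoundedContinuousFunction.norm_ofNormedAddCommGroup_le _ (by positivity) (hbd f)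
  have hA : ∀ f t, A f t = (Real.exp (-ν * t) : ℂ) * J f t := fun _ _ => rfl
  refine ⟨A, LinearMap.mkContinuous_norm_le _ hC _, fun f t ht => ?_, fun hν f => ?_⟩
  · have e : (A f).ext =ᶠ[𝓝 t] fun t => (Real.exp (-ν * t) : ℂ) * J f t := by
      filter_upwards [lt_mem_nhds ht] with s hs
      rw [Path.ext, hA, Real.coe_toNNReal _ hs.le]
    have h1 : HasDerivAt (fun t : ℝ => (Real.exp (-ν * t) : ℂ)) ((Real.exp (-ν * t) * -ν : ℝ) : ℂ) t := by
      have : HasDerivAt (fun t : ℝ => Real.exp (-ν * t)) (Real.exp (-ν * t) * -ν) t := by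
        simpa using ((hasDerivAt_id t).const_mul (-ν)).exp
      exact this.ofReal_comp
    refine (((h1.mul (hder f t)).congr_of_eventuallyEq e).congr_deriv ?_)
    rw [e.eq_of_nhds, ← mul_assoc, ← Complex.ofReal_mul, ← Real.exp_add]
    push_cast
    simp only [neg_mul, neg_add_cancel, Complex.exp_zero, one_mul]
    ring
  · rw [hA, NNReal.coe_zero, h0 hν, mul_zero]

/-- Damped case: the forward solution `e^{-νt} ∫₀ᵗ e^{ντ} f` with zero initial value. -/
theorem exists_isDuhamel_of_pos {ν : ℝ} (hν : 0 < ν) : ∃ A, IsDuhamel ν ν⁻¹ A := by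
  refine isDuhamel_of_primitive (by positivity)
    (fun f t => ∫ τ in (0 : ℝ)..t, (Real.exp (ν * τ) : ℂ) * f.ext τ) ?_ ?_ ?_ ?_ ?_
  · intro f g t
    rw [← intervalIntegral.integral_add ((continuous_exp_mul_ext ν f).intervalIntegrable _ _)
      ((continuous_exp_mul_ext ν g).intervalIntegrable _ _)]
    simp only [← mul_add]
    rfl
  · intro r f t
    rw [← intervalIntegral.integral_smul]
    simp only [← mul_smul_comm]
    rfl
  · intro f t
    exact (continuous_exp_mul_ext ν f).integral_hasStrictDerivAt 0 t |>.hasDerivAt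
  · intro f t ht
    have h : ‖∫ τ in (0 : ℝ)..t, (Real.exp (ν * τ) : ℂ) * f.ext τ‖
        ≤ ∫ τ in (0 : ℝ)..t, Real.exp (ν * τ) * ‖f‖ := by
      refine intervalIntegral.norm_integral_le_of_norm_le ht (ae_of_all _ fun τ _ => ?_)
        (Continuous.intervalIntegrable (by fun_prop) _ _)
      rw [norm_mul, Complex.norm_real, Real.norm_eq_abs, Real.abs_exp]
      exact mul_le_mul_of_nonneg_left (f.norm_ext_le τ) (Real.exp_pos _).le
    refine h.trans ?_
    rw [intervalIntegral.integral_mul_const,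
      intervalIntegral.integral_comp_mul_left (fun x => Real.exp x) hν.ne', integral_exp]
    refine mul_le_mul_of_nonneg_right ?_ (norm_nonneg f)
    rw [smul_eq_mul, mul_zero, Real.exp_zero]
    have := inv_pos.2 hν
    nlinarith
  · intro _ f
    exact intervalIntegral.integral_same

theorem integrableOn_exp_mul_ext {ν : ℝ} (hν : ν < 0) (f : Path) (a : ℝ) :
    IntegrableOn (fun τ : ℝ => (Real.exp (ν * τ) : ℂ) * f.ext τ) (Ioi a) := by
  refine Integrable.mono' ((integrableOn_exp_mul_Ioi hν a).mul_const ‖f‖)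
    (continuous_exp_mul_ext ν f).aestronglyMeasurable (ae_of_all _ fun τ => ?_)
  rw [norm_mul, Complex.norm_real, Real.norm_eq_abs, Real.abs_exp]
  exact mul_le_mul_of_nonneg_left (f.norm_ext_le τ) (Real.exp_pos _).le

/-- Growing case: boundedness forces integration from infinity, `-e^{-νt} ∫ₜ^∞ e^{ντ} f`, and no
initial value can be prescribed. -/
theorem exists_isDuhamel_of_neg {ν : ℝ} (hν : ν < 0) : ∃ A, IsDuhamel ν (-ν)⁻¹ A := by
  have hi := integrableOn_exp_mul_ext hν
  have hc := continuous_exp_mul_ext ν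
  refine isDuhamel_of_primitive (by have := neg_pos.2 hν; positivity)
    (fun f t => (∫ τ in (0 : ℝ)..t, (Real.exp (ν * τ) : ℂ) * f.ext τ)
      - ∫ τ in Ioi (0 : ℝ), (Real.exp (ν * τ) : ℂ) * f.ext τ) ?_ ?_ ?_ ?_ ?_
  · intro f g t
    have h1 := intervalIntegral.integral_add (μ := volume) ((hc f).intervalIntegrable 0 t)
      ((hc g).intervalIntegrable 0 t)
    have h2 := integral_add (hi f 0) (hi g 0)
    have e : ∀ τ, (Real.exp (ν * τ) : ℂ) * (f + g).ext τ
        = (Real.exp (ν * τ) : ℂ) * f.ext τ + (Real.exp (ν * τ) : ℂ) * g.ext τ := fun τ =>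
      mul_add _ _ _
    simp only [e]
    rw [h1, h2]
    ring
  · intro r f t
    have e : ∀ τ, (Real.exp (ν * τ) : ℂ) * (r • f).ext τ
        = r • ((Real.exp (ν * τ) : ℂ) * f.ext τ) := fun τ =>
      mul_smul_comm r (Real.exp (ν * τ) : ℂ) (f.ext τ)
    simp only [e]
    rw [intervalIntegral.integral_smul, integral_smul, smul_sub]
  · intro f t
    exact ((hc f).integral_hasStrictDerivAt 0 t).hasDerivAt.sub_const _
  · intro f t ht
    have e : (∫ τ in (0 : ℝ)..t, (Real.exp (ν * τ) : ℂ) * f.ext τ)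
        - ∫ τ in Ioi (0 : ℝ), (Real.exp (ν * τ) : ℂ) * f.ext τ
        = -∫ τ in Ioi t, (Real.exp (ν * τ) : ℂ) * f.ext τ := by
      rw [← intervalIntegral.integral_interval_add_Ioi (hi f 0) (hi f t)]
      ring
    rw [e, norm_neg]
    refine (norm_integral_le_of_norm_le ((integrableOn_exp_mul_Ioi hν t).mul_const ‖f‖)
      (ae_of_all _ fun τ => ?_)).trans ?_
    · rw [norm_mul, Complex.norm_real, Real.norm_eq_abs, Real.abs_exp]
      exact mul_le_mul_of_nonneg_left (f.norm_ext_le τ) (Real.exp_pos _).le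
    · rw [integral_mul_const, integral_exp_mul_Ioi hν]
      refine mul_le_mul_of_nonneg_right (le_of_eq ?_) (norm_nonneg f)
      rw [inv_neg]
      field_simp
  · intro h
    exact absurd h hν.not_gt

/-! ### The linearised evolution -/

/-- The relaxation rate of a mode of the linearised problem. -/
def relaxRate (c : ℕ → ℝ) (n : ℤ) : ℝ :=
  if 0 ≤ n then (c 0 + 2 * c 1) / 4 * n else c 0 / 4 * -n

/-- The coefficients of the modes in terms of the diagonal variables. -/
def modeDiag (n : ℤ) : ℝ :=
  if n = 0 then 1 else if 1 ≤ n then (n + 1) / (2 * n) else if n = -1 then 0 else -1 / 2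

/-- The coefficients of the modes in terms of the opposite diagonal variables. -/
def modeAnti (n : ℤ) : ℝ :=
  if 2 ≤ n then 1 / 2 else if n ≤ -1 then (n + 1) / (2 * n) else 0

theorem abs_modeDiag_le (n : ℤ) : |modeDiag n| ≤ 1 := by
  unfold modeDiag
  split_ifs with h0 h1 h2
  · simp
  · have : (1 : ℝ) ≤ n := by exact_mod_cast h1
    rw [abs_of_nonneg (by positivity), div_le_one (by positivity)]
    linarith
  · simp
  · norm_num

theorem abs_modeAnti_le (n : ℤ) : |modeAnti n| ≤ 1 := by
  unfold modeAnti
  split_ifs with h0 h1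
  · norm_num
  · have : (n : ℝ) ≤ -1 := by exact_mod_cast h1
    rw [abs_of_nonneg (div_nonneg_of_nonpos (by linarith) (by linarith)),
      div_le_one_of_neg (by linarith)]
    linarith
  · simp

/-- The coefficients of the scaled forcing of the diagonal variables. -/
def forceDiag (n : ℤ) : ℝ :=
  if n = 0 then -1 / 8 else if 1 ≤ n then -((n + 1) / (8 * n)) else -((n ^ 2 - 1) / (8 * n ^ 2))

/-- The coefficients of the opposite scaled forcing of the diagonal variables. -/
def forceAnti (n : ℤ) : ℝ :=
  if n = 0 then 0 else if 1 ≤ n then (n - 1) / (8 * n) else -((n ^ 2 - 1) / (8 * n ^ 2))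

theorem abs_sq_coeff_le {n : ℝ} (h : 1 ≤ n ^ 2) : |-((n ^ 2 - 1) / (8 * n ^ 2))| ≤ 1 := by
  rw [abs_neg, abs_of_nonneg (div_nonneg (by linarith) (by positivity)), div_le_one (by linarith)]
  linarith

theorem one_le_sq_cast {n : ℤ} (h : n ≠ 0) : (1 : ℝ) ≤ (n : ℝ) ^ 2 := by
  have : 0 < n ^ 2 := by positivity
  exact_mod_cast this

theorem abs_forceDiag_le (n : ℤ) : |forceDiag n| ≤ 1 := by
  unfold forceDiag
  split_ifs with h0 h1
  · norm_num
  · have : (1 : ℝ) ≤ n := by exact_mod_cast h1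
    rw [abs_neg, abs_of_nonneg (by positivity), div_le_one (by positivity)]
    linarith
  · exact abs_sq_coeff_le (one_le_sq_cast h0)

theorem abs_forceAnti_le (n : ℤ) : |forceAnti n| ≤ 1 := by
  unfold forceAnti
  split_ifs with h0 h1
  · simp
  · have : (1 : ℝ) ≤ n := by exact_mod_cast h1
    rw [abs_of_nonneg (div_nonneg (by linarith) (by positivity)), div_le_one (by positivity)]
    linarith
  · exact abs_sq_coeff_le (one_le_sq_cast h0)

/-- The coefficients of the diagonal variables in terms of the modes. -/
def dataDiag (n : ℤ) : ℝ := if n = 0 then 0 else if 1 ≤ n then 1 else (1 - n) / n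

/-- The coefficients of the diagonal variables in terms of the opposite modes. -/
def dataAnti (n : ℤ) : ℝ := if n = 0 then 0 else if 1 ≤ n then 1 else (n + 1) / n

theorem abs_dataDiag_le (n : ℤ) : |dataDiag n| ≤ 2 := by
  unfold dataDiag
  split_ifs with h0 h1
  · simp
  · norm_num
  · have : (n : ℝ) ≤ -1 := by exact_mod_cast (by omega : n ≤ -1)
    rw [abs_div, abs_of_nonneg (by linarith), abs_of_neg (by linarith),
      div_le_iff₀ (by linarith)]
    linarith

theorem abs_dataAnti_le (n : ℤ) : |dataAnti n| ≤ 2 := by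
  unfold dataAnti
  split_ifs with h0 h1
  · simp
  · norm_num
  · have : (n : ℝ) ≤ -1 := by exact_mod_cast (by omega : n ≤ -1)
    rw [abs_div, abs_of_nonpos (by linarith), abs_of_neg (by linarith),
      div_le_iff₀ (by linarith)]
    linarith

/-- The family of the scaled diagonal variables evolves as the modes should. -/
theorem mode_evolution (c : ℕ → ℝ) (n : ℤ) (P Q R S : ℂ) :
    (modeDiag n : ℂ) * (-relaxRate c n * P
        + max |(n : ℝ)| 1 * (forceDiag n * R + forceAnti n * S))
      + modeAnti n * (-relaxRate c (-n) * Q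
        + max |(n : ℝ)| 1 * (forceDiag (-n) * S + forceAnti (-n) * R))
    = -(n + 1) / 8 * (Frame.diagCoeff c n * (if n = 0 then 0 else modeDiag n * P + modeAnti n * Q)
        + Frame.antiCoeff c n * (modeDiag (-n) * Q + modeAnti (-n) * P) + R) := by
  rcases lt_trichotomy n 0 with h | rfl | h
  · obtain rfl | h2 : n = -1 ∨ n ≤ -2 := by omega
    · simp [modeDiag, modeAnti]
    have h3 : (n : ℝ) ≤ -2 := by exact_mod_cast h2
    have h4 : (n : ℂ) ≠ 0 := by exact_mod_cast h.ne
    have h5 : (n : ℂ) + 1 ≠ 0 := by exact_mod_cast (by omega : n + 1 ≠ 0)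
    have e1 : max |(n : ℝ)| 1 = -n := by
      rw [abs_of_neg (by linarith), max_eq_left (by linarith)]
    rw [Frame.diagCoeff_of_neg c h2, Frame.antiCoeff_of_neg c h2, e1]
    simp only [modeDiag, modeAnti, relaxRate, forceDiag, forceAnti,
      if_neg (show ¬ n = 0 by omega), if_neg (show ¬ 1 ≤ n by omega), if_neg (show ¬ 0 ≤ n by omega),
      if_neg (show ¬ n = -1 by omega), if_neg (show ¬ 2 ≤ n by omega), if_pos (show n ≤ -1 by omega),
      if_neg (show ¬ -n = 0 by omega), if_pos (show 1 ≤ -n by omega), if_pos (show 2 ≤ -n by omega),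
      if_pos (show 0 ≤ -n by omega)]
    push_cast
    field_simp
    ring
  · simp [modeDiag, modeAnti, relaxRate, forceDiag, forceAnti, Frame.diagCoeff_zero,
      Frame.antiCoeff_zero]
  · obtain rfl | h2 : n = 1 ∨ 2 ≤ n := by omega
    · simp [modeDiag, modeAnti, relaxRate, forceDiag, forceAnti, Frame.diagCoeff_of_pos]
      ring
    have h3 : (2 : ℝ) ≤ n := by exact_mod_cast h2
    have h4 : (n : ℂ) ≠ 0 := by exact_mod_cast h.ne'
    have h5 : (n : ℂ) + 1 ≠ 0 := by exact_mod_cast (by omega : n + 1 ≠ 0)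
    have e1 : max |(n : ℝ)| 1 = n := by
      rw [abs_of_pos (by linarith), max_eq_left (by linarith)]
    rw [Frame.diagCoeff_of_pos c (by omega), Frame.antiCoeff_of_pos c h2, e1]
    simp only [modeDiag, modeAnti, relaxRate, forceDiag, forceAnti,
      if_neg (show ¬ n = 0 by omega), if_pos (show 1 ≤ n by omega), if_pos (show 0 ≤ n by omega),
      if_pos (show 2 ≤ n by omega), if_neg (show ¬ -n = 0 by omega),
      if_neg (show ¬ 1 ≤ -n by omega), if_neg (show ¬ 2 ≤ -n by omega),
      if_neg (show ¬ -n = -1 by omega), if_neg (show ¬ 0 ≤ -n by omega),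
      if_pos (show -n ≤ -1 by omega)]
    push_cast
    field_simp
    ring

/-- The passages to and from the diagonal variables are mutually inverse once the mode `-1`
vanishes. With `w` the conjugate of the mode `-n`, that constraint concerns `w` for `n = 1` and `v`
for `n = -1`. -/
theorem modeDiag_dataDiag {n : ℤ} (hn : n ≠ 0) (v w : ℂ) (h1 : n = 1 → w = 0) (h2 : n = -1 → v = 0) :
    (modeDiag n : ℂ) * (dataDiag n * v + dataAnti n * w)
      + modeAnti n * (dataDiag (-n) * w + dataAnti (-n) * v) = v := by
  have h4 : (n : ℂ) ≠ 0 := by exact_mod_cast hn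
  rcases lt_or_gt_of_ne hn with h | h
  · obtain rfl | h3 : n = -1 ∨ n ≤ -2 := by omega
    · simp [modeDiag, modeAnti, h2]
    simp only [modeDiag, modeAnti, dataDiag, dataAnti,
      if_neg (show ¬ n = 0 by omega), if_neg (show ¬ 1 ≤ n by omega),
      if_neg (show ¬ n = -1 by omega), if_neg (show ¬ 2 ≤ n by omega), if_pos (show n ≤ -1 by omega),
      if_neg (show ¬ -n = 0 by omega), if_pos (show 1 ≤ -n by omega)]
    push_cast
    field_simp
    ring
  · obtain rfl | h3 : n = 1 ∨ 2 ≤ n := by omega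
    · simp [modeDiag, modeAnti, dataDiag, dataAnti, h1]
    simp only [modeDiag, modeAnti, dataDiag, dataAnti,
      if_neg (show ¬ n = 0 by omega), if_pos (show 1 ≤ n by omega),
      if_pos (show 2 ≤ n by omega), if_neg (show ¬ -n = 0 by omega),
      if_neg (show ¬ 1 ≤ -n by omega)]
    push_cast
    field_simp
    ring

/-- The diagonal operator with given entries. -/
def Fam.diag {B B' : Type*} [NormedAddCommGroup B] [NormedSpace ℝ B] [NormedAddCommGroup B']
    [NormedSpace ℝ B'] [CompleteSpace B'] (A : ℤ → B →L[ℝ] B') {C : ℝ} (h : ∀ n, ‖A n‖ ≤ C) :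
    Fam ℤ B →L[ℝ] Fam ℤ B' :=
  Fam.lift (C := C) (fun n => (Fam.single n).comp (A n)) fun n =>
    ContinuousLinearMap.opNorm_le_bound _ ((norm_nonneg _).trans (h n)) fun b => by
      rw [ContinuousLinearMap.comp_apply, Fam.norm_single]
      exact ContinuousLinearMap.le_of_opNorm_le _ (h n) b

theorem Fam.diag_apply {B B' : Type*} [NormedAddCommGroup B] [NormedSpace ℝ B]
    [NormedAddCommGroup B'] [NormedSpace ℝ B'] [CompleteSpace B'] (A : ℤ → B →L[ℝ] B') {C : ℝ}
    (h : ∀ n, ‖A n‖ ≤ C) (f : Fam ℤ B) (n : ℤ) : Fam.diag A h f n = A n (f n) := by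
  have : Fam.coord n ∘L Fam.diag A h = A n ∘L Fam.coord n := by
    refine Fam.clm_ext fun k b => ?_
    simp only [ContinuousLinearMap.comp_apply, Fam.diag, Fam.lift_single]
    change (Fam.single k (A k b) : Fam ℤ B') n = A n ((Fam.single k b : Fam ℤ B) n)
    rw [Fam.single_apply, Fam.single_apply]
    split_ifs with h
    · rw [h]
    · rw [map_zero]
  exact Fam.clm_eq this f

theorem stateEval_apply (μ t : ℝ≥0) (z : State) (n : ℤ) : stateEval μ t z n
    = (if n = 0 then z.1 else 0) + (Real.exp (-modeRate μ n * t) : ℂ) * z.2 n t := by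
  rw [stateEval, Fam.add_apply, Fam.single_apply, famEval_apply]
  congr

/-- The factor `8` makes the relaxation rate at least `2μ|n|`: one half pays for the exponential
weight, the other remains as damping of order `|n|`, which recovers the derivative lost in the
forcing. -/
theorem relaxRate_sub_modeRate {c : ℕ → ℝ} {μ : ℝ≥0} (h1 : 8 * μ ≤ c 0)
    (h2 : 8 * μ ≤ c 0 + 2 * c 1) {n : ℤ} (hn : n ≠ 0) :
    μ * max |(n : ℝ)| 1 ≤ relaxRate c n - modeRate μ n := by
  have hn1 : (1 : ℝ) ≤ |(n : ℝ)| := by exact_mod_cast Int.one_le_abs hn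
  have key : 2 * μ * |(n : ℝ)| ≤ relaxRate c n := by
    unfold relaxRate
    split_ifs with h
    · rw [abs_of_nonneg (by exact_mod_cast h)]
      exact mul_le_mul_of_nonneg_right (by linarith) (by exact_mod_cast h)
    · rw [abs_of_neg (by exact_mod_cast not_le.1 h)]
      exact mul_le_mul_of_nonneg_right (by linarith)
        (neg_nonneg.2 (by exact_mod_cast (not_le.1 h).le))
  rw [modeRate, max_eq_left hn1]
  linarith

theorem relaxRate_sub_modeRate_zero (c : ℕ → ℝ) (μ : ℝ≥0) : relaxRate c 0 - modeRate μ 0 = -μ := by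
  simp [relaxRate, modeRate]

theorem exists_duhamel_family {c : ℕ → ℝ} {μ : ℝ≥0} (hμ : 0 < μ) (h1 : 8 * μ ≤ c 0)
    (h2 : 8 * μ ≤ c 0 + 2 * c 1) : ∃ A : ℤ → Path →L[ℝ] Path, ∀ n,
      IsDuhamel (relaxRate c n - modeRate μ n) (μ * max |(n : ℝ)| 1)⁻¹ (A n) := by
  have hμ' : (0 : ℝ) < μ := hμ
  have : ∀ n : ℤ, ∃ A, IsDuhamel (relaxRate c n - modeRate μ n) (μ * max |(n : ℝ)| 1)⁻¹ A := by
    intro n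
    rcases eq_or_ne n 0 with rfl | hn
    · rw [relaxRate_sub_modeRate_zero]
      obtain ⟨A, hA⟩ := exists_isDuhamel_of_neg (neg_lt_zero.2 hμ')
      refine ⟨A, ⟨hA.norm_le.trans (by simp), hA.hasDerivAt, hA.zero⟩⟩
    · have h := relaxRate_sub_modeRate h1 h2 hn
      have h0 : 0 < μ * max |(n : ℝ)| 1 := by positivity
      obtain ⟨A, hA⟩ := exists_isDuhamel_of_pos (h0.trans_le h)
      exact ⟨A, ⟨hA.norm_le.trans (inv_anti₀ h0 h), hA.hasDerivAt, hA.zero⟩⟩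
  choose A hA using this
  exact ⟨A, hA⟩

/-- The paths `t ↦ e^{-νt} z`. -/
def decayPath (ν : ℝ) : ℂ →L[ℝ] Path := (ContinuousLinearMap.mul ℝ Path (decay ν)).comp constPath

theorem norm_decayPath_le (ν : ℝ) : ‖decayPath ν‖ ≤ 1 :=
  ContinuousLinearMap.opNorm_le_bound _ zero_le_one fun z => by
    refine (norm_mul_le _ _).trans ?_
    exact mul_le_mul (norm_decay_le ν) (norm_constPath_le z) (norm_nonneg _) zero_le_one

theorem decayPath_apply {ν : ℝ} (hν : 0 ≤ ν) (z : ℂ) (t : ℝ≥0) :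
    decayPath ν z t = (Real.exp (-ν * t) : ℂ) * z := by
  change (decay ν * constPath z) t = _
  rw [BoundedContinuousFunction.mul_apply, decay_apply hν, constPath_apply]

theorem decayPath_ext_hasDerivAt {ν : ℝ} (hν : 0 ≤ ν) (z : ℂ) {t : ℝ} (ht : 0 < t) :
    HasDerivAt (decayPath ν z).ext (-ν * (decayPath ν z).ext t) t := by
  have e : (decayPath ν z).ext =ᶠ[𝓝 t] fun t => (Real.exp (-ν * t) : ℂ) * z := by
    filter_upwards [lt_mem_nhds ht] with s hs
    rw [Path.ext, decayPath_apply hν, Real.coe_toNNReal _ hs.le]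
  have h1 : HasDerivAt (fun t : ℝ => (Real.exp (-ν * t) : ℂ)) ((Real.exp (-ν * t) * -ν : ℝ) : ℂ) t := by
    have : HasDerivAt (fun t : ℝ => Real.exp (-ν * t)) (Real.exp (-ν * t) * -ν) t := by
      simpa using ((hasDerivAt_id t).const_mul (-ν)).exp
    exact this.ofReal_comp
  refine ((h1.mul_const z).congr_of_eventuallyEq e).congr_deriv ?_
  rw [e.eq_of_nhds]
  push_cast
  ring

/-- The linear problem with forcing, for exponentially decaying families. -/
theorem exists_linear_solution {c : ℕ → ℝ} {μ : ℝ≥0} (hμ : 0 < μ) (h1 : 8 * μ ≤ c 0)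
    (h2 : 8 * μ ≤ c 0 + 2 * c 1) :
    ∃ (L : Fam ℤ ℂ →L[ℝ] State) (T : Fam ℤ Path →L[ℝ] State), ∀ w R, w (-1) = 0 →
      stateEval μ 0 (L w + T R) = w ∧ (L w + T R).2 (-1) = 0 ∧
      ∀ n : ℤ, ∀ t : ℝ, 0 < t →
        HasDerivAt (fun s : ℝ => stateEval μ s.toNNReal (L w + T R) n) (-(n + 1) / 8 *
          famEval μ t.toNNReal ((decayFrame μ).linRow c (L w + T R).2 + R) n) t := by
  obtain ⟨A, hA⟩ := exists_duhamel_family hμ h1 h2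
  set ν : ℤ → ℝ := fun n => relaxRate c n - modeRate μ n with hν
  have hν0 : ∀ n ≠ 0, 0 < ν n := fun n hn =>
    (show 0 < μ * max |(n : ℝ)| 1 by positivity).trans_le (relaxRate_sub_modeRate h1 h2 hn)
  -- The factor `max |n| 1` is the derivative in the forcing; the Duhamel bound `(μ max |n| 1)⁻¹`
  -- absorbs it exactly.
  let A' : ℤ → Path →L[ℝ] Path := fun n => max |(n : ℝ)| 1 • A n
  have hA' : ∀ n, ‖A' n‖ ≤ (μ : ℝ)⁻¹ := by
    intro n
    have h : 0 < max |(n : ℝ)| 1 := by positivity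
    rw [norm_smul, Real.norm_of_nonneg h.le]
    refine (mul_le_mul_of_nonneg_left (hA n).norm_le h.le).trans (le_of_eq ?_)
    field_simp
  let force : Fam ℤ Path →L[ℝ] Fam ℤ Path :=
    twoDiag forceDiag forceAnti abs_forceDiag_le abs_forceAnti_le
  let data : Fam ℤ ℂ →L[ℝ] Fam ℤ ℂ := twoDiag dataDiag dataAnti abs_dataDiag_le abs_dataAnti_le
  let modes : Fam ℤ Path →L[ℝ] Fam ℤ Path :=
    twoDiag modeDiag modeAnti abs_modeDiag_le abs_modeAnti_le
  let e0 : Fam ℤ Path →L[ℝ] ℂ := (BoundedContinuousFunction.evalCLM ℝ 0).comp (Fam.coord 0)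
  let lin : Fam ℤ ℂ →L[ℝ] Fam ℤ Path := Fam.diag (fun n => decayPath (ν n)) (fun n => norm_decayPath_le _)
  let duh : Fam ℤ Path →L[ℝ] Fam ℤ Path := Fam.diag A' hA'
  let T₂ := modes ∘L duh ∘L force
  let L₂ := modes ∘L lin ∘L data
  -- The neutral mode is integrated from infinity, so its decaying part has a forced value at time
  -- `0`. The first component, the limit, is chosen to make up the difference with `w 0`.
  refine ⟨(Fam.coord 0 - e0 ∘L L₂).prod L₂, (-(e0 ∘L T₂)).prod T₂, fun w R hw => ?_⟩
  set z : State := (Fam.coord 0 - e0 ∘L L₂).prod L₂ w + (-(e0 ∘L T₂)).prod T₂ R with hz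
  let Y : Fam ℤ Path := lin (data w) + duh (force R)
  have hz2 : z.2 = modes Y := by
    change modes (lin (data w)) + modes (duh (force R)) = _
    rw [← map_add]
  have hz1 : z.1 = w 0 - z.2 0 0 := by
    change w 0 - L₂ w 0 0 + -(T₂ R 0 0) = w 0 - (L₂ w 0 0 + T₂ R 0 0)
    ring
  have hY : ∀ n, Y n = decayPath (ν n) (data w n) + A' n (force R n) := fun n => by
    change lin (data w) n + duh (force R) n = _
    rw [Fam.diag_apply, Fam.diag_apply]
  have hg : ∀ n t, z.2 n t = modeDiag n * Y n t + modeAnti n * star (Y (-n) t) := fun n t => by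
    rw [hz2, twoDiag_apply]
    change modeDiag n • Y n t + modeAnti n • star (Y (-n) t) = _
    rw [Complex.real_smul, Complex.real_smul]
  have hY0 : ∀ n ≠ 0, Y n 0 = dataDiag n * w n + dataAnti n * star (w (-n)) := by
    intro n hn
    have h : A' n (force R n) 0 = 0 := by
      change max |(n : ℝ)| 1 • A n (force R n) 0 = 0
      rw [(hA n).zero (hν0 n hn), smul_zero]
    rw [hY, BoundedContinuousFunction.add_apply, h, add_zero, decayPath_apply (hν0 n hn).le,
      twoDiag_apply, Complex.real_smul, Complex.real_smul]
    simp
  refine ⟨Fam.ext fun n => ?_, ?_, fun n t ht => ?_⟩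
  · rw [stateEval_apply]
    rcases eq_or_ne n 0 with rfl | hn
    · simp [hz1]
    · rw [if_neg hn, NNReal.coe_zero, mul_zero, Real.exp_zero, Complex.ofReal_one, one_mul, zero_add,
        hg, hY0 n hn, hY0 (-n) (neg_ne_zero.2 hn), neg_neg]
      simp only [RCLike.star_def, map_add, map_mul, Complex.conj_ofReal, Complex.conj_conj]
      refine modeDiag_dataDiag hn _ _ (fun h => ?_) fun h => ?_
      · rw [h, hw, map_zero]
      · rw [h, hw]
  · ext t
    rw [hg]
    simp [modeDiag, modeAnti]
  · -- the diagonal variables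
    let P : ℤ → ℝ → ℂ := fun n s => (Real.exp (-modeRate μ n * s) : ℂ) * (Y n).ext s
    have hP : ∀ n, HasDerivAt (P n) (-relaxRate c n * P n t + max |(n : ℝ)| 1 *
        (Real.exp (-modeRate μ n * t) * (force R n).ext t)) t := by
      intro n
      have d1 : HasDerivAt (fun s : ℝ => (Real.exp (-modeRate μ n * s) : ℂ))
          ((Real.exp (-modeRate μ n * t) * -modeRate μ n : ℝ) : ℂ) t := by
        have : HasDerivAt (fun t : ℝ => Real.exp (-modeRate μ n * t))
            (Real.exp (-modeRate μ n * t) * -modeRate μ n) t := by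
          simpa using ((hasDerivAt_id t).const_mul (-modeRate μ n)).exp
        exact this.ofReal_comp
      have d2 : HasDerivAt (decayPath (ν n) (data w n)).ext
          (-ν n * (decayPath (ν n) (data w n)).ext t) t := by
        -- For `n = 0` the rate `ν 0 = -μ` is negative and `decayPath` is truncated, but the
        -- diagonal datum is zero there.
        rcases eq_or_ne n 0 with rfl | hn
        · have : data w 0 = 0 := by
            rw [twoDiag_apply]
            simp [dataDiag, dataAnti]
          rw [this, map_zero]
          change HasDerivAt (fun _ => (0 : ℂ)) (_ * 0) t
          rw [mul_zero]
          exact hasDerivAt_const _ _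
        · exact decayPath_ext_hasDerivAt (hν0 n hn).le _ ht
      have d3 := ((hA n).hasDerivAt (force R n) t ht).const_smul (max |(n : ℝ)| 1)
      have d4 : HasDerivAt (Y n).ext (-ν n * (decayPath (ν n) (data w n)).ext t
          + max |(n : ℝ)| 1 • (-((ν n : ℝ) : ℂ) * (A n (force R n)).ext t + (force R n).ext t)) t := by
        refine (d2.add d3).congr_of_eventuallyEq (Eventually.of_forall fun s => ?_)
        rw [hY]
        rfl
      refine (d1.mul d4).congr_deriv ?_
      have e : (Y n).ext t = (decayPath (ν n) (data w n)).ext t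
          + max |(n : ℝ)| 1 • (A n (force R n)).ext t := by
        rw [hY]
        rfl
      simp only [P, e, hν, Complex.real_smul]
      push_cast
      ring
    have hV : ∀ n s, 0 ≤ s → (Real.exp (-modeRate μ n * s) : ℂ) * z.2 n s.toNNReal
        = modeDiag n * P n s + modeAnti n * star (P (-n) s) := by
      intro n s hs
      simp only [hg, P, Path.ext, modeRate_neg, RCLike.star_def, map_mul, Complex.conj_ofReal]
      ring
    have d : HasDerivAt (fun s : ℝ => stateEval μ s.toNNReal z n) (modeDiag n * (-relaxRate c n * P n t
          + max |(n : ℝ)| 1 * (Real.exp (-modeRate μ n * t) * (force R n).ext t))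
        + modeAnti n * star (-relaxRate c (-n) * P (-n) t + max |((-n : ℤ) : ℝ)| 1 *
          (Real.exp (-modeRate μ (-n) * t) * (force R (-n)).ext t))) t := by
      refine HasDerivAt.congr_of_eventuallyEq
        ((((hP n).const_mul _).add ((hP (-n)).star.const_mul _)).const_add
          (if n = 0 then z.1 else 0)) ?_
      filter_upwards [lt_mem_nhds ht] with s hs
      rw [stateEval_apply, Real.coe_toNNReal _ hs.le, hV n s hs.le]
      rfl
    refine d.congr_deriv ?_
    have key := mode_evolution c n (P n t) (star (P (-n) t)) (Real.exp (-modeRate μ n * t) * (R n).ext t)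
      (Real.exp (-modeRate μ n * t) * star ((R (-n)).ext t))
    have hf : ∀ n, (force R n).ext t = forceDiag n * (R n).ext t + forceAnti n * star ((R (-n)).ext t) := by
      intro n
      change force R n t.toNNReal = _
      rw [twoDiag_apply]
      change forceDiag n • R n t.toNNReal + forceAnti n • star (R (-n) t.toNNReal) = _
      rw [Complex.real_smul, Complex.real_smul]
      rfl
    have hl : famEval μ t.toNNReal ((decayFrame μ).linRow c z.2 + R) n
        = Frame.diagCoeff c n * (modeDiag n * P n t + modeAnti n * star (P (-n) t))
          + Frame.antiCoeff c n * (modeDiag (-n) * star (P (-n) t) + modeAnti (-n) * P n t)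
          + Real.exp (-modeRate μ n * t) * (R n).ext t := by
      have v1 := hV n t ht.le
      have v2 := congrArg star (hV (-n) t ht.le)
      rw [famEval_apply, Real.coe_toNNReal _ ht.le, Fam.add_apply, Frame.linRow_eq]
      change _ * (Frame.diagCoeff c n • z.2 n t.toNNReal
        + Frame.antiCoeff c n • star (z.2 (-n) t.toNNReal) + (R n).ext t) = _
      rw [neg_neg, modeRate_neg] at v2
      simp only [RCLike.star_def, map_add, map_mul, Complex.conj_ofReal, Complex.conj_conj,
        Complex.real_smul] at v1 v2 ⊢
      linear_combination (Frame.diagCoeff c n : ℂ) * v1 + (Frame.antiCoeff c n : ℂ) * v2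
    -- At `n = 0` the diagonal coefficient vanishes, so the case distinction in `mode_evolution` is
    -- harmless.
    have hn0 : (Frame.diagCoeff c n : ℂ) * (if n = 0 then 0 else modeDiag n * P n t + modeAnti n * star (P (-n) t))
        = Frame.diagCoeff c n * (modeDiag n * P n t + modeAnti n * star (P (-n) t)) := by
      split_ifs with h
      · rw [h, Frame.diagCoeff_zero]; simp
      · rfl
    rw [hn0] at key
    rw [hl, ← key, hf, hf, neg_neg, modeRate_neg]
    simp only [RCLike.star_def, map_add, map_mul, map_neg, Complex.conj_ofReal, Complex.conj_conj,
      Int.cast_neg, abs_neg]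
    ring

/-! ### Contraction argument and global existence for the tangent modes -/

/-- The ball of radius `2‖a‖` is preserved because `‖a‖ + (1/2) · 2‖a‖ = 2‖a‖`; its radius makes the
solution linear in the size of the data. -/
theorem exists_fixed_point {E : Type*} [NormedAddCommGroup E] [CompleteSpace E] {Φ : E → E}
    {δ : ℝ} (hδ : 0 ≤ δ) (h0 : Φ 0 = 0)
    (hΦ : ∀ x y, ‖x‖ ≤ δ → ‖y‖ ≤ δ → ‖Φ x - Φ y‖ ≤ 1 / 2 * ‖x - y‖) {a : E} (ha : 2 * ‖a‖ ≤ δ) :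
    ∃ x, ‖x‖ ≤ 2 * ‖a‖ ∧ a + Φ x = x := by
  have hsub : ∀ {x : E}, x ∈ Metric.closedBall (0 : E) (2 * ‖a‖) → ‖x‖ ≤ δ := fun {x} hx =>
    (mem_closedBall_zero_iff.1 hx).trans ha
  have hmaps : MapsTo (fun x => a + Φ x) (Metric.closedBall 0 (2 * ‖a‖))
      (Metric.closedBall 0 (2 * ‖a‖)) := by
    intro x hx
    have h := hΦ x 0 (hsub hx) (by simpa using hδ)
    rw [h0, sub_zero, sub_zero] at h
    rw [mem_closedBall_zero_iff] at hx ⊢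
    exact (norm_add_le _ _).trans (by linarith)
  have hcontr : ContractingWith (1 / 2) (hmaps.restrict (fun x => a + Φ x) _ _) := by
    refine ⟨by rw [← NNReal.coe_lt_coe]; norm_num, LipschitzWith.of_dist_le_mul fun x y => ?_⟩
    rw [Subtype.dist_eq, Subtype.dist_eq, dist_eq_norm, dist_eq_norm]
    change ‖(a + Φ x) - (a + Φ y)‖ ≤ _
    rw [add_sub_add_left_eq_sub]
    simpa using hΦ x y (hsub x.2) (hsub y.2)
  obtain ⟨x, hx, hfix, -⟩ := hcontr.exists_fixedPoint' Metric.isClosed_closedBall.isComplete hmaps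
    (Metric.mem_closedBall_self (by positivity)) (edist_ne_top _ _)
  exact ⟨x, mem_closedBall_zero_iff.1 hx, hfix⟩

theorem exists_rate {τ : ℝ → ℝ} {c : ℕ → ℝ} {K a : ℝ} (hc : IsExpansion τ c K a) :
    ∃ μ : ℝ≥0, 0 < μ ∧ 8 * μ ≤ c 0 ∧ 8 * μ ≤ c 0 + 2 * c 1 := by
  have h1 := hc.zero_pos
  have h2 := hc.one_pos
  have h := lt_min h1 h2
  refine ⟨(min (c 0) (c 0 + 2 * c 1) / 8).toNNReal, Real.toNNReal_pos.2 (by positivity), ?_, ?_⟩ <;>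
  rw [Real.coe_toNNReal _ (by positivity)]
  · linarith [min_le_left (c 0) (c 0 + 2 * c 1)]
  · linarith [min_le_right (c 0) (c 0 + 2 * c 1)]

/-- Global existence for small data, in terms of the Fourier modes of the tangent. -/
theorem exists_state {τ : ℝ → ℝ} {c : ℕ → ℝ} {K a : ℝ} (hc : IsExpansion τ c K a) :
    ∃ μ : ℝ≥0, 0 < μ ∧ ∃ C > 0, ∃ ε > 0, ∀ w : Fam ℤ ℂ, w (-1) = 0 → ‖w‖ ≤ ε →
      ∃ z : State, ‖z‖ ≤ C * ‖w‖ ∧ stateEval μ 0 z = w ∧ z.2 (-1) = 0 ∧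
        (∀ t, Regular a (vars (stateEval μ t z))) ∧
        ∃ G : Fam ℤ Path, ‖G‖ ≤ C * ‖w‖ ∧ (∀ t, rhs c (stateEval μ t z) = famEval μ t G) ∧
        ∀ n : ℤ, ∀ t : ℝ, 0 < t → HasDerivAt (fun s : ℝ => stateEval μ s.toNNReal z n)
          (-(n + 1) / 8 * famEval μ t.toNNReal G n) t := by
  obtain ⟨μ, hμ, hμ1, hμ2⟩ := exists_rate hc
  obtain ⟨L, T, hLT⟩ := exists_linear_solution hμ hμ1 hμ2
  obtain ⟨δ₁, hδ₁, hreg⟩ := exists_regular (R := DecayAlg μ) hc.pos.le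
  obtain ⟨δ₂, hδ₂, hreg'⟩ := exists_regular (R := Wiener) hc.pos.le
  -- This constant makes the composition of `T` with the remainder Lipschitz with constant `1/2`.
  obtain ⟨δ₃, hδ₃, hrem⟩ := norm_remainder_sub_le hc μ
    (show 0 < 1 / (2 * (‖T‖ + 1)) by positivity)
  -- The division by two offsets the factor `2` in the bounds for `stateVar` and `stateEval`.
  set δ := min (min δ₁ δ₂) δ₃ / 2 with hδ
  have hδ0 : 0 < δ := by positivity
  set N := ‖(decayFrame μ).linRow c‖ with hN
  have hN0 : 0 ≤ N := norm_nonneg _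
  -- The fixed point satisfies `‖z‖ ≤ 2‖L w‖`, and `G`, the linear part plus the remainder, is at
  -- most `(N + 1)‖z‖`.
  refine ⟨μ, hμ, (N + 1) * (2 * ‖L‖ + 1), by positivity, δ / (2 * ‖L‖ + 1), by positivity, fun w hw hwε => ?_⟩
  rw [le_div_iff₀ (by positivity)] at hwε
  have hLw := L.le_opNorm w
  have ha : 2 * ‖L w‖ ≤ δ := by nlinarith [norm_nonneg w, norm_nonneg (L w)]
  obtain ⟨z, hz, hfix⟩ := exists_fixed_point (Φ := fun z => T (remainder c μ z)) hδ0.le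
    (by rw [remainder_zero, map_zero]) (fun x y hx hy => by
      have hxy := hrem x y (by linarith [min_le_right (min δ₁ δ₂) δ₃])
        (by linarith [min_le_right (min δ₁ δ₂) δ₃])
      rw [← map_sub]
      refine (T.le_opNorm _).trans ((mul_le_mul_of_nonneg_left hxy (norm_nonneg _)).trans ?_)
      rw [← mul_assoc]
      refine mul_le_mul_of_nonneg_right ?_ (norm_nonneg _)
      rw [mul_one_div, div_le_div_iff₀ (by positivity) (by norm_num)]
      linarith) ha
  have hzδ : 2 * ‖z‖ ≤ min δ₁ δ₂ := by
    linarith [min_le_left (min δ₁ δ₂) δ₃]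
  obtain ⟨i1, i2, i3⟩ := hLT w (remainder c μ z) hw
  rw [hfix] at i1 i2 i3
  have hR : Regular a (stateVars μ z) := hreg _ fun i => by
    rw [stateVars, add_sub_cancel_left]
    exact (norm_stateVar_le μ i z).trans (hzδ.trans (min_le_left _ _))
  have hR' : ∀ v : Fam ℤ ℂ, ‖v‖ ≤ 2 * ‖z‖ → Regular a (vars v) := fun v hv => hreg' _ fun i =>
    (norm_vars_sub_one_le v i).trans (hv.trans (hzδ.trans (min_le_right _ _)))
  have hzw : ‖z‖ ≤ (2 * ‖L‖ + 1) * ‖w‖ := by nlinarith [norm_nonneg w]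
  have hzr : ‖remainder c μ z‖ ≤ ‖z‖ := by
    have h := hrem z 0 (by linarith [min_le_right (min δ₁ δ₂) δ₃, norm_nonneg z])
      (by rw [norm_zero]; exact hδ₃.le)
    rw [remainder_zero, sub_zero, sub_zero] at h
    refine h.trans (mul_le_of_le_one_left (norm_nonneg z) ?_)
    rw [div_le_one (by positivity)]
    linarith [norm_nonneg T]
  refine ⟨z, ?_, i1, i2, fun t => hR' _ (norm_stateEval_le μ t z), _, ?_, fun t => rhs_stateEval hc hR
    (hR' _ ?_) t, i3⟩
  · nlinarith [mul_nonneg hN0 ((norm_nonneg z).trans hzw)]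
  · have h1 := (((decayFrame μ).linRow c).le_opNorm z.2).trans
      (mul_le_mul_of_nonneg_left (norm_snd_le z) hN0)
    refine (norm_add_le _ _).trans ((add_le_add h1 hzr).trans ?_)
    nlinarith [mul_le_mul_of_nonneg_left hzw hN0]
  · rw [Fam.norm_single]
    linarith [norm_fst_le z, norm_nonneg z]

/-! ### Fourier coefficients of absolutely convergent series -/

/-- The exponential `e^{iks}`. -/
def character (k : ℤ) (s : ℝ) : ℂ := Complex.exp (Complex.I * (k * s))

theorem norm_character (k : ℤ) (s : ℝ) : ‖character k s‖ = 1 := by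
  have : (k : ℂ) * s = ((k * s : ℝ) : ℂ) := by push_cast; rfl
  rw [character, this, norm_exp_I]

theorem continuous_character (k : ℤ) : Continuous (character k) := by
  unfold character; fun_prop

theorem character_periodic (k : ℤ) : Function.Periodic (character k) (2 * Real.pi) := fun s => by
  unfold character
  rw [← Complex.exp_periodic.int_mul k (Complex.I * (k * s))]
  congr 1
  push_cast
  ring

theorem character_zero (s : ℝ) : character 0 s = 1 := by simp [character]

theorem character_one (s : ℝ) : character 1 s = Complex.exp (Complex.I * s) := by simp [character]

theorem character_mul (j k : ℤ) (s : ℝ) : character j s * character k s = character (j + k) s := by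
  rw [character, character, character, ← Complex.exp_add]
  congr 1
  push_cast
  ring

theorem integral_character (k : ℤ) :
    ∫ s in (0 : ℝ)..2 * Real.pi, character k s = if k = 0 then ((2 * Real.pi : ℝ) : ℂ) else 0 := by
  split_ifs with h
  · simp [h, character_zero]
  · have hk : Complex.I * k ≠ 0 := mul_ne_zero Complex.I_ne_zero (by exact_mod_cast h)
    have e : ∀ s : ℝ, character k s = Complex.exp (Complex.I * k * s) := fun s => by
      rw [character, mul_assoc]
    simp only [e]
    rw [integral_exp_mul_complex hk]
    have h1 := character_periodic k 0
    rw [zero_add, e, e] at h1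
    rw [h1, sub_self, zero_div]

theorem coeff_eq_integral (f : ℝ → ℂ) (k : ℤ) :
    coeff f k = (1 / (2 * Real.pi) : ℝ) • ∫ s in (0 : ℝ)..2 * Real.pi, character (-k) s * f s := by
  rw [coeff, fourierCoeffOn_eq_integral, sub_zero]
  congr 1
  refine intervalIntegral.integral_congr fun s _ => ?_
  simp only [fourier_coe_apply, smul_eq_mul, character]
  congr 2
  push_cast
  have : (Real.pi : ℂ) ≠ 0 := by exact_mod_cast Real.pi_ne_zero
  field_simp

theorem coeff_eq_of_hasSum {f : ℝ → ℂ} {X : ℤ → ℂ} (hX : Summable fun k => ‖X k‖)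
    (h : ∀ s, HasSum (fun k => X k * character k s) (f s)) (n : ℤ) : coeff f n = X n := by
  have h1 : HasSum (fun k => ∫ s in (0 : ℝ)..2 * Real.pi, X k * character (k - n) s)
      (∫ s in (0 : ℝ)..2 * Real.pi, character (-n) s * f s) := by
    refine intervalIntegral.hasSum_integral_of_dominated_convergence (fun k _ => ‖X k‖)
      (fun k => (by have := continuous_character (k - n); fun_prop : Continuous fun s =>
        X k * character (k - n) s).aestronglyMeasurable) (fun k => ae_of_all _ fun s _ => ?_)
      (ae_of_all _ fun s _ => hX) intervalIntegrable_const (ae_of_all _ fun s _ => ?_)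
    · rw [norm_mul, norm_character, mul_one]
    · refine (hasSum_congr fun k => ?_).1 ((h s).mul_left (character (-n) s))
      rw [mul_left_comm, character_mul, neg_add_eq_sub]
  have h2 : ∀ k, ∫ s in (0 : ℝ)..2 * Real.pi, X k * character (k - n) s
      = if k = n then X n * ((2 * Real.pi : ℝ) : ℂ) else 0 := fun k => by
    rw [intervalIntegral.integral_const_mul, integral_character]
    by_cases hk : k = n
    · simp [hk]
    · rw [if_neg hk, if_neg (sub_ne_zero.2 hk), mul_zero]
  rw [coeff_eq_integral, h1.unique ((hasSum_congr fun k => (h2 k).symm).1 (hasSum_ite_eq n _)),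
    Complex.real_smul]
  have : (Real.pi : ℂ) ≠ 0 := by exact_mod_cast Real.pi_ne_zero
  push_cast
  field_simp

theorem coeff_sub {f g : ℝ → ℂ} (hf : Continuous f) (hg : Continuous g) (k : ℤ) :
    coeff (fun s => f s - g s) k = coeff f k - coeff g k := by
  have hc := continuous_character (-k)
  rw [coeff_eq_integral, coeff_eq_integral, coeff_eq_integral, ← smul_sub,
    ← intervalIntegral.integral_sub (Continuous.intervalIntegrable (by fun_prop) _ _)
      (Continuous.intervalIntegrable (by fun_prop) _ _)]
  simp only [mul_sub]

theorem circleCurve_eq (a b : ℂ) (s : ℝ) :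
    circleCurve a b s = a * character 0 s + b * character 1 s := by
  rw [circleCurve, character_zero, character_one, mul_one]

theorem continuous_circleCurve (a b : ℂ) : Continuous (circleCurve a b) := by
  unfold circleCurve; fun_prop

theorem coeff_circleCurve (a b : ℂ) (k : ℤ) :
    coeff (circleCurve a b) k = if k = 0 then a else if k = 1 then b else 0 := by
  have hs : ∀ k ∉ ({0, 1} : Finset ℤ), (if k = 0 then a else if k = 1 then b else 0) = 0 := by
    intro k hk
    simp only [Finset.mem_insert, Finset.mem_singleton, not_or] at hk
    rw [if_neg hk.1, if_neg hk.2]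
  refine coeff_eq_of_hasSum (X := fun k => if k = 0 then a else if k = 1 then b else 0)
    (summable_of_ne_finset_zero (s := {0, 1}) fun k hk => by rw [hs k hk, norm_zero])
    (fun s => ?_) k
  have := hasSum_sum_of_ne_finset_zero (L := .unconditional ℤ) (s := ({0, 1} : Finset ℤ))
    (f := fun k => (if k = 0 then a else if k = 1 then b else 0) * character k s)
    (fun k hk => by rw [hs k hk, zero_mul])
  rw [circleCurve_eq]
  simpa using this

/-- A continuous periodic function with absolutely summable coefficients is the sum of its
Fourier series. -/
theorem hasSum_coeff {f : ℝ → ℂ} (hf : Continuous f) (hp : Function.Periodic f (2 * Real.pi))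
    (hs : Summable fun k => ‖coeff f k‖) (s : ℝ) :
    HasSum (fun k => coeff f k * character k s) (f s) := by
  have := Fact.mk Real.two_pi_pos
  let g : C(AddCircle (2 * Real.pi), ℂ) := ⟨hp.lift, by
    exact continuous_coinduced_dom.mpr hf⟩
  have hg : ∀ x : ℝ, g x = f x := fun x => hp.lift_coe x
  have hc : ∀ k, fourierCoeff g k = coeff f k := fun k => by
    rw [fourierCoeff_eq_intervalIntegral _ _ 0, coeff, fourierCoeffOn_eq_integral, zero_add,
      sub_zero]
    simp only [hg]
  have h1 := has_pointwise_sum_fourier_series_of_summable (f := g)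
    (by simp only [funext hc]; exact hs.of_norm) (s : AddCircle (2 * Real.pi))
  rw [hg] at h1
  refine (hasSum_congr fun k => ?_).1 h1
  rw [hc, fourier_coe_apply, smul_eq_mul, character]
  congr 2
  have : (Real.pi : ℂ) ≠ 0 := by exact_mod_cast Real.pi_ne_zero
  push_cast
  field_simp

/-! ### The Wiener norm -/

theorem summable_of_wienerNorm {f : ℝ → ℂ} (h : wienerNorm f ≠ ∞) :
    Summable fun k : ℤ => |(k : ℝ)| * ‖coeff f k‖ := by
  have e : ∀ k : ℤ, ‖coeff f k‖ₑ * ENNReal.ofReal |(k : ℝ)|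
      = ENNReal.ofReal (|(k : ℝ)| * ‖coeff f k‖) := fun k => by
    rw [ENNReal.ofReal_mul (abs_nonneg _), ofReal_norm, mul_comm]
  simp only [wienerNorm, e] at h
  refine (ENNReal.summable_toReal h).congr fun k => ?_
  rw [ENNReal.toReal_ofReal (by positivity)]

theorem wienerNorm_eq {f : ℝ → ℂ} (h : Summable fun k : ℤ => |(k : ℝ)| * ‖coeff f k‖) :
    wienerNorm f = ENNReal.ofReal (∑' k : ℤ, |(k : ℝ)| * ‖coeff f k‖) := by
  rw [ENNReal.ofReal_tsum_of_nonneg (fun k => by positivity) h, wienerNorm]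
  refine tsum_congr fun k => ?_
  rw [ENNReal.ofReal_mul (abs_nonneg _), ofReal_norm, mul_comm]

theorem summable_norm_of_abs_mul {X : ℤ → ℂ} (h : Summable fun k : ℤ => |(k : ℝ)| * ‖X k‖) :
    Summable fun k => ‖X k‖ := by
  have h0 : Summable fun k : ℤ => if k = 0 then ‖X 0‖ else 0 :=
    summable_of_ne_finset_zero (s := {0}) fun n hn => by simp at hn; simp [hn]
  refine Summable.of_nonneg_of_le (fun _ => norm_nonneg _) (fun k => ?_) (h.add h0)
  split_ifs with hk
  · simp [hk]
  · have : (1 : ℝ) ≤ |(k : ℝ)| := by exact_mod_cast Int.one_le_abs hk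
    nlinarith [norm_nonneg (X k)]

theorem wienerNorm_le_of {f : ℝ → ℂ} {u : ℤ → ℝ} {C : ℝ} (hu : HasSum u C)
    (h : ∀ k : ℤ, |(k : ℝ)| * ‖coeff f k‖ ≤ u k) : wienerNorm f ≤ ENNReal.ofReal C := by
  have hs : Summable fun k : ℤ => |(k : ℝ)| * ‖coeff f k‖ :=
    Summable.of_nonneg_of_le (fun k => by positivity) h hu.summable
  rw [wienerNorm_eq hs]
  exact ENNReal.ofReal_le_ofReal ((hs.tsum_le_tsum h hu.summable).trans hu.tsum_eq.le)

/-- The tangent modes of a continuous periodic curve of small Wiener distance to a circle. -/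
theorem exists_isCurve {f : ℝ → ℂ} (hf : Continuous f) (hp : Function.Periodic f (2 * Real.pi))
    {ε : ℝ} (hε : 0 ≤ ε)
    (h : wienerNorm (fun s => f s - circleCurve 0 1 s) ≤ ENNReal.ofReal ε) :
    ∃ w : Fam ℤ ℂ, ‖w‖ ≤ ε ∧ IsCurve f w (coeff f) := by
  set g := fun s => f s - circleCurve 0 1 s with hg
  have hs := summable_of_wienerNorm (h.trans_lt ENNReal.ofReal_lt_top).ne
  have hgc : ∀ k, coeff g k = coeff f k - if k = 1 then 1 else 0 := fun k => by
    rw [hg, coeff_sub hf (continuous_circleCurve 0 1), coeff_circleCurve]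
    split_ifs with h0 h1 <;> simp_all
  have hs1 : Summable fun k => ‖coeff f k‖ := by
    have h1 : Summable fun k : ℤ => ‖(if k = 1 then 1 else 0 : ℂ)‖ :=
      summable_of_ne_finset_zero (s := {1}) fun n hn => by simp at hn; simp [hn]
    refine Summable.of_nonneg_of_le (fun _ => norm_nonneg _) (fun k => ?_)
      ((summable_norm_of_abs_mul hs).add h1)
    calc ‖coeff f k‖ = ‖coeff g k + if k = 1 then 1 else 0‖ := by rw [hgc, sub_add_cancel]
      _ ≤ _ := norm_add_le _ _
  have e : ∀ n : ℤ, ‖((n + 1 : ℤ) : ℂ) * coeff g (n + 1)‖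
      = |((n + 1 : ℤ) : ℝ)| * ‖coeff g (n + 1)‖ := fun n => by
    rw [norm_mul]
    congr 1
    rw [Complex.norm_intCast]
  have hsum := (Equiv.addRight (1 : ℤ)).summable_iff.2 hs
  refine ⟨Fam.mk (fun n => ((n + 1 : ℤ) : ℂ) * coeff g (n + 1)) ?_, ?_, fun s => ?_, fun n => ?_⟩
  · simp only [e]
    exact hsum
  · rw [Fam.norm_eq]
    simp only [Fam.mk_apply, e]
    rw [wienerNorm_eq hs] at h
    exact ((Equiv.addRight (1 : ℤ)).tsum_eq (fun k : ℤ => |(k : ℝ)| * ‖coeff g k‖)).trans_le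
      ((ENNReal.ofReal_le_ofReal_iff hε).1 h)
  · exact hasSum_coeff hf hp hs1 s
  · rw [Fam.mk_apply, hgc]
    by_cases hn : n = 0
    · simp [hn]
    · have : n + 1 ≠ 1 := by omega
      simp [hn]

/-! ### Curves which decay exponentially to a circle -/

theorem hasDerivAt_const_mul_character (a : ℂ) (k : ℤ) (s : ℝ) :
    HasDerivAt (fun s => a * character k s) (a * (Complex.I * k) * character k s) s := by
  have h1 : HasDerivAt (fun s : ℝ => Complex.I * (k * (s : ℂ))) (Complex.I * (k * 1)) s :=
    ((Complex.ofRealCLM.hasDerivAt (x := s)).const_mul (k : ℂ)).const_mul Complex.I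
  refine (h1.cexp.const_mul a).congr_deriv ?_
  rw [character]
  ring

theorem iteratedDeriv_const_mul_character (a : ℂ) (k : ℤ) (n : ℕ) :
    iteratedDeriv n (fun s => a * character k s)
      = fun s => a * (Complex.I * k) ^ n * character k s := by
  induction n with
  | zero => simp
  | succ n ih =>
    rw [iteratedDeriv_succ, ih]
    funext s
    rw [(hasDerivAt_const_mul_character _ k s).deriv]
    ring

theorem contDiff_const_mul_character (a : ℂ) (k : ℤ) (n : WithTop ℕ∞) :
    ContDiff ℝ n fun s => a * character k s := by
  unfold character
  have : ContDiff ℝ n fun s : ℝ => (s : ℂ) := Complex.ofRealCLM.contDiff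
  fun_prop

theorem contDiff_series {X : ℤ → ℂ} (h0 : Summable fun k => ‖X k‖) (N : ℕ)
    (hN : Summable fun k : ℤ => |(k : ℝ)| ^ N * ‖X k‖) :
    ContDiff ℝ N fun s => ∑' k, X k * character k s := by
  have hle : ∀ k : ℤ, ∀ n ≤ N, |(k : ℝ)| ^ n ≤ 1 + |(k : ℝ)| ^ N := by
    intro k n hn
    rcases le_total |(k : ℝ)| 1 with h | h
    · exact (pow_le_one₀ (abs_nonneg _) h).trans (by linarith [pow_nonneg (abs_nonneg (k : ℝ)) N])
    · exact (pow_le_pow_right₀ h hn).trans (by linarith)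
  refine contDiff_tsum (v := fun _ (k : ℤ) => (1 + |(k : ℝ)| ^ N) * ‖X k‖)
    (fun k => contDiff_const_mul_character _ k _) (fun _ _ => ?_) (fun n k s hn => ?_)
  · refine (h0.add hN).congr fun k => ?_
    ring
  · rw [norm_iteratedFDeriv_eq_norm_iteratedDeriv, iteratedDeriv_const_mul_character, norm_mul,
      norm_character, mul_one, norm_mul, norm_pow, norm_mul, Complex.norm_I, one_mul,
      Complex.norm_intCast, mul_comm]
    exact mul_le_mul_of_nonneg_right (hle k n (by exact_mod_cast hn)) (norm_nonneg _)

/-- The mode `k` of the curve is the tangent mode `k - 1`, and `|k| ≤ |k - 1| + 1 ≤ 2 max(|k - 1|,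
1)`. -/
theorem half_abs_le_modeRate (μ : ℝ≥0) (k : ℤ) : μ * (|(k : ℝ)| / 2) ≤ modeRate μ (k - 1) := by
  unfold modeRate
  refine mul_le_mul_of_nonneg_left ?_ μ.2
  have h1 := le_max_left |((k - 1 : ℤ) : ℝ)| 1
  have h2 := le_max_right |((k - 1 : ℤ) : ℝ)| 1
  have h3 := abs_sub_abs_le_abs_sub (k : ℝ) 1
  rw [abs_one] at h3
  push_cast at *
  linarith

theorem le_modeRate (μ : ℝ≥0) (n : ℤ) : (μ : ℝ) ≤ modeRate μ n :=
  le_mul_of_one_le_right μ.2 (le_max_right _ _)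

/-- The modes of the decaying part. -/
def decayMode (μ : ℝ≥0) (h : Fam ℤ Path) (t : ℝ≥0) (k : ℤ) : ℂ :=
  (Real.exp (-modeRate μ (k - 1) * t) : ℂ) * h k t

/-- A curve which decays to a circle. -/
def decayCurve (μ : ℝ≥0) (p q : ℂ) (h : Fam ℤ Path) (t : ℝ≥0) (s : ℝ) : ℂ :=
  circleCurve p q s + ∑' k, decayMode μ h t k * character k s

section

variable (μ t : ℝ≥0) (p q : ℂ) (h : Fam ℤ Path)

theorem norm_decayMode_le (k : ℤ) :
    ‖decayMode μ h t k‖ ≤ Real.exp (-modeRate μ (k - 1) * t) * ‖h k‖ := by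
  rw [decayMode, norm_mul, Complex.norm_real, Real.norm_eq_abs, Real.abs_exp]
  exact mul_le_mul_of_nonneg_left ((h k).norm_coe_le_norm t) (Real.exp_pos _).le

theorem norm_decayMode_le_exp (k : ℤ) :
    ‖decayMode μ h t k‖ ≤ Real.exp (-(μ : ℝ) * t) * ‖h k‖ := by
  refine (norm_decayMode_le μ t h k).trans (mul_le_mul_of_nonneg_right ?_ (norm_nonneg _))
  rw [Real.exp_le_exp]
  nlinarith [le_modeRate μ (k - 1), t.2, mul_le_mul_of_nonneg_right (le_modeRate μ (k - 1)) t.2]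

theorem norm_decayMode_le_norm (k : ℤ) : ‖decayMode μ h t k‖ ≤ ‖h k‖ := by
  refine (norm_decayMode_le_exp μ t h k).trans (mul_le_of_le_one_left (norm_nonneg _) ?_)
  rw [Real.exp_le_one_iff]
  nlinarith [μ.2, t.2, mul_nonneg μ.2 t.2]

theorem summable_decayMode : Summable fun k => ‖decayMode μ h t k‖ :=
  Summable.of_nonneg_of_le (fun _ => norm_nonneg _) (norm_decayMode_le_norm μ t h) (Fam.summable_norm h)

/-- The modes of the limit circle. -/
def circleMode (k : ℤ) : ℂ := if k = 0 then p else if k = 1 then q else 0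

theorem circleMode_eq_zero {k : ℤ} (hk : k ∉ ({0, 1} : Finset ℤ)) : circleMode p q k = 0 := by
  simp only [Finset.mem_insert, Finset.mem_singleton, not_or] at hk
  rw [circleMode, if_neg hk.1, if_neg hk.2]

theorem summable_circleMode : Summable fun k => ‖circleMode p q k‖ :=
  summable_of_ne_finset_zero (s := {0, 1}) fun k hk => by
    rw [circleMode_eq_zero p q hk, norm_zero]

theorem summable_modes : Summable fun k => ‖circleMode p q k + decayMode μ h t k‖ :=
  Summable.of_nonneg_of_le (fun _ => norm_nonneg _) (fun _ => norm_add_le _ _)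
    ((summable_circleMode p q).add (summable_decayMode μ t h))

theorem hasSum_circleMode (s : ℝ) :
    HasSum (fun k => circleMode p q k * character k s) (circleCurve p q s) := by
  have := hasSum_sum_of_ne_finset_zero (L := .unconditional ℤ) (s := ({0, 1} : Finset ℤ))
    (f := fun k => circleMode p q k * character k s)
    (fun k hk => by rw [circleMode_eq_zero p q hk, zero_mul])
  rw [circleCurve_eq]
  simpa [circleMode] using this

theorem hasSum_decayMode (s : ℝ) : HasSum (fun k => decayMode μ h t k * character k s)
    (∑' k, decayMode μ h t k * character k s) := by
  refine (Summable.of_norm ((summable_decayMode μ t h).congr fun k => ?_)).hasSum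
  rw [norm_mul, norm_character, mul_one]

theorem hasSum_decayCurve (s : ℝ) :
    HasSum (fun k => (circleMode p q k + decayMode μ h t k) * character k s)
      (decayCurve μ p q h t s) :=
  (hasSum_congr fun _ => (add_mul _ _ _).symm).1
    ((hasSum_circleMode p q s).add (hasSum_decayMode μ t h s))

theorem coeff_decayCurve (k : ℤ) :
    coeff (decayCurve μ p q h t) k = circleMode p q k + decayMode μ h t k :=
  coeff_eq_of_hasSum (summable_modes μ t p q h) (hasSum_decayCurve μ t p q h) k

theorem contDiff_decayCurve (N : ℕ)
    (hN : Summable fun k : ℤ => |(k : ℝ)| ^ N * ‖decayMode μ h t k‖) :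
    ContDiff ℝ N (decayCurve μ p q h t) := by
  have h1 : ContDiff ℝ N (circleCurve p q) := by
    have h2 := (contDiff_const_mul_character p 0 N).add (contDiff_const_mul_character q 1 N)
    rw [funext (circleCurve_eq p q)]
    exact h2
  exact h1.add (contDiff_series (summable_decayMode μ t h) N hN)

theorem continuous_decayCurve :
    Continuous fun x : ℝ × ℝ => decayCurve μ p q h x.1.toNNReal x.2 := by
  have h1 := continuous_circleCurve p q
  have h2 : Continuous fun x : ℝ × ℝ =>
      ∑' k, decayMode μ h x.1.toNNReal k * character k x.2 := by
    refine continuous_tsum (fun k => ?_) (Fam.summable_norm h) (fun k x => ?_)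
    · have h3 := (h k).continuous
      have h4 := continuous_character k
      unfold decayMode
      fun_prop
    · rw [norm_mul, norm_character, mul_one]
      exact norm_decayMode_le_norm μ _ h k
  unfold decayCurve
  fun_prop

theorem decayCurve_periodic : Function.Periodic (decayCurve μ p q h t) (2 * Real.pi) := fun s => by
  simp only [decayCurve, circleCurve_eq, character_periodic _ s]

theorem norm_decayCurve_sub_le (s : ℝ) :
    ‖decayCurve μ p q h t s - circleCurve p q s‖ ≤ Real.exp (-(μ : ℝ) * t) * ‖h‖ := by
  rw [decayCurve, add_sub_cancel_left, Fam.norm_eq, ← tsum_mul_left]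
  refine tsum_of_norm_bounded ((Fam.summable_norm h).mul_left _).hasSum fun k => ?_
  rw [norm_mul, norm_character, mul_one]
  exact norm_decayMode_le_exp μ t h k

theorem continuous_decayCurve_right : Continuous (decayCurve μ p q h t) := by
  have := (continuous_decayCurve μ p q h).comp (Continuous.prodMk_right (t : ℝ))
  simpa [Function.comp_def] using this

theorem wienerNorm_decayCurve_sub_le {u : ℤ → ℝ} {M : ℝ} (hM : HasSum u M)
    (hu : ∀ k : ℤ, |(k : ℝ)| * ‖h k‖ ≤ u k) :
    wienerNorm (fun s => decayCurve μ p q h t s - circleCurve p q s)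
      ≤ ENNReal.ofReal (Real.exp (-(μ : ℝ) * t) * M) := by
  refine wienerNorm_le_of (hM.mul_left _) fun k => ?_
  rw [coeff_sub (continuous_decayCurve_right μ t p q h) (continuous_circleCurve p q),
    coeff_circleCurve, coeff_decayCurve]
  change |(k : ℝ)| * ‖circleMode p q k + decayMode μ h t k - circleMode p q k‖ ≤ _
  rw [add_sub_cancel_left]
  refine (mul_le_mul_of_nonneg_left (norm_decayMode_le_exp μ t h k) (abs_nonneg _)).trans ?_
  rw [mul_left_comm]
  exact mul_le_mul_of_nonneg_left (hu k) (Real.exp_pos _).le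

theorem tendsto_decayMode (hμ : 0 < μ) (k : ℤ) :
    Tendsto (fun t : ℝ => decayMode μ h t.toNNReal k) atTop (𝓝 0) := by
  have h1 : Tendsto (fun t : ℝ => Real.exp (-(μ : ℝ) * t) * ‖h k‖) atTop (𝓝 0) := by
    have h2 : Tendsto (fun t : ℝ => -(μ : ℝ) * t) atTop atBot :=
      tendsto_id.const_mul_atTop_of_neg (neg_lt_zero.2 hμ)
    simpa using (Real.tendsto_exp_atBot.comp h2).mul_const ‖h k‖
  refine squeeze_zero_norm' ?_ h1
  filter_upwards [eventually_ge_atTop 0] with t ht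
  have := norm_decayMode_le_exp μ t.toNNReal h k
  rwa [Real.coe_toNNReal t ht] at this

theorem exp_mul_le {x y : ℝ} (hx : 0 < x) (hy : 0 ≤ y) : Real.exp (-(x * y)) * (1 + y) ≤ 1 + 1 / x := by
  have h1 := Real.add_one_le_exp (x * y)
  have h2 : 1 ≤ Real.exp (x * y) := Real.one_le_exp (by positivity)
  have h3 : Real.exp (-(x * y)) * Real.exp (x * y) = 1 := by rw [← Real.exp_add]; simp
  have h4 : 1 + y ≤ (1 + 1 / x) * Real.exp (x * y) := by
    have : y ≤ 1 / x * Real.exp (x * y) := by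
      rw [div_mul_eq_mul_div, one_mul, le_div_iff₀ hx]
      linarith
    linarith
  calc _ ≤ Real.exp (-(x * y)) * ((1 + 1 / x) * Real.exp (x * y)) :=
        mul_le_mul_of_nonneg_left h4 (Real.exp_pos _).le
    _ = (1 + 1 / x) * (Real.exp (-(x * y)) * Real.exp (x * y)) := by ring
    _ = _ := by rw [h3, mul_one]

theorem exp_modeRate_mul_le (hμ : 0 < μ) (k : ℤ) :
    Real.exp (-modeRate μ (k - 1) * t) * (1 + |(k : ℝ)| * t) ≤ 1 + 2 / μ := by
  have hμ' : (0 : ℝ) < μ / 2 := by have : (0 : ℝ) < μ := hμ; positivity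
  have h := exp_mul_le hμ' (show 0 ≤ |(k : ℝ)| * t by positivity)
  rw [one_div_div] at h
  refine le_trans (mul_le_mul_of_nonneg_right ?_ (by positivity)) h
  rw [Real.exp_le_exp]
  have := mul_le_mul_of_nonneg_right (half_abs_le_modeRate μ k) t.2
  change (μ : ℝ) * (|(k : ℝ)| / 2) * (t : ℝ) ≤ modeRate μ (k - 1) * t at this
  linarith

/-- The exponential weight absorbs a full factor `1 + |k|t`, more than the power `2/3` in the
space-time norm. The same factor gives one more derivative at positive times. -/
theorem decayMode_weight_le (hμ : 0 < μ) (k : ℤ) :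
    ‖decayMode μ h t k‖ * (1 + |(k : ℝ)| * t) ≤ (1 + 2 / μ) * ‖h k‖ := by
  refine (mul_le_mul_of_nonneg_right (norm_decayMode_le μ t h k) (by positivity)).trans ?_
  rw [mul_right_comm]
  exact mul_le_mul_of_nonneg_right (exp_modeRate_mul_le μ t hμ k) (norm_nonneg _)

/-- One power of `|k|` comes from the summability of the tangent modes, the other from the
exponential weight at the price of `1/t`. -/
theorem summable_sq_decayMode (hμ : 0 < μ) (ht : 0 < t)
    (hM : Summable fun k : ℤ => |(k : ℝ)| * ‖h k‖) :
    Summable fun k : ℤ => |(k : ℝ)| ^ 2 * ‖decayMode μ h t k‖ := by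
  have ht' : (0 : ℝ) < t := ht
  refine Summable.of_nonneg_of_le (fun _ => by positivity) (fun k => ?_)
    (hM.mul_left ((1 + 2 / (μ : ℝ)) / t))
  have h1 := decayMode_weight_le μ t h hμ k
  have h2 : ‖decayMode μ h t k‖ * (|(k : ℝ)| * t) ≤ (1 + 2 / μ) * ‖h k‖ := by
    nlinarith [norm_nonneg (decayMode μ h t k)]
  rw [div_mul_eq_mul_div, le_div_iff₀ ht']
  calc |(k : ℝ)| ^ 2 * ‖decayMode μ h t k‖ * t
      = |(k : ℝ)| * (‖decayMode μ h t k‖ * (|(k : ℝ)| * t)) := by ring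
    _ ≤ |(k : ℝ)| * ((1 + 2 / μ) * ‖h k‖) := mul_le_mul_of_nonneg_left h2 (abs_nonneg _)
    _ = _ := by ring

end

/-- The decaying part without the modes `0` and `1` is bounded in the space-time norm. -/
theorem wNorm_le {μ : ℝ≥0} (hμ : 0 < μ) {h : Fam ℤ Path} {M : ℝ} {u : ℤ → ℝ}
    (hM : HasSum u M) {Y : ℝ → ℝ → ℂ} (hu0 : ∀ k, 0 ≤ u k)
    (hu : ∀ k : ℤ, k ≠ 0 → k ≠ 1 → |(k : ℝ)| * ‖h k‖ ≤ u k)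
    (hY : ∀ t, 0 ≤ t → ∀ k, coeff (Y t) k =
      if k = 0 ∨ k = 1 then 0 else decayMode μ h t.toNNReal k) :
    wNorm Y ≤ ENNReal.ofReal ((2 + 2 / μ) * M) := by
  have hM0 : 0 ≤ M := hM.nonneg hu0
  have e : (2 + 2 / (μ : ℝ)) * M = M + (1 + 2 / (μ : ℝ)) * M := by ring
  have hμ' : (0 : ℝ) < μ := hμ
  rw [e, ENNReal.ofReal_add hM0 (by positivity), wNorm]
  refine add_le_add (iSup₂_le fun t ht => wienerNorm_le_of hM fun k => ?_)
    (iSup₂_le fun t ht => iSup_le fun m => ?_)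
  · rw [hY t ht]
    split_ifs with hk
    · rw [norm_zero, mul_zero]; exact hu0 k
    · rw [not_or] at hk
      exact (mul_le_mul_of_nonneg_left (norm_decayMode_le_norm μ _ h k) (abs_nonneg _)).trans
        (hu k hk.1 hk.2)
  -- The sum over a dyadic block is bounded by the sum over all frequencies.
  · refine (ENNReal.tsum_comp_le_tsum_of_injective (f := ((↑) : dyadicBlock m → ℤ))
      Subtype.coe_injective (fun k : ℤ => ‖coeff (Y t) k‖ₑ *
        ENNReal.ofReal (|(k : ℝ)| * (1 + |(k : ℝ)| * t) ^ (2 / 3 : ℝ)))).trans ?_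
    have hM' := hM.mul_left (1 + 2 / (μ : ℝ))
    rw [← hM'.tsum_eq, ENNReal.ofReal_tsum_of_nonneg
      (fun k => mul_nonneg (by positivity) (hu0 k)) hM'.summable]
    refine ENNReal.tsum_le_tsum fun k => ?_
    rw [hY t ht, ← ofReal_norm, ← ENNReal.ofReal_mul (norm_nonneg _)]
    refine ENNReal.ofReal_le_ofReal ?_
    split_ifs with hk
    · rw [norm_zero, zero_mul]
      exact mul_nonneg (by positivity) (hu0 k)
    · rw [not_or] at hk
      have ht' : (0 : ℝ) ≤ t := ht
      have h1 : (1 : ℝ) ≤ 1 + |(k : ℝ)| * t := by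
        have : 0 ≤ |(k : ℝ)| * t := by positivity
        linarith
      have h2 : (1 + |(k : ℝ)| * t) ^ (2 / 3 : ℝ) ≤ 1 + |(k : ℝ)| * t := by
        calc _ ≤ (1 + |(k : ℝ)| * t) ^ (1 : ℝ) :=
              Real.rpow_le_rpow_of_exponent_le h1 (by norm_num)
          _ = _ := Real.rpow_one _
      have h3 := decayMode_weight_le μ t.toNNReal h hμ k
      rw [Real.coe_toNNReal t ht'] at h3
      calc ‖decayMode μ h t.toNNReal k‖ * (|(k : ℝ)| * (1 + |(k : ℝ)| * t) ^ (2 / 3 : ℝ))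
          ≤ ‖decayMode μ h t.toNNReal k‖ * (|(k : ℝ)| * (1 + |(k : ℝ)| * t)) := by gcongr
        _ = |(k : ℝ)| * (‖decayMode μ h t.toNNReal k‖ * (1 + |(k : ℝ)| * t)) := by ring
        _ ≤ |(k : ℝ)| * ((1 + 2 / μ) * ‖h k‖) := mul_le_mul_of_nonneg_left h3 (abs_nonneg _)
        _ = (1 + 2 / μ) * (|(k : ℝ)| * ‖h k‖) := by ring
        _ ≤ _ := mul_le_mul_of_nonneg_left (hu k hk.1 hk.2) (by positivity)

/-! ### Existence -/

theorem hasDerivAt_exp_mul_ext {f : Path} {d : ℂ} {t : ℝ} (h : HasDerivAt f.ext d t)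
    (ρ : ℝ) : HasDerivAt (fun s : ℝ => (Real.exp (-ρ * s) : ℂ) * f.ext s)
      ((Real.exp (-ρ * t) : ℂ) * (d - ρ * f t.toNNReal)) t := by
  have h1 : HasDerivAt (fun s : ℝ => (Real.exp (-ρ * s) : ℂ)) ((Real.exp (-ρ * t) * -ρ : ℝ) : ℂ) t := by
    have : HasDerivAt (fun t : ℝ => Real.exp (-ρ * t)) (Real.exp (-ρ * t) * -ρ) t := by
      simpa using ((hasDerivAt_id t).const_mul (-ρ)).exp
    exact this.ofReal_comp
  refine (h1.mul h).congr_deriv ?_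
  rw [Path.ext]
  push_cast
  ring

/-- The modes of the curve with given tangent modes and given zeroth mode. -/
def curveModes (H : Path) (g : Fam ℤ Path) : Fam ℤ Path :=
  Fam.mk (fun k => if k = 0 then H else (k : ℝ)⁻¹ • g (k - 1)) <| by
    have h0 : Summable fun k : ℤ => if k = 0 then ‖H‖ else 0 :=
      summable_of_ne_finset_zero (s := {0}) fun n hn => by simp at hn; simp [hn]
    have h1 : Summable fun k : ℤ => ‖g (k - 1)‖ :=
      (Equiv.subRight (1 : ℤ)).summable_iff (f := fun k => ‖g k‖) |>.2 (Fam.summable_norm g)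
    refine Summable.of_nonneg_of_le (fun _ => norm_nonneg _) (fun k => ?_) (h0.add h1)
    split_ifs with hk
    · linarith [norm_nonneg (g (k - 1))]
    · rw [norm_smul, zero_add]
      refine mul_le_of_le_one_left (norm_nonneg _) ?_
      rw [norm_inv]
      refine inv_le_one_of_one_le₀ ?_
      rw [Real.norm_eq_abs]
      exact_mod_cast Int.one_le_abs hk

section

variable (H : Path) (g : Fam ℤ Path)

theorem curveModes_zero : curveModes H g 0 = H := by
  rw [curveModes, Fam.mk_apply, if_pos rfl]

theorem curveModes_of_ne {k : ℤ} (hk : k ≠ 0) : curveModes H g k = (k : ℝ)⁻¹ • g (k - 1) := by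
  rw [curveModes, Fam.mk_apply, if_neg hk]

theorem hasSum_norm_shift : HasSum (fun k : ℤ => ‖g (k - 1)‖) ‖g‖ := by
  rw [Fam.norm_eq]
  exact (Equiv.subRight (1 : ℤ)).hasSum_iff (f := fun k => ‖g k‖) |>.2 (Fam.summable_norm g).hasSum

theorem abs_mul_norm_curveModes (k : ℤ) : |(k : ℝ)| * ‖curveModes H g k‖ ≤ ‖g (k - 1)‖ := by
  rcases eq_or_ne k 0 with rfl | hk
  · simp
  · have : |(k : ℝ)| ≠ 0 := by simpa using hk
    rw [curveModes_of_ne H g hk, norm_smul, norm_inv, Real.norm_eq_abs, mul_inv_cancel_left₀ this]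

theorem norm_curveModes_le : ‖curveModes H g‖ ≤ ‖H‖ + ‖g‖ := by
  have h0 : HasSum (fun k : ℤ => if k = 0 then ‖H‖ else 0) ‖H‖ := hasSum_ite_eq 0 _
  rw [Fam.norm_eq]
  refine hasSum_le (fun k => ?_) (Fam.summable_norm _).hasSum (h0.add (hasSum_norm_shift g))
  rcases eq_or_ne k 0 with rfl | hk
  · rw [if_pos rfl, curveModes_zero]
    linarith [norm_nonneg (g (0 - 1))]
  · rw [if_neg hk, zero_add]
    refine le_trans (le_mul_of_one_le_left (norm_nonneg _) ?_) (abs_mul_norm_curveModes H g k)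
    exact_mod_cast Int.one_le_abs hk

end

/-- The vanishing of the mode `-1` is a compatibility condition: this tangent mode corresponds to
the constant mode of the curve, which differentiation kills. The constant mode is therefore free,
namely `p` plus the decaying path `H`. -/
theorem isCurve_decayCurve (μ t : ℝ≥0) (p : ℂ) (H : Path) {z : State} (hz : z.2 (-1) = 0) :
    IsCurve (decayCurve μ p (1 + z.1) (curveModes H z.2) t) (stateEval μ t z)
      (fun k => circleMode p (1 + z.1) k + decayMode μ (curveModes H z.2) t k) where
  hasSum s := hasSum_decayCurve μ t p (1 + z.1) _ s
  coeff n := by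
    rw [stateEval_apply]
    by_cases hn : n + 1 = 0
    · obtain rfl : n = -1 := by omega
      simp [hz]
    · have h1 : ((n : ℂ) + 1) ≠ 0 := by exact_mod_cast hn
      rw [decayMode, curveModes_of_ne _ _ hn, add_sub_cancel_right,
        BoundedContinuousFunction.smul_apply, Complex.real_smul, circleMode, if_neg hn]
      by_cases h0 : n = 0
      · subst h0
        simp
        ring
      · rw [if_neg (show ¬ n + 1 = 1 by omega), if_neg h0, if_neg h0]
        push_cast
        field_simp
        ring

/-- For `k ≠ 0` the derivative of the tangent mode is divided by `k`. For `k = 0` the weight is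
`e^{-μt}`, and the term `μ H` in the equation for `H` cancels its derivative. -/
theorem hasDerivAt_decayMode {μ : ℝ≥0} {G H : Path} {g : Fam ℤ Path} (k : ℤ) {b : ℂ} {t : ℝ}
    (ht : 0 < t) (hH : HasDerivAt H.ext (μ * H.ext t - 1 / 8 * G.ext t) t)
    (hg : k ≠ 0 → HasDerivAt (fun s : ℝ => (Real.exp (-modeRate μ (k - 1) * s) : ℂ)
      * g (k - 1) s.toNNReal) (k * b) t)
    (hb : k = 0 → b = -1 / 8 * (Real.exp (-modeRate μ (-1) * t) * G.ext t)) :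
    HasDerivAt (fun s : ℝ => decayMode μ (curveModes H g) s.toNNReal k) b t := by
  have e : (fun s : ℝ => decayMode μ (curveModes H g) s.toNNReal k) =ᶠ[𝓝 t] fun s =>
      (Real.exp (-modeRate μ (k - 1) * s) : ℂ) * curveModes H g k s.toNNReal := by
    filter_upwards [lt_mem_nhds ht] with s hs
    rw [decayMode, Real.coe_toNNReal s hs.le]
  refine HasDerivAt.congr_of_eventuallyEq ?_ e
  rcases eq_or_ne k 0 with rfl | hk
  · rw [curveModes_zero]
    refine (hasDerivAt_exp_mul_ext hH (modeRate μ (0 - 1))).congr_deriv ?_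
    have h1 : modeRate μ (-1) = μ := by simp [modeRate]
    rw [hb rfl, zero_sub, h1]
    simp only [Path.ext]
    ring
  · have hk' : (k : ℂ) ≠ 0 := by exact_mod_cast hk
    refine (((hg hk).const_mul (k : ℂ)⁻¹).congr_of_eventuallyEq
      (Eventually.of_forall fun s => ?_)).congr_deriv (by field_simp)
    simp only [curveModes_of_ne H g hk, BoundedContinuousFunction.smul_apply, Complex.real_smul]
    push_cast
    ring

/-- Termwise differentiation: the derivatives of the modes are dominated by `‖G (k - 1)‖`, summable
and independent of time. -/
theorem hasDerivAt_decayCurve {μ : ℝ≥0} {h G : Fam ℤ Path} (p q : ℂ)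
    (hmode : ∀ (t : ℝ), 0 < t → ∀ k, HasDerivAt (fun s : ℝ => decayMode μ h s.toNNReal k)
      (-1 / 8 * famEval μ t.toNNReal G (k - 1)) t) {t : ℝ} (ht : 0 < t) (s : ℝ) :
    HasDerivAt (fun t' : ℝ => decayCurve μ p q h t'.toNNReal s)
      (-1 / 8 * Complex.exp (Complex.I * s) * fourierSum s (famEval μ t.toNNReal G)) t := by
  have hd : HasDerivAt (fun t' : ℝ => ∑' k, decayMode μ h t'.toNNReal k * character k s)
      (∑' k, -1 / 8 * famEval μ t.toNNReal G (k - 1) * character k s) t := by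
    have hs0 : Summable fun k => decayMode μ h t.toNNReal k * character k s :=
      (hasSum_decayMode μ _ h s).summable
    have hu : Summable fun k : ℤ => ‖G (k - 1)‖ := (hasSum_norm_shift G).summable
    refine hasDerivAt_tsum_of_isPreconnected (𝕜 := ℝ) (t := Ioi (0 : ℝ)) (y₀ := t) (y := t)
      (u := fun k => ‖G (k - 1)‖)
      (g := fun k t' => decayMode μ h t'.toNNReal k * character k s)
      (g' := fun k t' => -1 / 8 * famEval μ t'.toNNReal G (k - 1) * character k s)
      hu isOpen_Ioi isPreconnected_Ioi (fun k y hy => ?_) (fun k y hy => ?_) ht hs0 ht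
    · exact (hmode y hy k).mul_const _
    · rw [norm_mul, norm_character, mul_one, norm_mul, famEval_apply, norm_mul,
        Complex.norm_real, Real.norm_eq_abs, Real.abs_exp]
      have h1 : ‖(-1 / 8 : ℂ)‖ ≤ 1 := by norm_num
      have h2 : Real.exp (-modeRate μ (k - 1) * y.toNNReal) ≤ 1 := by
        rw [Real.exp_le_one_iff, neg_mul]
        exact neg_nonpos.2 (mul_nonneg (modeRate_nonneg μ (k - 1)) y.toNNReal.2)
      refine (mul_le_of_le_one_left (by positivity) h1).trans ?_
      exact (mul_le_of_le_one_left (norm_nonneg _) h2).trans ((G (k - 1)).norm_coe_le_norm _)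
  refine (hd.const_add (circleCurve p q s)).congr_deriv ?_
  have h1 := (hasSum_fourierSum s (famEval μ t.toNNReal G)).mul_left
    (-1 / 8 * Complex.exp (Complex.I * s))
  refine HasSum.tsum_eq ((Equiv.addRight (1 : ℤ)).hasSum_iff.1 ((hasSum_congr fun n => ?_).1 h1))
  simp only [Function.comp_apply, Equiv.coe_addRight]
  rw [add_sub_cancel_right, ← character_mul, character_one, character]
  ring

/-- The tangent mode `k - 1` is `k` times the mode `k` of the difference with the unit circle, so
passing between curve and tangent costs no constant. -/
theorem IsCurve.wienerNorm_sub_le {f : ℝ → ℂ} {v : Fam ℤ ℂ} {x : ℤ → ℂ} (h : IsCurve f v x)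
    (hf : Continuous f) (hx : ∀ k, Peskin.coeff f k = x k) :
    wienerNorm (fun s => f s - circleCurve 0 1 s) ≤ ENNReal.ofReal ‖v‖ := by
  have hs : HasSum (fun k : ℤ => ‖v (k - 1)‖) ‖v‖ := by
    rw [Fam.norm_eq]
    exact (Equiv.subRight (1 : ℤ)).hasSum_iff (f := fun k => ‖v k‖) |>.2 (Fam.summable_norm v).hasSum
  refine wienerNorm_le_of hs fun k => ?_
  rw [coeff_sub hf (continuous_circleCurve _ _), coeff_circleCurve, hx]
  have h1 := h.coeff (k - 1)
  rw [sub_add_cancel] at h1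
  push_cast at h1
  rw [sub_add_cancel] at h1
  have h2 : v (k - 1) = k * (x k - if k = 0 then 0 else if k = 1 then 1 else 0) := by
    rw [mul_sub, h1]
    by_cases h0 : k = 0
    · simp [h0]
    · by_cases h1 : k = 1
      · simp [h1]
      · simp [h0, h1, show ¬ k - 1 = 0 by omega]
  rw [h2, norm_mul, Complex.norm_intCast]

/-- The nonlinearity depends on the tangent alone. The tangent modes are solved first, by
`exists_state`, and the centre `a₀` is recovered by integrating a decaying source. -/
theorem exists_solution {τ : ℝ → ℝ} {c : ℕ → ℝ} {K a : ℝ} (hc : IsExpansion τ c K a) :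
    ∃ C > (0 : ℝ), ∃ κ > (0 : ℝ), ∃ ε₀ > (0 : ℝ), ∀ ε : ℝ, 0 < ε → ε ≤ ε₀ →
      ∀ X₀ : ℝ → ℂ, Continuous X₀ → Function.Periodic X₀ (2 * Real.pi) →
        wienerNorm (fun s => X₀ s - circleCurve 0 1 s) ≤ ENNReal.ofReal ε →
        ∃ X : ℝ → ℝ → ℂ, IsSolution τ X₀ X ∧ (∀ t, 0 < t → ContDiff ℝ 2 (X t)) ∧
          (∀ t, 0 ≤ t →
            wienerNorm (fun s => X t s - circleCurve 0 1 s) ≤ ENNReal.ofReal (C * ε)) ∧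
          ∃ (a₀ a₁ : ℝ → ℂ) (Y : ℝ → ℝ → ℂ), HasDecomposition X a₀ a₁ Y ∧
            wNorm Y ≤ ENNReal.ofReal (C * ε) ∧
            ∃ a₀lim a₁lim : ℂ, a₁lim ≠ 0 ∧
              Tendsto a₀ atTop (𝓝 a₀lim) ∧ Tendsto a₁ atTop (𝓝 a₁lim) ∧
              ∀ t, 0 ≤ t →
                (∀ s, ‖X t s - circleCurve a₀lim a₁lim s‖ ≤ C * Real.exp (-κ * t)) ∧
                wienerNorm (fun s => X t s - circleCurve a₀lim a₁lim s) ≤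
                  ENNReal.ofReal (C * Real.exp (-κ * t)) := by
  obtain ⟨μ, hμ, C, hC, ε₁, hε₁, hex⟩ := exists_state hc
  have hμ' : (0 : ℝ) < μ := hμ
  obtain ⟨A, hA⟩ := exists_isDuhamel_of_neg (neg_lt_zero.2 hμ')
  rw [neg_neg] at hA
  -- The bound `ε ≤ 1` makes the decay constants independent of `ε`; the bound `1 / (2C)` gives
  -- `‖z.1‖ ≤ 1/2`, so that the limit `1 + z.1` of `a₁` is not zero.
  refine ⟨(2 + 2 / μ) * C, by positivity, μ, hμ', min ε₁ (min 1 (1 / (2 * C))), by positivity,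
    fun ε hε hεle X₀ hX₀ hper hX₀ε => ?_⟩
  have hεC : C * ε ≤ 1 / 2 := by
    have := (hεle.trans (min_le_right _ _)).trans (min_le_right _ _)
    rw [le_div_iff₀ (by positivity)] at this
    linarith
  have hε1 : ε ≤ 1 := (hεle.trans (min_le_right _ _)).trans (min_le_left _ _)
  obtain ⟨w, hwε, hw⟩ := exists_isCurve hX₀ hper hε.le hX₀ε
  have hw1 : w (-1) = 0 := by
    have := hw.coeff (-1)
    simpa using this.symm
  obtain ⟨z, hz, hz0, hz1, hreg, G, hG, hrhs, hode⟩ := hex w hw1 (hwε.trans (hεle.trans (min_le_left _ _)))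
  replace hz : ‖z‖ ≤ C * ε := hz.trans (mul_le_mul_of_nonneg_left hwε hC.le)
  replace hG : ‖G‖ ≤ C * ε := hG.trans (mul_le_mul_of_nonneg_left hwε hC.le)
  -- Integrating the source of the constant mode from infinity makes its time-dependent part
  -- `e^{-μt} H` decay; the constant `p` below then restores the initial value.
  set H : Path := A ((-1 / 8 : ℝ) • (G (-1) : Path)) with hHdef
  have hH : ∀ t, 0 < t → HasDerivAt H.ext (μ * H.ext t - 1 / 8 * (G (-1)).ext t) t := by
    intro t ht
    refine (hA.hasDerivAt _ t ht).congr_deriv ?_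
    have : ((-1 / 8 : ℝ) • G (-1)).ext t = ((-1 / 8 : ℝ) : ℂ) * (G (-1)).ext t := rfl
    rw [this, ← hHdef]
    push_cast
    ring
  have hHn : ‖H‖ ≤ C * ε / μ := by
    refine (A.le_of_opNorm_le hA.norm_le _).trans ?_
    rw [norm_smul, div_eq_inv_mul (C * ε)]
    refine mul_le_mul_of_nonneg_left ?_ (inv_nonneg.2 hμ'.le)
    have h1 : ‖(-1 / 8 : ℝ)‖ ≤ 1 := by rw [Real.norm_eq_abs, abs_le]; norm_num
    exact (mul_le_of_le_one_left (norm_nonneg _) h1).trans ((Fam.norm_apply_le G _).trans hG)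
  set h := curveModes H z.2 with hh
  set p := coeff X₀ 0 - H 0 with hp
  set q := 1 + z.1 with hq
  have hcurve := fun t => isCurve_decayCurve μ t p H hz1
  have hz2 : ‖z.2‖ ≤ C * ε := (norm_snd_le z).trans hz
  have hu := abs_mul_norm_curveModes H z.2
  have hsum := hasSum_norm_shift z.2
  have hM : Summable fun k : ℤ => |(k : ℝ)| * ‖h k‖ :=
    Summable.of_nonneg_of_le (fun k => by positivity) hu hsum.summable
  have hmode : ∀ (t : ℝ), 0 < t → ∀ k, HasDerivAt (fun s : ℝ => decayMode μ h s.toNNReal k)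
      (-1 / 8 * famEval μ t.toNNReal G (k - 1)) t := by
    intro t ht k
    refine hasDerivAt_decayMode (G := G (-1)) k ht (hH t ht) (fun hk => ?_) fun hk => ?_
    · have h1 := (hode (k - 1) t ht).sub_const (if k - 1 = 0 then z.1 else 0)
      refine (h1.congr_of_eventuallyEq ?_).congr_deriv (by push_cast; ring)
      filter_upwards [lt_mem_nhds ht] with s hs
      rw [stateEval_apply, Real.coe_toNNReal s hs.le]
      ring
    · rw [hk, zero_sub, famEval_apply, Real.coe_toNNReal t ht.le]
      rfl
  refine ⟨fun t s => decayCurve μ p q h t.toNNReal s, ?_, ?_, fun t _ => ?_, ?_⟩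
  · refine ⟨fun t _ => decayCurve_periodic μ _ p q h, fun t _ => ?_,
      (continuous_decayCurve μ p q h).continuousOn, fun s => ?_, fun t ht s => ?_⟩
    · refine contDiff_decayCurve μ _ p q h 1 ?_
      refine Summable.of_nonneg_of_le (fun k => by positivity) (fun k => ?_) hM
      rw [pow_one]
      exact mul_le_mul_of_nonneg_left (norm_decayMode_le_norm μ _ h k) (abs_nonneg _)
    · rw [Real.toNNReal_zero]
      refine HasSum.unique ((hasSum_congr fun k => ?_).1 ((hcurve 0).hasSum s)) (hw.hasSum s)
      congr 1
      rcases eq_or_ne k 0 with rfl | hk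
      · simp only [circleMode, if_true, decayMode, NNReal.coe_zero, mul_zero, Real.exp_zero,
          Complex.ofReal_one, one_mul, curveModes_zero, hp, sub_add_cancel]
      · have h1 := (hcurve 0).coeff (k - 1)
        have h2 := hw.coeff (k - 1)
        rw [hz0, ← h2] at h1
        have hk' : (((k - 1 : ℤ) : ℂ) + 1) ≠ 0 := by
          push_cast
          rw [sub_add_cancel]
          exact_mod_cast hk
        have h3 := mul_left_cancel₀ hk' h1
        rwa [sub_add_cancel] at h3
    · refine ⟨_, (hcurve t.toNNReal).hasPrincipalValue hc (hreg _) s, ?_⟩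
      rw [hrhs]
      refine (hasDerivAt_decayCurve p q hmode ht s).congr_deriv ?_
      have : (Real.pi : ℂ) ≠ 0 := by exact_mod_cast Real.pi_ne_zero
      push_cast
      field_simp
      ring
  · intro t ht
    exact contDiff_decayCurve μ _ p q h 2
      (summable_sq_decayMode μ _ h hμ (Real.toNNReal_pos.2 ht) hM)
  · refine ((hcurve _).wienerNorm_sub_le (continuous_decayCurve_right μ _ p q h)
      (coeff_decayCurve μ _ p q h)).trans (ENNReal.ofReal_le_ofReal ?_)
    refine (norm_stateEval_le μ _ z).trans ((mul_le_mul_of_nonneg_left hz zero_le_two).trans ?_)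
    rw [mul_assoc]
    exact mul_le_mul_of_nonneg_right (le_add_of_nonneg_right (by positivity)) (by positivity)
  · have hcf : ∀ t : ℝ≥0, ∀ k, coeff (decayCurve μ p q h t) k = circleMode p q k + decayMode μ h t k :=
      fun t k => coeff_decayCurve μ t p q h k
    set a₀ : ℝ → ℂ := fun t => p + decayMode μ h t.toNNReal 0 with ha₀
    set a₁ : ℝ → ℂ := fun t => q + decayMode μ h t.toNNReal 1 with ha₁
    set Y : ℝ → ℝ → ℂ := fun t s => decayCurve μ p q h t.toNNReal s - circleCurve (a₀ t) (a₁ t) s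
    have hY : ∀ t, ∀ k, coeff (Y t) k = if k = 0 ∨ k = 1 then 0 else decayMode μ h t.toNNReal k := by
      intro t k
      rw [coeff_sub (continuous_decayCurve_right μ _ p q h) (continuous_circleCurve _ _), hcf,
        coeff_circleCurve, circleMode]
      by_cases h0 : k = 0
      · simp [h0, ha₀]
      · by_cases h1 : k = 1
        · simp [h1, ha₁]
        · simp [h0, h1]
    refine ⟨a₀, a₁, Y, fun t _ => ⟨fun s => by simp only [Y]; ring, by simp [hY], by simp [hY]⟩,
      ?_, p, q, ?_, ?_, ?_, fun t ht => ⟨fun s => ?_, ?_⟩⟩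
    · refine (wNorm_le hμ hsum (fun _ => norm_nonneg _) (fun k _ _ => hu k) fun t _ => hY t).trans ?_
      refine ENNReal.ofReal_le_ofReal ?_
      rw [mul_assoc]
      exact mul_le_mul_of_nonneg_left hz2 (by positivity)
    · intro h0
      have h1 : ‖z.1‖ ≤ 1 / 2 := (norm_fst_le z).trans (hz.trans hεC)
      have h2 : z.1 = -1 := by linear_combination h0
      rw [h2] at h1
      norm_num at h1
    · simpa using (tendsto_decayMode μ h hμ 0).const_add p
    · simpa using (tendsto_decayMode μ h hμ 1).const_add q
    · refine (norm_decayCurve_sub_le μ _ p q h s).trans ?_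
      rw [Real.coe_toNNReal t ht, mul_comm]
      refine mul_le_mul_of_nonneg_right ?_ (Real.exp_pos _).le
      refine (norm_curveModes_le H z.2).trans ((add_le_add hHn hz2).trans ?_)
      have h1 : C * ε ≤ C := mul_le_of_le_one_right hC.le hε1
      have h2 : C * ε / μ ≤ C / μ := div_le_div_of_nonneg_right h1 hμ'.le
      have h3 : (2 + 2 / μ) * C = 2 * C + 2 * (C / μ) := by ring
      have h4 : 0 ≤ C / μ := by positivity
      linarith
    · refine (wienerNorm_decayCurve_sub_le μ _ p q h hsum hu).trans (ENNReal.ofReal_le_ofReal ?_)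
      rw [Real.coe_toNNReal t ht, mul_comm]
      refine mul_le_mul_of_nonneg_right ?_ (Real.exp_pos _).le
      have h1 : C * ε ≤ C := mul_le_of_le_one_right hC.le hε1
      have h3 : (2 + 2 / μ) * C = 2 * C + 2 * (C / μ) := by ring
      have h4 : 0 ≤ C / μ := by positivity
      linarith

/-! ### Expansion of the tension -/

/-- The function `S(w) = τ(√w)/√w` is analytic at `1`, with `S(1) = τ(1)` and `S'(1) = (τ'(1) -
τ(1))/2`. Hence `c₀ = τ(1)` and `c₀ + 2c₁ = τ'(1)`, both positive by assumption. -/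
theorem IsTension.exists_isExpansion {τ : ℝ → ℝ} (hτ : IsTension τ) :
    ∃ c K a, IsExpansion τ c K a := by
  set S : ℝ → ℝ := fun w => τ (Real.sqrt w) / Real.sqrt w with hS
  have hsq : AnalyticAt ℝ Real.sqrt 1 := by
    have h1 : AnalyticAt ℝ (fun w : ℝ => Real.exp (Real.log w / 2)) 1 :=
      ((analyticAt_log one_pos).div analyticAt_const two_ne_zero).rexp
    refine h1.congr ?_
    filter_upwards [lt_mem_nhds (zero_lt_one (α := ℝ))] with w hw
    rw [Real.exp_half, Real.exp_log hw]
  have h1 : AnalyticAt ℝ S 1 := by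
    have h2 : AnalyticAt ℝ τ (Real.sqrt 1) := hτ.analytic _ (by simp)
    exact (h2.comp hsq).div hsq (by simp)
  obtain ⟨p, hp⟩ := h1
  obtain ⟨K, r, hK, hr, hbd⟩ := p.le_mul_pow_of_radius_pos hp.radius_pos
  obtain ⟨R, hR⟩ := hp
  obtain ⟨ρ, hρ, hρR⟩ : ∃ ρ : ℝ≥0, 0 < ρ ∧ (ρ : ℝ≥0∞) < R := by
    obtain ⟨ρ, h1, h2⟩ := ENNReal.lt_iff_exists_nnreal_btwn.1 hR.r_pos
    exact ⟨ρ, by exact_mod_cast h1, h2⟩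
  have hρ' : (0 : ℝ) < ρ := hρ
  have hc0 : p.coeff 0 = τ 1 := by
    have : p.coeff 0 = S 1 := hR.coeff_zero _
    rw [this, hS]
    simp
  have hder : HasDerivAt S (p.coeff 1) 1 := hR.hasFPowerSeriesAt.hasDerivAt
  have hder' : HasDerivAt S (deriv τ 1 / 2 - τ 1 / 2) 1 := by
    have d1 : HasDerivAt Real.sqrt (1 / (2 * Real.sqrt 1)) 1 := Real.hasDerivAt_sqrt one_ne_zero
    have d2 : HasDerivAt τ (deriv τ (Real.sqrt 1)) (Real.sqrt 1) :=
      (hτ.analytic _ (by simp)).differentiableAt.hasDerivAt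
    refine ((d2.comp 1 d1).div d1 (by simp)).congr_deriv ?_
    simp only [Real.sqrt_one, Function.comp_apply]
    ring
  have hc1 := hder.unique hder'
  have hcoeff : ∀ n, |p.coeff n| ≤ ‖p n‖ := fun n => by
    rw [← Real.norm_eq_abs, ← FormalMultilinearSeries.norm_apply_eq_norm_coef]
  -- `r` controls the growth of the coefficients, and `ρ⁻¹` ensures that `a|y| < 1` forces `|y| < ρ
  -- < R`, inside the ball of convergence.
  refine ⟨fun n => p.coeff n, K, max r ρ⁻¹, lt_max_of_lt_left hr, fun n => ?_, fun y hy => ?_, ?_, ?_⟩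
  · exact (hcoeff n).trans ((hbd n).trans (by gcongr; exact le_max_left _ _))
  · have hy1 : |y| < ρ := by
      have := (mul_le_mul_of_nonneg_right (le_max_right r (ρ : ℝ)⁻¹) (abs_nonneg y)).trans_lt hy
      rwa [inv_mul_lt_one₀ hρ'] at this
    have hy2 : y ∈ Metric.eball (0 : ℝ) R := by
      rw [Metric.mem_eball, edist_zero_right]
      refine lt_trans ?_ hρR
      rw [← ofReal_norm, ← ENNReal.ofReal_coe_nnreal]
      exact (ENNReal.ofReal_lt_ofReal_iff hρ').2 hy1
    have := hR.hasSum hy2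
    simp only [FormalMultilinearSeries.apply_eq_pow_smul_coeff] at this
    refine (tsum_congr fun n => ?_).trans this.tsum_eq
    rw [smul_eq_mul, smul_eq_mul, mul_comm]
  · rw [hc0]
    exact hτ.pos 1 one_pos
  · rw [hc0, hc1]
    have := hτ.deriv_pos 1 one_pos
    linarith

/-! ### Differences of the nonlinearity in the uniform norm -/

section

variable {R B : Type*} [NormedCommRing R] [NormedAlgebra ℝ R] [CompleteSpace R] [NormOneClass R]
  [NormedCommRing B] [NormedAlgebra ℝ B] [NormOneClass B] [CompleteSpace B]
  [StarRing B] [NormedStarGroup B] [StarModule ℝ B] (S : Frame R B)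

/-- Row `n` of the product with the `i`-th variable, as a function of the variable. -/
def Frame.rowMul (i : Fin 4) (n : ℤ) (x : R) : Fam ℤ B →L[ℝ] B :=
  Fam.coord n ∘L S.row ∘L (ContinuousLinearMap.mul ℝ R x) ∘L S.emb i

theorem Frame.rowMul_apply (i : Fin 4) (n : ℤ) (x : R) (d : Fam ℤ B) :
    S.rowMul i n x d = S.row (x * S.emb i d) n := rfl

/-- Row `n` of the product with the `i`-th variable, as a function of the factor. -/
def Frame.mulRow (i : Fin 4) (n : ℤ) (d : Fam ℤ B) : R →L[ℝ] B :=
  Fam.coord n ∘L S.row ∘L ((ContinuousLinearMap.mul ℝ R).flip (S.emb i d))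

end

theorem row_single_mul_s_apply (a : ℤ × ℤ) (b : ℂ) {j n : ℤ} (p : ℤ) (w : ℂ) (hj : a.1 + j ≠ n) :
    wienerFrame.row (Conv.single _ a b * wienerFrame.s j p w) n = 0 := by
  have e : Conv.single _ a b * wienerFrame.s j p w = wienerFrame.s (a.1 + j) (a.2 + p) (b * w) :=
    trivial_single_mul a (j, p) b w
  rw [e, wienerFrame.row_s, Fam.single_apply, if_neg (Ne.symm hj)]

theorem row_single_mul_smul_sum (a : ℤ × ℤ) (b : ℂ) {j n : ℤ} (w : ℂ) (hj : a.1 + j ≠ n) (r : ℝ)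
    (s : Finset ℤ) (f : ℤ → ℤ) :
    wienerFrame.row (Conv.single _ a b * (r • ∑ p ∈ s, wienerFrame.s j (f p) w)) n = 0 := by
  let L : Wiener →L[ℝ] ℂ := Fam.coord n ∘L wienerFrame.row
  change L _ = 0
  have e : Conv.single _ a b * (r • ∑ p ∈ s, wienerFrame.s j (f p) w)
      = r • ∑ p ∈ s, Conv.single _ a b * wienerFrame.s j (f p) w := by
    rw [← Finset.mul_sum]
    exact mul_smul_comm r (Conv.single (Cocycle.trivial (ℤ × ℤ) ℂ) a b) _
  rw [e, map_smul, map_sum, Finset.sum_eq_zero, smul_zero]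
  exact fun p _ => row_single_mul_s_apply a b (f p) w hj

theorem row_single_mul_emb_single (i : Fin 4) (a : ℤ × ℤ) (b : ℂ) (k n : ℤ) (v : ℂ)
    (h : a.1 + (if i = 0 ∨ i = 2 then k else -k) ≠ n) :
    wienerFrame.row (Conv.single _ a b * wienerFrame.emb i (Fam.single k v)) n = 0 := by
  fin_cases i
  · simp only [Fin.zero_eta, Frame.emb_zero_single]
    exact row_single_mul_s_apply a b k v (by simpa using h)
  · simp only [Fin.mk_one, Frame.emb_one_single]
    exact row_single_mul_s_apply a b (-k) (star v) (by simpa using h)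
  · simp only [Fin.reduceFinMk, Frame.emb_two_single]
    exact row_single_mul_smul_sum a b v (by simpa using h) _ _ fun p => p
  · simp only [Fin.reduceFinMk, Frame.emb_three_single]
    exact row_single_mul_smul_sum a b (star v) (by simpa using h) _ _ fun p => -p

/-- Multiplying by a one-term element shifts the index, or reflects and shifts it, so row `n` sees a
single entry of `d`. Summing over the `ℓ¹` element `G` gives a bound in the supremum norm of `d`,
although `d` enters the algebra through its `ℓ¹` norm. -/
theorem norm_row_mul_emb_apply_le (i : Fin 4) (G : Wiener) {d : Fam ℤ ℂ} {M : ℝ}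
    (hd : ∀ n, ‖d n‖ ≤ M) (n : ℤ) : ‖wienerFrame.row (G * wienerFrame.emb i d) n‖ ≤ ‖G‖ * M := by
  have key : ∀ a b, ‖wienerFrame.row (Conv.single _ a b * wienerFrame.emb i d) n‖ ≤ ‖b‖ * M := by
    intro a b
    obtain ⟨κ, hκ⟩ : ∃ κ : ℤ, ∀ k ≠ κ, a.1 + (if i = 0 ∨ i = 2 then k else -k) ≠ n := by
      refine ⟨if i = 0 ∨ i = 2 then n - a.1 else a.1 - n, fun k hk h => hk ?_⟩
      split_ifs at h ⊢ <;> omega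
    set φ : Fam ℤ ℂ →L[ℝ] ℂ := wienerFrame.rowMul i n (Conv.single _ a b) with hφ
    have e : φ = φ ∘L Fam.single κ ∘L Fam.coord κ := by
      refine Fam.clm_ext fun k v => ?_
      change φ (Fam.single k v) = φ (Fam.single κ ((Fam.single k v : Fam ℤ ℂ) κ))
      by_cases hk : k = κ
      · rw [hk, Fam.single_apply, if_pos rfl]
      · rw [Fam.single_apply, if_neg (Ne.symm hk), map_zero, map_zero, hφ, Frame.rowMul_apply]
        exact row_single_mul_emb_single i a b k n v (hκ k hk)
    have h1 : φ d = φ (Fam.single κ (d κ)) := Fam.clm_eq e d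
    rw [hφ, Frame.rowMul_apply, Frame.rowMul_apply] at h1
    rw [h1]
    refine (Fam.norm_apply_le _ n).trans ?_
    refine (ContinuousLinearMap.le_of_opNorm_le _ wienerFrame.norm_row _).trans ?_
    rw [one_mul]
    refine (norm_mul_le _ _).trans ?_
    rw [Conv.norm_single]
    refine mul_le_mul_of_nonneg_left ?_ (norm_nonneg _)
    refine (Frame.norm_emb_le _ _ _).trans ?_
    rw [Fam.norm_single]
    exact hd κ
  have h1 : HasSum (fun a => wienerFrame.row (Conv.single _ a (G.toFam a) * wienerFrame.emb i d) n)
      (wienerFrame.row (G * wienerFrame.emb i d) n) :=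
    (Fam.hasSum_single G.toFam).mapL (wienerFrame.mulRow i n d)
  have h2 : HasSum (fun a => ‖G.toFam a‖ * M) (‖G‖ * M) := by
    have : ‖G‖ = ∑' a, ‖G.toFam a‖ := Fam.norm_eq G.toFam
    rw [this]
    exact (Fam.summable_norm G.toFam).hasSum.mul_right M
  exact h1.norm_le_of_bounded h2 fun a => key a _

theorem vars_sub (v w : Fam ℤ ℂ) (i : Fin 4) : vars v i - vars w i = wienerFrame.emb i (v - w) := by
  rw [vars, vars, add_sub_add_left_eq_sub, map_sub]

/-- The same multipliers `A i - nonlinCoeff i` give smallness in `ℓ¹` and in the supremum norm. The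
latter relies on the difference being a combination with coefficients in the algebra, not merely on
a bound for an abstract derivative. -/
theorem exists_rhs_sub_eq {τ : ℝ → ℝ} {c : ℕ → ℝ} {K a : ℝ} (hc : IsExpansion τ c K a)
    {η : ℝ} (hη : 0 < η) : ∃ δ > 0, ∀ v w : Fam ℤ ℂ, ‖v‖ ≤ δ → ‖w‖ ≤ δ →
      ∃ ρ : Fam ℤ ℂ, rhs c v - rhs c w = wienerFrame.linRow c (v - w) + ρ ∧
        ‖ρ‖ ≤ η * ‖v - w‖ ∧ ∀ M, (∀ n, ‖(v - w) n‖ ≤ M) → ∀ n, ‖ρ n‖ ≤ η * M := by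
  -- Each of the four variables contributes `η / 4`.
  obtain ⟨δ, hδ, h⟩ := (hasDivDiff_nonlin hc.bound hc.pos wienerFrame.E).exists_delta
    (show 0 < η / 4 by positivity)
  refine ⟨δ, hδ, fun v w hv hw => ?_⟩
  obtain ⟨A, hA, hF⟩ := h (vars v) (vars w) (fun i => (norm_vars_sub_one_le v i).trans hv)
    (fun i => (norm_vars_sub_one_le w i).trans hw)
  set g : Fin 4 → Wiener := fun i => A i - nonlinCoeff c wienerFrame.E i
  refine ⟨∑ i, wienerFrame.row (g i * wienerFrame.emb i (v - w)), ?_, ?_, fun M hM n => ?_⟩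
  · rw [rhs, rhs, ← map_sub, hF, Frame.linRow_apply, ← map_sum, ← map_add,
      ← Finset.sum_add_distrib]
    congr 1
    refine Finset.sum_congr rfl fun i _ => ?_
    rw [vars_sub]
    simp only [g]
    ring
  · refine (norm_sum_le _ _).trans ((Finset.sum_le_card_nsmul _ _ (η / 4 * ‖v - w‖)
      fun i _ => ?_).trans (by simp; linarith))
    refine (ContinuousLinearMap.le_of_opNorm_le _ wienerFrame.norm_row _).trans ?_
    rw [one_mul]
    exact (norm_mul_le _ _).trans (mul_le_mul (hA i) (Frame.norm_emb_le _ _ _) (norm_nonneg _)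
      (by positivity))
  · have e : (∑ i, wienerFrame.row (g i * wienerFrame.emb i (v - w)) : Fam ℤ ℂ) n
        = ∑ i, wienerFrame.row (g i * wienerFrame.emb i (v - w)) n := by
      change Fam.coord (B := ℂ) n (∑ i, wienerFrame.row (g i * wienerFrame.emb i (v - w))) = _
      rw [map_sum]
      rfl
    rw [e]
    refine (norm_sum_le _ _).trans ((Finset.sum_le_card_nsmul _ _ (η / 4 * M)
      fun i _ => ?_).trans (by simp; linarith))
    refine (norm_row_mul_emb_apply_le i (g i) hM n).trans ?_
    exact mul_le_mul_of_nonneg_right (hA i) ((norm_nonneg _).trans (hM 0))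

theorem exists_norm_rhs_le {τ : ℝ → ℝ} {c : ℕ → ℝ} {K a : ℝ} (hc : IsExpansion τ c K a) :
    ∃ δ > 0, ∃ M, ∀ v : Fam ℤ ℂ, ‖v‖ ≤ δ → ‖rhs c v‖ ≤ M := by
  obtain ⟨δ, hδ, h⟩ := exists_rhs_sub_eq hc one_pos
  refine ⟨δ, hδ, ‖rhs c 0‖ + (‖wienerFrame.linRow c‖ * δ + 1 * δ), fun v hv => ?_⟩
  obtain ⟨ρ, h1, h2, -⟩ := h v 0 hv (by rw [norm_zero]; exact hδ.le)
  rw [sub_zero] at h1 h2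
  rw [← sub_add_cancel (rhs c v) (rhs c 0), h1, add_comm]
  refine (norm_add_le _ _).trans (add_le_add_right ((norm_add_le _ _).trans (add_le_add ?_ ?_)) _)
  · exact ((wienerFrame.linRow c).le_opNorm v).trans (by gcongr)
  · exact h2.trans (by gcongr)

/-! ### The evolution of the diagonal variables -/

/-- The counterpart of `mode_evolution` for a given solution: the diagonal variables obey decoupled
damped equations, with forcing of order `|n|`. -/
theorem data_evolution (c : ℕ → ℝ) {n : ℤ} (hn : n ≠ 0) (V W R S : ℂ) (h1 : n = 1 → W = 0)
    (h2 : n = -1 → V = 0) :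
    (dataDiag n : ℂ) * (-(n + 1) / 8 * (Frame.diagCoeff c n * V + Frame.antiCoeff c n * W + R))
      + dataAnti n * (-((-n : ℤ) + 1) / 8 * (Frame.diagCoeff c (-n) * W + Frame.antiCoeff c (-n) * V + S))
    = -relaxRate c n * (dataDiag n * V + dataAnti n * W)
      + |(n : ℝ)| * (forceDiag n * R + forceAnti n * S) := by
  have h4 : (n : ℂ) ≠ 0 := by exact_mod_cast hn
  rcases lt_or_gt_of_ne hn with h | h
  · obtain rfl | h3 : n = -1 ∨ n ≤ -2 := by omega
    · simp [dataDiag, dataAnti, h2, forceDiag, forceAnti]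
    have h3' : (n : ℝ) ≤ -2 := by exact_mod_cast h3
    have h5 : (n : ℂ) + 1 ≠ 0 := by exact_mod_cast (by omega : n + 1 ≠ 0)
    have h6 : -(n : ℂ) + 1 ≠ 0 := by exact_mod_cast (by omega : -n + 1 ≠ 0)
    rw [Frame.diagCoeff_of_neg c h3, Frame.antiCoeff_of_neg c h3,
      Frame.diagCoeff_of_pos c (show 1 ≤ -n by omega), Frame.antiCoeff_of_pos c (show 2 ≤ -n by omega),
      abs_of_neg (by linarith)]
    simp only [dataDiag, dataAnti, relaxRate, forceDiag, forceAnti,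
      if_neg (show ¬ n = 0 by omega), if_neg (show ¬ 1 ≤ n by omega), if_neg (show ¬ 0 ≤ n by omega)]
    push_cast
    field_simp
    ring
  · obtain rfl | h3 : n = 1 ∨ 2 ≤ n := by omega
    · simp [dataDiag, dataAnti, h1, forceDiag, forceAnti, relaxRate, Frame.diagCoeff_of_pos]
      ring
    have h3' : (2 : ℝ) ≤ n := by exact_mod_cast h3
    have h5 : (n : ℂ) + 1 ≠ 0 := by exact_mod_cast (by omega : n + 1 ≠ 0)
    have h6 : -(n : ℂ) + 1 ≠ 0 := by exact_mod_cast (by omega : -n + 1 ≠ 0)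
    rw [Frame.diagCoeff_of_neg c (show -n ≤ -2 by omega), Frame.antiCoeff_of_neg c (show -n ≤ -2 by omega),
      Frame.diagCoeff_of_pos c (show 1 ≤ n by omega), Frame.antiCoeff_of_pos c h3,
      abs_of_pos (by linarith)]
    simp only [dataDiag, dataAnti, relaxRate, forceDiag, forceAnti,
      if_neg (show ¬ n = 0 by omega), if_pos (show 1 ≤ n by omega), if_pos (show 0 ≤ n by omega)]
    push_cast
    field_simp
    ring

/-! ### Comparison -/

/-- Pairing with a suitable `w` of norm at most one reduces to the real function `Re (w f) - β`,
which is nonincreasing. Derivatives are needed only in the interior. -/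
theorem norm_sub_le_of_hasDerivAt {f f' : ℝ → ℂ} {β β' : ℝ → ℝ} {a b : ℝ}
    (hf : ContinuousOn f (Icc a b)) (hβ : ContinuousOn β (Icc a b))
    (hf' : ∀ t ∈ Ioo a b, HasDerivAt f (f' t) t) (hβ' : ∀ t ∈ Ioo a b, HasDerivAt β (β' t) t)
    (h : ∀ t ∈ Ioo a b, ‖f' t‖ ≤ β' t) {t : ℝ} (ht : t ∈ Icc a b) : ‖f t - f a‖ ≤ β t - β a := by
  obtain ⟨w, hw, hw1⟩ : ∃ w : ℂ, ‖w‖ ≤ 1 ∧ ‖f t - f a‖ ≤ (w * (f t - f a)).re := by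
    rcases eq_or_ne (f t - f a) 0 with h0 | h0
    · exact ⟨0, by simp, by simp [h0]⟩
    · have hn : ‖f t - f a‖ ≠ 0 := norm_ne_zero_iff.2 h0
      refine ⟨(starRingEnd ℂ) (f t - f a) / ‖f t - f a‖, ?_, ?_⟩
      · rw [norm_div, RCLike.norm_conj, Complex.norm_real, norm_norm, div_self hn]
      · rw [div_mul_eq_mul_div, mul_comm, Complex.mul_conj, Complex.normSq_eq_norm_sq,
          ← Complex.ofReal_div, Complex.ofReal_re]
        exact le_of_eq (by field_simp)
  have hd : ∀ t ∈ Ioo a b, HasDerivAt (fun t => (w * f t).re - β t) ((w * f' t).re - β' t) t :=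
    fun t ht => (((Complex.reCLM.hasFDerivAt.comp_hasDerivAt t
      ((hf' t ht).const_mul w)))).sub (hβ' t ht)
  have hanti : AntitoneOn (fun t => (w * f t).re - β t) (Icc a b) := by
    refine antitoneOn_of_deriv_nonpos (convex_Icc a b) ?_ ?_ ?_
    · exact (Complex.continuous_re.comp_continuousOn (hf.const_mul w)).sub hβ
    · rw [interior_Icc]
      exact fun t ht => (hd t ht).differentiableAt.differentiableWithinAt
    · rw [interior_Icc]
      intro t ht
      rw [(hd t ht).deriv]
      have h1 := Complex.re_le_norm (w * f' t)
      rw [norm_mul] at h1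
      have h2 := mul_le_of_le_one_left (norm_nonneg (f' t)) hw
      linarith [h t ht]
  have := hanti (left_mem_Icc.2 (ht.1.trans ht.2)) ht ht.1
  simp only at this
  rw [mul_sub, Complex.sub_re] at hw1
  linarith

/-- Duhamel's estimate. -/
theorem norm_le_of_hasDerivAt_damped {y F : ℝ → ℂ} {a b l B : ℝ} (hl : 0 < l) (hB : 0 ≤ B)
    (hy : ContinuousOn y (Icc a b)) (hy' : ∀ t ∈ Ioo a b, HasDerivAt y (-l * y t + F t) t)
    (hF : ∀ t ∈ Ioo a b, ‖F t‖ ≤ B) (h0 : y a = 0) {t : ℝ} (ht : t ∈ Icc a b) : ‖y t‖ ≤ B / l := by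
  have he : ∀ t, HasDerivAt (fun t : ℝ => Real.exp (l * t)) (Real.exp (l * t) * l) t := fun t => by
    simpa using ((hasDerivAt_id t).const_mul l).exp
  have hec : Continuous fun t : ℝ => Real.exp (l * t) := by fun_prop
  have h := norm_sub_le_of_hasDerivAt (f := fun t => (Real.exp (l * t) : ℂ) * y t)
    (f' := fun t => (Real.exp (l * t) : ℂ) * F t) (β := fun t => Real.exp (l * t) * (B / l))
    (β' := fun t => Real.exp (l * t) * B) (a := a) (b := b)
    ((Complex.continuous_ofReal.comp hec).continuousOn.mul hy) (by fun_prop)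
    (fun t ht => ((he t).ofReal_comp.mul (hy' t ht)).congr_deriv (by push_cast; ring))
    (fun t _ => ((he t).mul_const (B / l)).congr_deriv (by field_simp))
    (fun t ht => by
      rw [norm_mul, Complex.norm_real, Real.norm_eq_abs, Real.abs_exp]
      exact mul_le_mul_of_nonneg_left (hF t ht) (Real.exp_pos _).le) ht
  simp only [h0, mul_zero, sub_zero] at h
  rw [norm_mul, Complex.norm_real, Real.norm_eq_abs, Real.abs_exp] at h
  have h3 : Real.exp (l * t) * ‖y t‖ ≤ Real.exp (l * t) * (B / l) :=
    h.trans (sub_le_self _ (by positivity))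
  exact le_of_mul_le_mul_left h3 (Real.exp_pos _)

/-! ### The evolution of the Fourier coefficients of a solution -/

namespace IsSolution

variable {τ : ℝ → ℝ} {X₀ : ℝ → ℂ} {X : ℝ → ℝ → ℂ}

theorem continuous_max (hX : IsSolution τ X₀ X) : Continuous fun x : ℝ × ℝ => X (max x.1 0) x.2 := by
  have h := hX.continuousOn.comp_continuous (f := fun x : ℝ × ℝ => (max x.1 0, x.2)) (by fun_prop)
    fun x => ⟨mem_Ici.2 (le_max_right _ _), mem_univ _⟩
  exact h

theorem continuous (hX : IsSolution τ X₀ X) {t : ℝ} (ht : 0 ≤ t) : Continuous (X t) :=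
  (hX.contDiff t ht).continuous

theorem continuousOn_coeff (hX : IsSolution τ X₀ X) (k : ℤ) :
    ContinuousOn (fun t => coeff (X t) k) (Ici 0) := by
  have h1 : Continuous fun t => coeff (X (max t 0)) k := by
    simp only [coeff_eq_integral]
    refine Continuous.const_smul (intervalIntegral.continuous_parametric_intervalIntegral_of_continuous'
      (μ := volume) (f := fun t s => character (-k) s * X (max t 0) s) ?_ _ _)
      (1 / (2 * Real.pi) : ℝ)
    exact ((continuous_character (-k)).comp continuous_snd).mul hX.continuous_max
  refine h1.continuousOn.congr fun t ht => ?_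
  simp only [max_eq_left (show (0 : ℝ) ≤ t from ht)]

theorem continuousOn_apply (hX : IsSolution τ X₀ X) (s : ℝ) :
    ContinuousOn (fun t => X t s) (Ici 0) := by
  have h1 : Continuous fun t => X (max t 0) s :=
    hX.continuous_max.comp (Continuous.prodMk_left s)
  refine h1.continuousOn.congr fun t ht => ?_
  simp only [max_eq_left (show (0 : ℝ) ≤ t from ht)]

end IsSolution

theorem continuous_fourierSum (w : Fam ℤ ℂ) : Continuous fun s => fourierSum s w := by
  have e : (fun s => fourierSum s w) = fun s => ∑' n, character n s * w n :=
    funext fun s => (hasSum_fourierSum s w).tsum_eq.symm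
  rw [e]
  refine continuous_tsum (fun n => (continuous_character n).mul continuous_const)
    (Fam.summable_norm w) fun n s => ?_
  rw [norm_mul, norm_character, one_mul]

theorem coeff_fourierSum (r : ℂ) (w : Fam ℤ ℂ) (k : ℤ) :
    coeff (fun s => r * (Complex.exp (Complex.I * s) * fourierSum s w)) k = r * w (k - 1) := by
  refine coeff_eq_of_hasSum (X := fun k => r * w (k - 1)) ?_ (fun s => ?_) k
  · have h1 : Summable fun k : ℤ => ‖w (k - 1)‖ :=
      (Equiv.subRight (1 : ℤ)).summable_iff (f := fun k => ‖w k‖) |>.2 (Fam.summable_norm w)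
    exact (h1.mul_left ‖r‖).congr fun k => (norm_mul _ _).symm
  · have h1 := ((hasSum_fourierSum s w).mul_left (Complex.exp (Complex.I * s))).mul_left r
    refine (Equiv.addRight (1 : ℤ)).hasSum_iff.1 ((hasSum_congr fun n => ?_).1 h1)
    simp only [Function.comp_apply, Equiv.coe_addRight]
    rw [add_sub_cancel_right, ← character_mul, character_one, character]
    ring

theorem IsSolution.hasDerivAt_apply {τ : ℝ → ℝ} {c : ℕ → ℝ} {K a : ℝ} (hc : IsExpansion τ c K a)
    {X₀ : ℝ → ℂ} {X : ℝ → ℝ → ℂ} (hX : IsSolution τ X₀ X) {t : ℝ} (ht : 0 < t) {v : Fam ℤ ℂ}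
    {x : ℤ → ℂ} (hv : IsCurve (X t) v x) (hr : Regular a (vars v)) (s : ℝ) :
    HasDerivAt (fun t' => X t' s)
      (-1 / 8 * (Complex.exp (Complex.I * s) * fourierSum s (rhs c v))) t := by
  obtain ⟨V, hV, hd⟩ := hX.evolution t ht s
  rw [hV.unique (hv.hasPrincipalValue hc hr s)] at hd
  refine hd.congr_deriv ?_
  have : (Real.pi : ℂ) ≠ 0 := by exact_mod_cast Real.pi_ne_zero
  push_cast
  field_simp
  ring

/-- Differentiation under the integral: the time derivative is bounded, uniformly in `s` and `t`, by
the `ℓ¹` norm of the row sums. -/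
theorem IsSolution.hasDerivAt_coeff {τ : ℝ → ℝ} {c : ℕ → ℝ} {K a : ℝ} (hc : IsExpansion τ c K a)
    {X₀ : ℝ → ℂ} {X : ℝ → ℝ → ℂ} (hX : IsSolution τ X₀ X) {t₀ t₁ : ℝ} (h0 : 0 ≤ t₀) {M : ℝ}
    {v : ℝ → Fam ℤ ℂ} {x : ℝ → ℤ → ℂ} (hv : ∀ t ∈ Ioo t₀ t₁, IsCurve (X t) (v t) (x t))
    (hr : ∀ t ∈ Ioo t₀ t₁, Regular a (vars (v t))) (hM : ∀ t ∈ Ioo t₀ t₁, ‖rhs c (v t)‖ ≤ M)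
    {t : ℝ} (ht : t ∈ Ioo t₀ t₁) (k : ℤ) :
    HasDerivAt (fun t => coeff (X t) k) (-1 / 8 * rhs c (v t) (k - 1)) t := by
  have hpos : ∀ t ∈ Ioo t₀ t₁, 0 < t := fun t ht => h0.trans_lt ht.1
  have hI : Ioo t₀ t₁ ∈ 𝓝 t := Ioo_mem_nhds ht.1 ht.2
  have hch := continuous_character (-k)
  have key := intervalIntegral.hasDerivAt_integral_of_dominated_loc_of_deriv_le (μ := volume)
    (a := 0) (b := 2 * Real.pi) (x₀ := t) (s := Ioo t₀ t₁) (bound := fun _ => M)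
    (F := fun t s => character (-k) s * X t s)
    (F' := fun t s => character (-k) s *
      (-1 / 8 * (Complex.exp (Complex.I * s) * fourierSum s (rhs c (v t))))) hI
    (by
      filter_upwards [hI] with t' ht'
      exact (hch.mul (hX.continuous (hpos t' ht').le)).aestronglyMeasurable)
    ((hch.mul (hX.continuous (hpos t ht).le)).intervalIntegrable _ _)
    (by
      have := continuous_fourierSum (rhs c (v t))
      exact Continuous.aestronglyMeasurable (by fun_prop))
    (ae_of_all _ fun s _ t' ht' => by
      rw [norm_mul, norm_character, one_mul, norm_mul, norm_mul, norm_exp_I, one_mul]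
      have h1 : ‖(-1 / 8 : ℂ)‖ ≤ 1 := by norm_num
      exact (mul_le_of_le_one_left (norm_nonneg _) h1).trans
        ((norm_fourierSum_le s _).trans (hM t' ht')))
    intervalIntegrable_const
    (ae_of_all _ fun s _ t' ht' =>
      (hX.hasDerivAt_apply hc (hpos t' ht') (hv t' ht') (hr t' ht') s).const_mul _)
  rw [← coeff_fourierSum, coeff_eq_integral]
  simp only [coeff_eq_integral (X _)]
  exact key.2.const_smul (1 / (2 * Real.pi) : ℝ)

/-! ### Uniqueness -/

theorem IsCurve.apply_eq {f : ℝ → ℂ} {v : Fam ℤ ℂ} {x : ℤ → ℂ} (h : IsCurve f v x) (n : ℤ) :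
    v n = (n + 1) * x (n + 1) - if n = 0 then 1 else 0 := by rw [h.coeff]; ring

theorem eq_zero_of_halving {ι : Type*} {f : ι → ℝ} {M : ℝ} (hf : ∀ i, 0 ≤ f i) (hM : ∀ i, f i ≤ M)
    (h : ∀ M, (∀ i, f i ≤ M) → ∀ i, f i ≤ M / 2) (i : ι) : f i = 0 := by
  have h1 : ∀ k : ℕ, ∀ i, f i ≤ M / 2 ^ k := by
    intro k
    induction k with
    | zero => simpa using hM
    | succ k ih =>
      intro i
      rw [pow_succ, ← div_div]
      exact h _ ih i
  refine le_antisymm (ge_of_tendsto' (x := atTop) (f := fun k : ℕ => M / 2 ^ k) ?_ fun k => h1 k i) (hf i)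
  exact tendsto_const_nhds.div_atTop (tendsto_pow_atTop_atTop_of_one_lt one_lt_two)

/-- An a priori estimate for the difference of two solutions in terms of the modes. -/
theorem mode_difference_le {c : ℕ → ℝ} {μ : ℝ≥0} (hμ : 0 < μ) (h1 : 8 * μ ≤ c 0)
    (h2 : 8 * μ ≤ c 0 + 2 * c 1) {t₀ t₁ B : ℝ} (ht : t₁ ≤ t₀ + 1) {D ρ : ℝ → ℤ → ℂ}
    (hD : ∀ n, ContinuousOn (fun t => D t n) (Icc t₀ t₁)) (hD0 : ∀ n, D t₀ n = 0)
    (hD1 : ∀ t ∈ Icc t₀ t₁, D t (-1) = 0)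
    (hD' : ∀ t ∈ Ioo t₀ t₁, ∀ n : ℤ, HasDerivAt (fun t => D t n) (-(n + 1) / 8 *
      (Frame.diagCoeff c n * D t n + Frame.antiCoeff c n * star (D t (-n)) + ρ t n)) t)
    (hB : 0 ≤ B) (hρ : ∀ t ∈ Ioo t₀ t₁, ∀ n, ‖ρ t n‖ ≤ B) {t : ℝ} (htI : t ∈ Icc t₀ t₁) (n : ℤ) :
    ‖D t n‖ ≤ (1 + 2 / μ) * B := by
  have hμ' : (0 : ℝ) < μ := hμ
  have hmul : ∀ {x : ℝ} {z : ℂ} {C : ℝ}, |x| ≤ 1 → ‖z‖ ≤ C → ‖(x : ℂ) * z‖ ≤ C := by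
    intro x z C hx hz
    rw [norm_mul, Complex.norm_real, Real.norm_eq_abs]
    exact (mul_le_of_le_one_left (norm_nonneg _) hx).trans hz
  rcases eq_or_ne n 0 with rfl | hn
  -- The mode `0` is not damped, but its linear coefficients vanish; the forcing is integrated over
  -- an interval of length at most one.
  · have h := norm_sub_le_of_hasDerivAt (f := fun t => D t 0) (β := fun t => B * t)
      (β' := fun _ => B) (hD 0) (by fun_prop) (fun t ht => hD' t ht 0)
      (fun t _ => by simpa using (hasDerivAt_id t).const_mul B) (fun t ht => by
        rw [Frame.diagCoeff_zero, Frame.antiCoeff_zero]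
        have := hρ t ht 0
        have h8 : ‖(-1 / 8 : ℂ)‖ ≤ 1 := by norm_num
        simp only [Int.cast_zero, zero_add, Complex.ofReal_zero, zero_mul, norm_mul]
        exact (mul_le_of_le_one_left (norm_nonneg _) h8).trans this) htI
    simp only [hD0, sub_zero] at h
    have h3 : B * t - B * t₀ ≤ B * 1 := by
      rw [← mul_sub]
      exact mul_le_mul_of_nonneg_left (by linarith [htI.2]) hB
    have h4 : 0 ≤ 2 / (μ : ℝ) * B := by positivity
    linarith
  · -- the diagonal variables
    let y : ℤ → ℝ → ℂ := fun n t => dataDiag n * D t n + dataAnti n * star (D t (-n))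
    have hy : ∀ n ≠ 0, ∀ t ∈ Icc t₀ t₁, ‖y n t‖ ≤ B / μ := by
      intro n hn t ht
      have hn1 : (1 : ℝ) ≤ |(n : ℝ)| := by exact_mod_cast Int.one_le_abs hn
      have hrate := relaxRate_sub_modeRate h1 h2 hn
      rw [modeRate, max_eq_left hn1] at hrate
      have hl : 2 * (μ * |(n : ℝ)|) ≤ relaxRate c n := by linarith
      have hm : 0 < μ * |(n : ℝ)| := by positivity
      have hl0 : 0 < relaxRate c n := by linarith
      have h := norm_le_of_hasDerivAt_damped (y := y n) (a := t₀) (b := t₁) (l := relaxRate c n)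
        (B := |(n : ℝ)| * (B + B))
        (F := fun t => |(n : ℝ)| * (forceDiag n * ρ t n + forceAnti n * star (ρ t (-n)))) hl0
        (by positivity)
        (((hD n).const_mul _).add ((continuous_star.comp_continuousOn (hD (-n))).const_mul _))
        (fun t ht => by
          have d := ((hD' t ht n).const_mul (dataDiag n : ℂ)).add
            ((hD' t ht (-n)).star.const_mul (dataAnti n : ℂ))
          refine d.congr_deriv ?_
          have ht' : t ∈ Icc t₀ t₁ := Ioo_subset_Icc_self ht
          have e := data_evolution c hn (D t n) (star (D t (-n))) (ρ t n) (star (ρ t (-n)))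
            (fun h => by rw [h, hD1 t ht', star_zero]) (fun h => by rw [h, hD1 t ht'])
          simp only [y]
          rw [← e, neg_neg]
          simp only [RCLike.star_def, map_mul, map_add, map_neg, map_div₀, Complex.conj_ofReal,
            Complex.conj_conj, map_one, map_ofNat, map_intCast])
        (fun t ht => by
          rw [norm_mul, Complex.norm_real, norm_abs_eq_norm, Real.norm_eq_abs]
          refine mul_le_mul_of_nonneg_left ?_ (abs_nonneg _)
          refine (norm_add_le _ _).trans (add_le_add (hmul (abs_forceDiag_le n) (hρ t ht n))
            (hmul (abs_forceAnti_le n) ?_))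
          rw [norm_star]
          exact hρ t ht (-n))
        (by simp [y, hD0]) ht
      refine h.trans ?_
      -- The forcing is at most `2|n|B` and the rate at least `2μ|n|`, so the factor `|n|` cancels.
      rw [div_le_div_iff₀ hl0 hμ']
      nlinarith
    have e := modeDiag_dataDiag hn (D t n) (star (D t (-n)))
      (fun h => by rw [h, hD1 t htI, star_zero]) (fun h => by rw [h, hD1 t htI])
    have e' : (modeDiag n : ℂ) * y n t + modeAnti n * star (y (-n) t) = D t n := by
      rw [← e]
      simp only [y, neg_neg, RCLike.star_def, map_add, map_mul, Complex.conj_ofReal,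
        Complex.conj_conj]
    rw [← e']
    have h3 : ‖(modeDiag n : ℂ) * y n t + modeAnti n * star (y (-n) t)‖ ≤ B / μ + B / μ := by
      refine (norm_add_le _ _).trans (add_le_add (hmul (abs_modeDiag_le n) (hy n hn t htI))
        (hmul (abs_modeAnti_le n) ?_))
      rw [norm_star]
      exact hy (-n) (neg_ne_zero.2 hn) t htI
    refine h3.trans ?_
    have : (1 + 2 / (μ : ℝ)) * B = B + (B / μ + B / μ) := by ring
    linarith

/-- The supremum over times and modes of the tangent difference is finite a priori, from the
pointwise smallness, and satisfies the mode estimate with forcing of size `η` times itself; hence it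
is at most half of itself. Each mode is treated separately, so no summability of suprema in time is
needed. -/
theorem IsSolution.eqOn_of_wienerNorm_le {τ : ℝ → ℝ} {c : ℕ → ℝ} {K a : ℝ} (hc : IsExpansion τ c K a) :
    ∃ δ > (0 : ℝ), ∀ (X₀ : ℝ → ℂ) (X X' : ℝ → ℝ → ℂ) (t₀ t₁ : ℝ), IsSolution τ X₀ X →
      IsSolution τ X₀ X' → 0 ≤ t₀ → t₀ ≤ t₁ → t₁ ≤ t₀ + 1 → (∀ s, X' t₀ s = X t₀ s) →
      (∀ t ∈ Icc t₀ t₁,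
        wienerNorm (fun s => X t s - circleCurve 0 1 s) ≤ ENNReal.ofReal δ ∧
        wienerNorm (fun s => X' t s - circleCurve 0 1 s) ≤ ENNReal.ofReal δ) →
      ∀ t ∈ Icc t₀ t₁, ∀ s, X' t s = X t s := by
  obtain ⟨μ, hμ, hμ1, hμ2⟩ := exists_rate hc
  have hμ' : (0 : ℝ) < μ := hμ
  -- Chosen so that `(1 + 2/μ) η = 1/2`, with `1 + 2/μ` the constant of `mode_difference_le`.
  set η : ℝ := 1 / (2 * (1 + 2 / μ)) with hη
  obtain ⟨δ₁, hδ₁, hrhs⟩ := exists_rhs_sub_eq hc (show 0 < η by positivity)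
  obtain ⟨δ₂, hδ₂, M, hM⟩ := exists_norm_rhs_le hc
  obtain ⟨δ₃, hδ₃, hreg⟩ := exists_regular (R := Wiener) hc.pos.le
  refine ⟨min δ₁ (min δ₂ δ₃), by positivity, fun X₀ X X' t₀ t₁ hX hX' h0 h01 ht1 heq hsmall => ?_⟩
  set δ := min δ₁ (min δ₂ δ₃) with hδ
  have hδ0 : 0 < δ := by positivity
  have hle1 : δ ≤ δ₁ := min_le_left _ _
  have hle2 : δ ≤ δ₂ := (min_le_right _ _).trans (min_le_left _ _)
  have hle3 : δ ≤ δ₃ := (min_le_right _ _).trans (min_le_right _ _)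
  have hcurve : ∀ Z : ℝ → ℝ → ℂ, IsSolution τ X₀ Z →
      (∀ t ∈ Icc t₀ t₁, wienerNorm (fun s => Z t s - circleCurve 0 1 s) ≤ ENNReal.ofReal δ) →
      ∃ v : ℝ → Fam ℤ ℂ, ∀ t ∈ Icc t₀ t₁, ‖v t‖ ≤ δ ∧ IsCurve (Z t) (v t) (coeff (Z t)) := by
    intro Z hZ hs
    have : ∀ t, ∃ w : Fam ℤ ℂ, t ∈ Icc t₀ t₁ → ‖w‖ ≤ δ ∧ IsCurve (Z t) w (coeff (Z t)) := by
      intro t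
      by_cases ht : t ∈ Icc t₀ t₁
      · obtain ⟨w, hw⟩ := exists_isCurve (hZ.continuous (h0.trans ht.1))
          (hZ.periodic t (h0.trans ht.1)) hδ0.le (hs t ht)
        exact ⟨w, fun _ => hw⟩
      · exact ⟨0, fun h => absurd h ht⟩
    choose v hv using this
    exact ⟨v, hv⟩
  obtain ⟨v, hv⟩ := hcurve X hX fun t ht => (hsmall t ht).1
  obtain ⟨v', hv'⟩ := hcurve X' hX' fun t ht => (hsmall t ht).2
  have hsub : Ioo t₀ t₁ ⊆ Icc t₀ t₁ := Ioo_subset_Icc_self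
  have hR : ∀ w : Fam ℤ ℂ, ‖w‖ ≤ δ → Regular a (vars w) := fun w hw => hreg _ fun i =>
    (norm_vars_sub_one_le w i).trans (hw.trans hle3)
  have hd : ∀ t ∈ Ioo t₀ t₁, ∀ k, HasDerivAt (fun t => coeff (X t) k)
      (-1 / 8 * rhs c (v t) (k - 1)) t := fun t ht k =>
    hX.hasDerivAt_coeff hc h0 (fun t ht => (hv t (hsub ht)).2) (fun t ht => hR _ (hv t (hsub ht)).1)
      (fun t ht => hM _ ((hv t (hsub ht)).1.trans hle2)) ht k
  have hd' : ∀ t ∈ Ioo t₀ t₁, ∀ k, HasDerivAt (fun t => coeff (X' t) k)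
      (-1 / 8 * rhs c (v' t) (k - 1)) t := fun t ht k =>
    hX'.hasDerivAt_coeff hc h0 (fun t ht => (hv' t (hsub ht)).2)
      (fun t ht => hR _ (hv' t (hsub ht)).1) (fun t ht => hM _ ((hv' t (hsub ht)).1.trans hle2)) ht k
  have hcont : ∀ k, ContinuousOn (fun t => coeff (X t) k) (Icc t₀ t₁) := fun k =>
    (hX.continuousOn_coeff k).mono fun t ht => h0.trans ht.1
  have hcont' : ∀ k, ContinuousOn (fun t => coeff (X' t) k) (Icc t₀ t₁) := fun k =>
    (hX'.continuousOn_coeff k).mono fun t ht => h0.trans ht.1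
  have hX0 : coeff (X' t₀) = coeff (X t₀) := by rw [show X' t₀ = X t₀ from funext heq]
  -- the difference of the tangent modes
  let D : ℝ → ℤ → ℂ := fun t n => (n + 1) * (coeff (X' t) (n + 1) - coeff (X t) (n + 1))
  have hDv : ∀ t ∈ Icc t₀ t₁, ∀ n, (v' t - v t) n = D t n := fun t ht n => by
    rw [Fam.sub_apply, (hv t ht).2.apply_eq, (hv' t ht).2.apply_eq]
    simp only [D]
    ring
  have hstep : ∀ B : ℝ, 0 ≤ B → (∀ t ∈ Icc t₀ t₁, ∀ n, ‖D t n‖ ≤ B) →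
      ∀ t ∈ Icc t₀ t₁, ∀ n, ‖D t n‖ ≤ B / 2 := by
    intro B hB hDB
    have : ∀ t, ∃ ρ : Fam ℤ ℂ, t ∈ Icc t₀ t₁ →
        rhs c (v' t) - rhs c (v t) = wienerFrame.linRow c (v' t - v t) + ρ ∧
          ∀ n, ‖ρ n‖ ≤ η * B := by
      intro t
      by_cases ht : t ∈ Icc t₀ t₁
      · obtain ⟨ρ, h1, -, h2⟩ := hrhs (v' t) (v t) ((hv' t ht).1.trans hle1) ((hv t ht).1.trans hle1)
        exact ⟨ρ, fun _ => ⟨h1, h2 B fun n => by rw [hDv t ht]; exact hDB t ht n⟩⟩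
      · exact ⟨0, fun h => absurd h ht⟩
    choose ρ hρ using this
    intro t ht n
    refine (mode_difference_le hμ hμ1 hμ2 (B := η * B) (D := D) (ρ := fun t n => ρ t n) ht1 ?_ ?_ ?_ ?_
      (by positivity) (fun t ht n => (hρ t (hsub ht)).2 n) ht n).trans (le_of_eq ?_)
    · exact fun n => ((hcont' (n + 1)).sub (hcont (n + 1))).const_mul _
    · intro n
      simp only [D, hX0, sub_self, mul_zero]
    · intro t _
      simp [D]
    · intro t ht n
      refine (((hd' t ht (n + 1)).sub (hd t ht (n + 1))).const_mul ((n : ℂ) + 1)).congr_deriv ?_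
      have h1 : rhs c (v' t) n - rhs c (v t) n
          = Frame.diagCoeff c n * D t n + Frame.antiCoeff c n * star (D t (-n)) + ρ t n := by
        rw [← Fam.sub_apply, (hρ t (hsub ht)).1, Fam.add_apply, Frame.linRow_eq, hDv t (hsub ht),
          hDv t (hsub ht), Complex.real_smul, Complex.real_smul]
      rw [← h1, add_sub_cancel_right]
      ring
    · rw [hη]
      field_simp
  have hD0 : ∀ t ∈ Icc t₀ t₁, ∀ n, D t n = 0 := by
    intro t ht n
    have := eq_zero_of_halving (f := fun i : Icc t₀ t₁ × ℤ => ‖D i.1 i.2‖) (M := δ + δ)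
      (fun _ => norm_nonneg _) (fun i => by
        rw [← hDv i.1 i.1.2]
        refine (Fam.norm_apply_le _ _).trans ((norm_sub_le _ _).trans ?_)
        exact add_le_add (hv' _ i.1.2).1 (hv _ i.1.2).1)
      (fun B hB i => hstep B ((norm_nonneg _).trans (hB i)) (fun t ht n => hB (⟨t, ht⟩, n)) i.1 i.1.2
        i.2) (⟨t, ht⟩, n)
    exact norm_eq_zero.1 this
  have hvv : ∀ t ∈ Icc t₀ t₁, v' t = v t := fun t ht => by
    rw [← sub_eq_zero]
    exact Fam.ext fun n => (hDv t ht n).trans (hD0 t ht n)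
  -- The tangent does not see the constant mode; its derivatives agree for the two solutions because
  -- their tangents do.
  have hzero : ∀ t ∈ Icc t₀ t₁, coeff (X' t) 0 = coeff (X t) 0 := by
    intro t ht
    have h := norm_sub_le_of_hasDerivAt (f := fun t => coeff (X' t) 0 - coeff (X t) 0)
      (β := fun _ => 0) (β' := fun _ => 0) ((hcont' 0).sub (hcont 0)) continuousOn_const
      (fun t ht => (hd' t ht 0).sub (hd t ht 0)) (fun t _ => hasDerivAt_const t (0 : ℝ))
      (fun t ht => by rw [hvv t (hsub ht), sub_self, norm_zero]) ht
    simp only [hX0, sub_self, sub_zero] at h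
    exact sub_eq_zero.1 (norm_le_zero_iff.1 h)
  intro t ht s
  refine HasSum.unique ((hv' t ht).2.hasSum s) ((hasSum_congr fun k => ?_).1 ((hv t ht).2.hasSum s))
  congr 1
  rcases eq_or_ne k 0 with rfl | hk
  · exact (hzero t ht).symm
  · have h1 := hD0 t ht (k - 1)
    simp only [D] at h1
    rw [sub_add_cancel] at h1
    have hk' : (((k - 1 : ℤ) : ℂ) + 1) ≠ 0 := by
      push_cast
      rw [sub_add_cancel]
      exact_mod_cast hk
    exact (sub_eq_zero.1 ((mul_eq_zero.1 h1).resolve_left hk')).symm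

/-! ### Continuation of local uniqueness to all times -/

theorem norm_coeff_le_of_wienerNorm {f : ℝ → ℂ} {δ : ℝ} (hδ : 0 ≤ δ)
    (h : wienerNorm f ≤ ENNReal.ofReal δ) : ‖coeff f 1‖ ≤ δ := by
  have h1 := (ENNReal.le_tsum (f := fun k : ℤ => ‖coeff f k‖ₑ * ENNReal.ofReal |(k : ℝ)|) 1).trans h
  simp only [Int.cast_one, abs_one, ENNReal.ofReal_one, mul_one] at h1
  rw [← ofReal_norm] at h1
  exact (ENNReal.ofReal_le_ofReal_iff hδ).1 h1

/-- Solutions near the unit circle are unique. -/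
theorem IsSolution.unique {τ : ℝ → ℝ} {c : ℕ → ℝ} {K a : ℝ} (hc : IsExpansion τ c K a) :
    ∃ δ > (0 : ℝ), ∀ (X₀ : ℝ → ℂ) (X X' : ℝ → ℝ → ℂ) (b₀ b₁ : ℝ → ℂ) (Y' : ℝ → ℝ → ℂ),
      IsSolution τ X₀ X → IsSolution τ X₀ X' →
      (∀ t, 0 ≤ t → wienerNorm (fun s => X t s - circleCurve 0 1 s) ≤ ENNReal.ofReal δ) →
      HasDecomposition X' b₀ b₁ Y' → wNorm Y' ≤ ENNReal.ofReal δ →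
      ∀ t, 0 ≤ t → ∀ s, X' t s = X t s := by
  obtain ⟨δ, hδ, hloc⟩ := IsSolution.eqOn_of_wienerNorm_le hc
  -- The modes of `X'` other than `0` and `1` take `δ/4` and the deviation of the mode `1` from `1`
  -- may reach `δ/2`, which stays below `δ` in total. At a time of coincidence that deviation is at
  -- most `δ/4`, leaving room for continuity.
  refine ⟨δ / 4, by positivity, fun X₀ X X' b₀ b₁ Y' hX hX' hsmall hdec hY t ht => ?_⟩
  set S : Set ℝ := {t | ∀ s, X' t s = X t s}
  suffices h : Icc 0 t ⊆ S from h ⟨ht, le_rfl⟩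
  -- The set of times of coincidence is closed and contains a right neighbourhood of each of its
  -- points. Nothing is assumed about `b₁`, so the closeness of the mode `1` of `X'` to `1` must be
  -- regained from `X` at every such time.
  refine IsClosed.Icc_subset_of_forall_mem_nhdsWithin ?_ ?_ ?_
  · have e : S ∩ Icc 0 t = ⋂ s, {t' ∈ Icc 0 t | X' t' s = X t' s} := by
      ext t'
      simp only [S, mem_inter_iff, mem_ofPred_eq, mem_iInter]
      exact ⟨fun h s => ⟨h.2, h.1 s⟩, fun h => ⟨fun s => (h s).2, (h 0).1⟩⟩
    rw [e]
    refine isClosed_iInter fun s => ?_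
    exact isClosed_Icc.isClosed_eq ((hX'.continuousOn_apply s).mono Icc_subset_Ici_self)
      ((hX.continuousOn_apply s).mono Icc_subset_Ici_self)
  · intro s
    rw [hX'.initial, hX.initial]
  · rintro t₀ ⟨heq, ht0, -⟩
    have hYt : ∀ t, 0 ≤ t → Summable (fun k : ℤ => |(k : ℝ)| * ‖coeff (Y' t) k‖) ∧
        ∑' k : ℤ, |(k : ℝ)| * ‖coeff (Y' t) k‖ ≤ δ / 4 := by
      intro t ht
      have h1 : wienerNorm (Y' t) ≤ ENNReal.ofReal (δ / 4) :=
        le_trans (le_trans (le_iSup₂ (f := fun t (_ : t ∈ Ici (0 : ℝ)) => wienerNorm (Y' t)) t ht)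
          le_self_add) hY
      have h2 := summable_of_wienerNorm (h1.trans_lt ENNReal.ofReal_lt_top).ne
      rw [wienerNorm_eq h2] at h1
      exact ⟨h2, (ENNReal.ofReal_le_ofReal_iff (by positivity)).1 h1⟩
    have hYc : ∀ t, 0 ≤ t → ∀ k, coeff (Y' t) k = coeff (X' t) k - coeff (circleCurve (b₀ t) (b₁ t)) k := by
      intro t ht k
      rw [← coeff_sub (hX'.continuous ht) (continuous_circleCurve _ _)]
      congr 1
      funext s
      rw [(hdec t ht).1 s]
      ring
    -- the modes other than the modes `0` and `1` are small
    have hW : ∀ t, 0 ≤ t → ‖coeff (X' t) 1 - 1‖ ≤ δ / 2 →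
        wienerNorm (fun s => X' t s - circleCurve 0 1 s) ≤ ENNReal.ofReal δ := by
      intro t ht h1
      have hs : HasSum (fun k : ℤ => |(k : ℝ)| * ‖coeff (Y' t) k‖ + if k = 1 then δ / 2 else 0)
          (∑' k : ℤ, |(k : ℝ)| * ‖coeff (Y' t) k‖ + δ / 2) := (hYt t ht).1.hasSum.add (hasSum_ite_eq 1 _)
      refine (wienerNorm_le_of hs fun k => ?_).trans (ENNReal.ofReal_le_ofReal ?_)
      · rw [coeff_sub (hX'.continuous ht) (continuous_circleCurve _ _), hYc t ht, coeff_circleCurve,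
          coeff_circleCurve]
        by_cases h0 : k = 0
        · simp [h0]
        · by_cases h1 : k = 1
          · subst h1
            simp only [Int.cast_one, abs_one, one_mul, if_true, one_ne_zero, if_false]
            linarith [norm_nonneg (coeff (X' t) 1 - b₁ t)]
          · simp [h0, h1]
      · linarith [(hYt t ht).2]
    have hX1 : ‖coeff (X' t₀) 1 - 1‖ ≤ δ / 4 := by
      have h1 := norm_coeff_le_of_wienerNorm (by positivity) (hsmall t₀ ht0)
      rw [coeff_sub (hX.continuous ht0) (continuous_circleCurve _ _), coeff_circleCurve] at h1
      rw [show X' t₀ = X t₀ from funext heq]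
      simpa using h1
    have hcont : ContinuousWithinAt (fun t => ‖coeff (X' t) 1 - 1‖) (Ici t₀) t₀ :=
      ((((hX'.continuousOn_coeff 1).sub continuousOn_const).norm) t₀ ht0).mono (Ici_subset_Ici.2 ht0)
    have hev : ∀ᶠ t in 𝓝[≥] t₀, ‖coeff (X' t) 1 - 1‖ < δ / 2 :=
      hcont.eventually_lt_const (show _ < δ / 2 by linarith)
    obtain ⟨u, hu, hIco⟩ := mem_nhdsGE_iff_exists_Ico_subset.1 hev
    have hu' : t₀ < u := hu
    have hmem : Ioo t₀ (min u (t₀ + 1)) ∈ 𝓝[>] t₀ :=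
      Ioo_mem_nhdsGT (lt_min hu' (by linarith))
    filter_upwards [hmem] with t₁ ht₁
    refine hloc X₀ X X' t₀ t₁ hX hX' ht0 ht₁.1.le (ht₁.2.le.trans (min_le_right _ _)) heq
      (fun t' ht' => ⟨?_, ?_⟩) t₁ ⟨ht₁.1.le, le_rfl⟩
    · exact (hsmall t' (ht0.trans ht'.1)).trans (ENNReal.ofReal_le_ofReal (by linarith))
    · refine hW t' (ht0.trans ht'.1) (le_of_lt ?_)
      exact hIco ⟨ht'.1, ht'.2.trans_lt (ht₁.2.trans_le (min_le_left _ _))⟩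

end

end Peskin

theorem theorem2 (τ : ℝ → ℝ) (hτ : Peskin.IsTension τ) :
    ∃ ε₀ > (0 : ℝ), ∃ C > (0 : ℝ), ∃ c > (0 : ℝ),
      ∀ ε : ℝ, 0 < ε → ε ≤ ε₀ →
      ∀ X₀ : ℝ → ℂ, Continuous X₀ → Function.Periodic X₀ (2 * Real.pi) →
        Peskin.wienerNorm (fun s => X₀ s - Peskin.circleCurve 0 1 s) ≤ ENNReal.ofReal ε →
        ∃ X : ℝ → ℝ → ℂ,
          -- existence of a solution, of class `C²` in `s` for positive times
          Peskin.IsSolution τ X₀ X ∧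
          (∀ t, 0 < t → ContDiff ℝ 2 (X t)) ∧
          (∃ (a₀ a₁ : ℝ → ℂ) (Y : ℝ → ℝ → ℂ),
            Peskin.HasDecomposition X a₀ a₁ Y ∧
            Peskin.wNorm Y ≤ ENNReal.ofReal (C * ε) ∧
            -- exponential convergence to a circle
            ∃ a₀lim a₁lim : ℂ, a₁lim ≠ 0 ∧
              Tendsto a₀ atTop (𝓝 a₀lim) ∧ Tendsto a₁ atTop (𝓝 a₁lim) ∧
              ∀ t, 0 ≤ t →
                (∀ s, ‖X t s - Peskin.circleCurve a₀lim a₁lim s‖ ≤ C * Real.exp (-c * t)) ∧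
                Peskin.wienerNorm (fun s => X t s - Peskin.circleCurve a₀lim a₁lim s) ≤
                  ENNReal.ofReal (C * Real.exp (-c * t))) ∧
          -- uniqueness
          ∀ (X' : ℝ → ℝ → ℂ) (b₀ b₁ : ℝ → ℂ) (Y' : ℝ → ℝ → ℂ),
            Peskin.IsSolution τ X₀ X' → Peskin.HasDecomposition X' b₀ b₁ Y' →
            Peskin.wNorm Y' ≤ ENNReal.ofReal (C * ε) →
            ∀ t, 0 ≤ t → ∀ s, X' t s = X t s := by
  obtain ⟨c, K, a, hc⟩ := hτ.exists_isExpansion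
  obtain ⟨C, hC, κ, hκ, ε₀, hε₀, hex⟩ := Peskin.exists_solution hc
  obtain ⟨δ, hδ, huniq⟩ := Peskin.IsSolution.unique hc
  -- With `ε ≤ δ / C` the bounds `C ε`, both for the constructed solution and for any competitor,
  -- lie below the uniqueness threshold `δ`.
  refine ⟨min ε₀ (δ / C), by positivity, C, hC, κ, hκ, fun ε hε hεle X₀ hX₀ hper hX₀ε => ?_⟩
  have hCε : ENNReal.ofReal (C * ε) ≤ ENNReal.ofReal δ := by
    refine ENNReal.ofReal_le_ofReal ?_
    rw [mul_comm, ← le_div_iff₀ hC]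
    exact hεle.trans (min_le_right _ _)
  obtain ⟨X, hX, hX2, hXε, hdec⟩ := hex ε hε (hεle.trans (min_le_left _ _)) X₀ hX₀ hper hX₀ε
  exact ⟨X, hX, hX2, hdec, fun X' b₀ b₁ Y' hX' hY' hY'ε =>
    huniq X₀ X X' b₀ b₁ Y' hX hX' (fun t ht => (hXε t ht).trans hCε) hY' (hY'ε.trans hCε)⟩
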